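/- Let $H$ be a Hopf algebra with invertible antipode $S$ over a field $k$ of characteristic zero. Assume that $H$ is pointed (every simple subcoalgebra of $H$ is one-dimensional) and that its group $G$ of grouplike elements is finite. A \emph{partial representation} of $H$ in a $k$-algebra $B$ is a linear map $\pi : H \to B$ such that, for all $h, x \in H$, $$\pi(1) = 1,\qquad \pi(h)\,\pi(x_{(1)})\,\pi(S(x_{(2)})) = \pi(h x_{(1)})\,\pi(S(x_{(2)})),\qquad \pi(x_{(1)})\,\pi(S(x_{(2)}))\,\pi(h) = \pi(x_{(1)})\,\pi(S(x_{(2)})h).$$ A \emph{partial $H$-module} is a $k$-vector space $M$ with a partial representation $H \to \mathrm{End}_k(M)$, $h \mapsto (m \mapsto h \bullet m)$; morphisms are the linear maps $f$ with $f(h \bullet m) = h \bullet f(m)$. Let $\mathsf{PMod}_H$ be the category of partial $H$-modules and $\mathsf{Mod}_H$ the category of left $H$-modules. Let $H_{par}$ be the quotient of the tensor algebra of the vector space $H$ by the relations making the canonical map $h \mapsto [h]$ a partial representation, so that partial $H$-modules are the same as left $H_{par}$-modules. Let $A_{par} \subseteq H_{par}$ be the subalgebra generated by the elements $\varepsilon_h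 = [h_{(1)}][S(h_{(2)})]$, $h \in H$; it is a partial $H$-module via $h \bullet a = [h_{(1)}]\, a\, [S(h_{(2)})]$. For partial modules $M, N$, regard $M \otimes_k H$ as a partial module via $h \bullet (m \otimes x) = h_{(1)} \bullet m \otimes h_{(2)}x$, and let $\{M, N\} = \mathrm{Hom}_{\mathsf{PMod}_H}(M \otimes_k H, N)$, an $H$-module via $(h \rightharpoonup f)(m \otimes x) = f(m \otimes xh)$. For a partial module $M$ define $\varphi : M \to \mathrm{Hom}_k(H, M)$ by $\varphi(m)(x) = x \bullet m$, where $\mathrm{Hom}_k(H, M)$ is an $H$-module via $(h \rightharpoonup f)(x) = f(xh)$. The \emph{standard dilation} $\overline{M}$ is the $H$-submodule of $\mathrm{Hom}_k(H, M)$ generated by $\varphi(M)$. The \emph{dilation functor} $D : \mathsf{PMod}_H \to \mathsf{Mod}_H$ sends $M$ to $\overline{M}$ and a morphism $g$ to $f \mapsto g \circ f$. In particular $\overline{H_{par}}$, the standard dilation of $H_{par}$ with $h \bullet x = [h]x$, is an $(H, H_{par})$-bimodule, with right action $(h \rightharpoonup \varphi(x)) \triangleleft y = h \rightharpoonup \varphi(xy)$.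 Then the dilation functor $D$ is exact and has both a left adjoint and a right adjoint. Moreover, there are natural isomorphisms of functors $\mathsf{PMod}_H \to \mathsf{Mod}_H$ $$D \;\cong\; \{A_{par}, -\} \;\cong\; \overline{H_{par}} \otimes_{H_{par}} -.$$ -/

import Mathlib

open CategoryTheory CategoryTheory.Limits TensorProduct Coalgebra HopfAlgebra

universe u

noncomputable section

namespace PartialHopf

/-! ### Sweedler calculus -/

section Sweedler

variable {k : Type*} [Field k]
variable {C D : Type*} [AddCommMonoid C] [Module k C] [Coalgebra k C]
  [AddCommMonoid D] [Module k D] [Coalgebra k D]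
variable {X Y Z P Q W : Type*} [AddCommMonoid X] [Module k X] [AddCommMonoid Y] [Module k Y]
  [AddCommMonoid Z] [Module k Z] [AddCommMonoid P] [Module k P] [AddCommMonoid Q] [Module k Q]
  [AddCommMonoid W] [Module k W]

/-- `sw β f g` is the linear map `c ↦ β (f c₍₁₎) (g c₍₂₎)` (Sweedler notation). -/
def sw (β : X →ₗ[k] Y →ₗ[k] Z) (f : C →ₗ[k] X) (g : C →ₗ[k] Y) : C →ₗ[k] Z :=
  TensorProduct.lift β ∘ₗ TensorProduct.map f g ∘ₗ comul

theorem sw_assoc (β : P →ₗ[k] W →ₗ[k] Z) (β' : X →ₗ[k] Y →ₗ[k] P)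
    (γ : X →ₗ[k] Q →ₗ[k] Z) (γ' : Y →ₗ[k] W →ₗ[k] Q)
    (h : ∀ x y w, β (β' x y) w = γ x (γ' y w))
    (f : C →ₗ[k] X) (g : C →ₗ[k] Y) (l : C →ₗ[k] W) :
    sw β (sw β' f g) l = sw γ f (sw γ' g l) := by
  ext c
  have key := congrArg (TensorProduct.lift γ ∘ₗ
    TensorProduct.map f (TensorProduct.lift γ' ∘ₗ TensorProduct.map g l)) (coassoc_apply (R := k) c)
  have e1 : ∀ t : C ⊗[k] C, (TensorProduct.lift β ∘ₗ TensorProduct.map (sw β' f g) l) t =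
      (TensorProduct.lift γ ∘ₗ
        TensorProduct.map f (TensorProduct.lift γ' ∘ₗ TensorProduct.map g l))
        (TensorProduct.assoc k C C C (comul.rTensor C t)) := by
    intro t
    induction t with
    | zero => simp
    | add x y hx hy => simp only [map_add, hx, hy]
    | tmul a b =>
      simp only [sw, LinearMap.comp_apply, TensorProduct.map_tmul, TensorProduct.lift.tmul,
        LinearMap.rTensor_tmul]
      generalize comul (R := k) a = s
      induction s with
      | zero => simp
      | add x y hx hy => simp only [map_add, TensorProduct.add_tmul, LinearMap.add_apply, hx, hy]
      | tmul a1 a2 => simp [h]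
  have e2 : ∀ t : C ⊗[k] C, (TensorProduct.lift γ ∘ₗ TensorProduct.map f (sw γ' g l)) t =
      (TensorProduct.lift γ ∘ₗ
        TensorProduct.map f (TensorProduct.lift γ' ∘ₗ TensorProduct.map g l))
        (comul.lTensor C t) := by
    intro t
    induction t with
    | zero => simp
    | add x y hx hy => simp only [map_add, hx, hy]
    | tmul a b => simp [sw]
  exact (e1 _).trans (key.trans (e2 _).symm)

theorem sw_comp (β : X →ₗ[k] Y →ₗ[k] Z) (f : C →ₗ[k] X) (g : C →ₗ[k] Y) (v : D →ₗc[k] C) :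
    sw β f g ∘ₗ v.toLinearMap = sw β (f ∘ₗ v.toLinearMap) (g ∘ₗ v.toLinearMap) := by
  simp only [sw, LinearMap.comp_assoc, TensorProduct.map_comp]
  rw [← v.map_comp_comul]

theorem comp_sw (φ : Z →ₗ[k] W) (β : X →ₗ[k] Y →ₗ[k] Z) (f : C →ₗ[k] X) (g : C →ₗ[k] Y) :
    φ ∘ₗ sw β f g = sw (β.compr₂ φ) f g := by
  ext c
  simp only [sw, LinearMap.comp_apply]
  generalize comul (R := k) c = s
  induction s with
  | zero => simp
  | add x y hx hy => simp only [map_add, hx, hy]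
  | tmul a1 a2 => simp

theorem sw_comp₂ {X' Y' : Type*} [AddCommMonoid X'] [Module k X'] [AddCommMonoid Y'] [Module k Y']
    (β : X →ₗ[k] Y →ₗ[k] Z) (a : X' →ₗ[k] X) (b : Y' →ₗ[k] Y)
    (f : C →ₗ[k] X') (g : C →ₗ[k] Y') :
    sw β (a ∘ₗ f) (b ∘ₗ g) = sw (β.compl₁₂ a b) f g := by
  ext c
  simp only [sw, LinearMap.comp_apply]
  generalize comul (R := k) c = s
  induction s with
  | zero => simp
  | add x y hx hy => simp only [map_add, hx, hy]
  | tmul a1 a2 => simp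

theorem comul_comp_coalgHom (v : D →ₗc[k] C) :
    comul ∘ₗ v.toLinearMap =
      sw (TensorProduct.mk k C C) v.toLinearMap v.toLinearMap := by
  rw [sw, TensorProduct.lift_mk, LinearMap.id_comp, v.map_comp_comul]

/-- The linear map `c ↦ ε(c) a`. -/
def cst (a : X) : C →ₗ[k] X := LinearMap.toSpanSingleton k X a ∘ₗ counit

theorem sw_cst_left (β : X →ₗ[k] Y →ₗ[k] Z) (a : X) (g : C →ₗ[k] Y) :
    sw β (cst a) g = β a ∘ₗ g := by
  ext c
  have h := congrArg (TensorProduct.lift (β.compl₁₂ (LinearMap.toSpanSingleton k X a) g))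
    (rTensor_counit_comul (R := k) c)
  simp only [TensorProduct.lift.tmul, LinearMap.compl₁₂_apply,
    LinearMap.toSpanSingleton_apply, one_smul] at h
  rw [LinearMap.comp_apply, ← h]
  simp only [sw, cst, LinearMap.comp_apply]
  generalize comul (R := k) c = s
  induction s with
  | zero => simp
  | add x y hx hy => simp only [map_add, hx, hy]
  | tmul a1 a2 => simp

theorem sw_cst_right (β : X →ₗ[k] Y →ₗ[k] Z) (f : C →ₗ[k] X) (b : Y) :
    sw β f (cst b) = β.flip b ∘ₗ f := by
  ext c
  have h := congrArg (TensorProduct.lift (β.compl₁₂ f (LinearMap.toSpanSingleton k Y b)))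
    (lTensor_counit_comul (R := k) c)
  simp only [TensorProduct.lift.tmul, LinearMap.compl₁₂_apply,
    LinearMap.toSpanSingleton_apply, one_smul] at h
  rw [LinearMap.comp_apply, LinearMap.flip_apply, ← h]
  simp only [sw, cst, LinearMap.comp_apply]
  generalize comul (R := k) c = s
  induction s with
  | zero => simp
  | add x y hx hy => simp only [map_add, hx, hy]
  | tmul a1 a2 => simp

theorem cst_comp (a : X) (v : D →ₗc[k] C) :
    (cst a : C →ₗ[k] X) ∘ₗ v.toLinearMap = cst a := by
  simp only [cst, LinearMap.comp_assoc, v.counit_comp]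

theorem comp_cst (φ : X →ₗ[k] Y) (a : X) : φ ∘ₗ (cst a : C →ₗ[k] X) = cst (φ a) := by
  ext c; simp [cst]

/-- The first projection `c ⊗ d ↦ ε(d) c`, a morphism of coalgebras. -/
def prL : C ⊗[k] D →ₗc[k] C :=
  (Coalgebra.TensorProduct.rid k k C).toCoalgHom.comp
    (Coalgebra.TensorProduct.map (CoalgHom.id k C) (counitCoalgHom k D))

/-- The second projection `c ⊗ d ↦ ε(c) d`, a morphism of coalgebras. -/
def prR : C ⊗[k] D →ₗc[k] D :=
  (Coalgebra.TensorProduct.lid k D).toCoalgHom.comp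
    (Coalgebra.TensorProduct.map (counitCoalgHom k C) (CoalgHom.id k D))

theorem prL_tmul (c : C) (d : D) :
    (prL : C ⊗[k] D →ₗc[k] C) (c ⊗ₜ d) = counit (R := k) d • c := rfl

theorem prR_tmul (c : C) (d : D) :
    (prR : C ⊗[k] D →ₗc[k] D) (c ⊗ₜ d) = counit (R := k) c • d := rfl

theorem sw_prR (β : X →ₗ[k] Y →ₗ[k] Z) (F : C ⊗[k] D →ₗ[k] X) (G : D →ₗ[k] Y) (c : C) (d : D) :
    sw β F (G ∘ₗ (prR : C ⊗[k] D →ₗc[k] D).toLinearMap) (c ⊗ₜ d) =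
      sw β (F ∘ₗ TensorProduct.mk k C D c) G d := by
  have h := lTensor_counit_comul (R := k) c
  have h2 := congrArg (TensorProduct.rid k C) h
  simp only [TensorProduct.rid_tmul, one_smul] at h2
  conv_rhs => rw [← h2]
  simp only [sw, LinearMap.comp_apply, TensorProduct.comul_tmul]
  generalize comul (R := k) c = s
  generalize comul (R := k) d = t
  induction s with
  | zero => simp
  | add x y hx hy =>
    simp only [map_add, TensorProduct.add_tmul, hx, hy, LinearMap.comp_add,
      TensorProduct.map_add_left, LinearMap.add_apply]
  | tmul a1 a2 =>
    induction t with
    | zero => simp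
    | add x y hx hy => simp only [map_add, TensorProduct.tmul_add, hx, hy]
    | tmul b1 b2 => simp [prR_tmul]

theorem sw_prL (β : X →ₗ[k] Y →ₗ[k] Z) (F : C ⊗[k] D →ₗ[k] Y) (G : C →ₗ[k] X) (c : C) (d : D) :
    sw β (G ∘ₗ (prL : C ⊗[k] D →ₗc[k] C).toLinearMap) F (c ⊗ₜ d) =
      sw β G (F ∘ₗ (TensorProduct.mk k C D).flip d) c := by
  have h := rTensor_counit_comul (R := k) d
  have h2 := congrArg (TensorProduct.lid k D) h
  simp only [TensorProduct.lid_tmul, one_smul] at h2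
  conv_rhs => rw [← h2]
  simp only [sw, LinearMap.comp_apply, TensorProduct.comul_tmul]
  generalize comul (R := k) c = s
  generalize comul (R := k) d = t
  induction t with
  | zero => simp
  | add x y hx hy =>
    simp only [map_add, TensorProduct.tmul_add, hx, hy, LinearMap.comp_add,
      TensorProduct.map_add_right, LinearMap.add_apply]
  | tmul a1 a2 =>
    induction s with
    | zero => simp
    | add x y hx hy => simp only [map_add, TensorProduct.add_tmul, hx, hy]
    | tmul b1 b2 => simp [prL_tmul]

theorem sw_prL' (β : X →ₗ[k] Y →ₗ[k] Z) (F : C ⊗[k] D →ₗ[k] X) (G : C →ₗ[k] Y) (c : C) (d : D) :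
    sw β F (G ∘ₗ (prL : C ⊗[k] D →ₗc[k] C).toLinearMap) (c ⊗ₜ d) =
      sw β (F ∘ₗ (TensorProduct.mk k C D).flip d) G c := by
  have h := lTensor_counit_comul (R := k) d
  have h2 := congrArg (TensorProduct.rid k D) h
  simp only [TensorProduct.rid_tmul, one_smul] at h2
  conv_rhs => rw [← h2]
  simp only [sw, LinearMap.comp_apply, TensorProduct.comul_tmul]
  generalize comul (R := k) c = s
  generalize comul (R := k) d = t
  induction t with
  | zero => simp
  | add x y hx hy =>
    simp only [map_add, TensorProduct.tmul_add, hx, hy, LinearMap.comp_add,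
      TensorProduct.map_add_left, LinearMap.add_apply]
  | tmul a1 a2 =>
    induction s with
    | zero => simp
    | add x y hx hy => simp only [map_add, TensorProduct.add_tmul, hx, hy]
    | tmul b1 b2 => simp [prL_tmul]

theorem sw_prL_prR (β : X →ₗ[k] Y →ₗ[k] Z) (F : C →ₗ[k] X) (G : D →ₗ[k] Y) (c : C) (d : D) :
    sw β (F ∘ₗ (prL : C ⊗[k] D →ₗc[k] C).toLinearMap)
      (G ∘ₗ (prR : C ⊗[k] D →ₗc[k] D).toLinearMap) (c ⊗ₜ d) = β (F c) (G d) := by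
  rw [sw_prR]
  have : (F ∘ₗ (prL : C ⊗[k] D →ₗc[k] C).toLinearMap) ∘ₗ TensorProduct.mk k C D c =
      cst (F c) := by
    ext x; simp [prL_tmul, cst]
  rw [this, sw_cst_left]; rfl

theorem sw_prR_prL (β : Y →ₗ[k] X →ₗ[k] Z) (F : C →ₗ[k] X) (G : D →ₗ[k] Y) (c : C) (d : D) :
    sw β (G ∘ₗ (prR : C ⊗[k] D →ₗc[k] D).toLinearMap)
      (F ∘ₗ (prL : C ⊗[k] D →ₗc[k] C).toLinearMap) (c ⊗ₜ d) = β (G d) (F c) := by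
  have h1 := rTensor_counit_comul (R := k) d
  have h2 := lTensor_counit_comul (R := k) c
  have h1' := congrArg (TensorProduct.lid k D) h1
  have h2' := congrArg (TensorProduct.rid k C) h2
  have h3 := lTensor_counit_comul (R := k) d
  have h4 := rTensor_counit_comul (R := k) c
  have h3' := congrArg (TensorProduct.rid k D) h3
  have h4' := congrArg (TensorProduct.lid k C) h4
  simp only [TensorProduct.lid_tmul, TensorProduct.rid_tmul, one_smul] at h1' h2' h3' h4'
  conv_rhs => rw [← h3', ← h4']
  simp only [sw, LinearMap.comp_apply, TensorProduct.comul_tmul]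
  generalize comul (R := k) c = s
  generalize comul (R := k) d = t
  induction s with
  | zero => simp
  | add x y hx hy => simp only [map_add, TensorProduct.add_tmul, hx, hy]
  | tmul a1 a2 =>
    induction t with
    | zero => simp
    | add x y hx hy => simp only [map_add, TensorProduct.tmul_add, hx, hy, LinearMap.add_apply]
    | tmul b1 b2 => 
      simp only [TensorProduct.AlgebraTensorModule.tensorTensorTensorComm_tmul,
        TensorProduct.map_tmul, TensorProduct.lift.tmul, LinearMap.comp_apply,
        LinearMap.rTensor_tmul, LinearMap.lTensor_tmul, TensorProduct.lid_tmul,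
        TensorProduct.rid_tmul, map_smul, LinearMap.smul_apply,
        CoalgHom.coe_toLinearMap, CoalgHom.toLinearMap_eq_coe, prL_tmul, prR_tmul]
      rw [smul_comm]

end Sweedler

/-! ### Partial representations -/

section Conv

variable {k : Type*} [Field k] {H : Type*} [Ring H] [HopfAlgebra k H]
variable {C : Type*} [AddCommMonoid C] [Module k C] [Coalgebra k C]
variable {B : Type*} [Ring B] [Algebra k B] {B' : Type*} [Ring B'] [Algebra k B']

/-- The convolution product `c ↦ f(c₍₁₎) g(c₍₂₎)` of two linear maps into an algebra. -/
abbrev conv (f g : C →ₗ[k] B) : C →ₗ[k] B := sw (LinearMap.mul k B) f g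

/-- The linear map `h ↦ π(S(h))`. -/
abbrev antip (π : H →ₗ[k] B) : H →ₗ[k] B := π ∘ₗ antipode k

/-- A linear map `π : H → B` is a partial representation if `π(1) = 1`,
`π(h) π(x₍₁₎) π(S(x₍₂₎)) = π(h x₍₁₎) π(S(x₍₂₎))` and
`π(x₍₁₎) π(S(x₍₂₎)) π(h) = π(x₍₁₎) π(S(x₍₂₎) h)` for all `h` and `x`. -/
structure IsPartialRep (π : H →ₗ[k] B) : Prop where
  map_one : π 1 = 1
  left_mul : ∀ h x : H,
    π h * conv π (antip π) x = conv (π ∘ₗ LinearMap.mulLeft k h) (antip π) x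
  mul_right : ∀ x h : H,
    conv π (antip π) x * π h = conv π (π ∘ₗ LinearMap.mulRight k h ∘ₗ antipode k) x

theorem conv_assoc (f g h : C →ₗ[k] B) : conv (conv f g) h = conv f (conv g h) :=
  sw_assoc _ _ _ _ (fun x y w => by simp [mul_assoc]) f g h

theorem conv_one (f : C →ₗ[k] B) : conv f (cst 1) = f := by
  rw [conv, sw_cst_right]; ext; simp

theorem one_conv (f : C →ₗ[k] B) : conv (cst 1) f = f := by
  rw [conv, sw_cst_left]; ext; simp

theorem conv_comp {D : Type*} [AddCommMonoid D] [Module k D] [Coalgebra k D]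
    (f g : C →ₗ[k] B) (v : D →ₗc[k] C) :
    conv f g ∘ₗ v.toLinearMap = conv (f ∘ₗ v.toLinearMap) (g ∘ₗ v.toLinearMap) :=
  sw_comp _ _ _ _

theorem algHom_comp_conv (φ : B →ₐ[k] B') (f g : C →ₗ[k] B) :
    φ.toLinearMap ∘ₗ conv f g = conv (φ.toLinearMap ∘ₗ f) (φ.toLinearMap ∘ₗ g) := by
  rw [conv, conv, comp_sw, sw_comp₂]
  congr 1
  ext x y
  simp

theorem algHom_conv_apply (φ : B →ₐ[k] B') (f g : C →ₗ[k] B) (c : C) :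
    φ (conv f g c) = conv (φ.toLinearMap ∘ₗ f) (φ.toLinearMap ∘ₗ g) c :=
  LinearMap.congr_fun (algHom_comp_conv φ f g) c

theorem IsPartialRep.algHom_comp {π : H →ₗ[k] B} (hπ : IsPartialRep π) (φ : B →ₐ[k] B') :
    IsPartialRep (φ.toLinearMap ∘ₗ π) where
  map_one := by simp [hπ.map_one]
  left_mul h x := by
    have := congrArg φ (hπ.left_mul h x)
    rwa [map_mul, algHom_conv_apply, algHom_conv_apply] at this
  mul_right x h := by
    have := congrArg φ (hπ.mul_right x h)
    rwa [map_mul, algHom_conv_apply, algHom_conv_apply] at this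

/-! The three projections `p`, `q` and the multiplication `m`, as maps from `H ⊗ H`. -/

variable (k H) in
/-- `p : h ⊗ x ↦ ε(x) h`. -/
abbrev pp : H ⊗[k] H →ₗc[k] H := prL

variable (k H) in
/-- `q : h ⊗ x ↦ ε(h) x`. -/
abbrev qq : H ⊗[k] H →ₗc[k] H := prR

variable (k H) in
/-- `m : h ⊗ x ↦ h x`. -/
abbrev mm : H ⊗[k] H →ₗc[k] H := Bialgebra.mulCoalgHom k H

theorem conv_pp_qq : conv (pp k H).toLinearMap (qq k H).toLinearMap = (mm k H).toLinearMap := by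
  ext h x
  have := sw_prL_prR (k := k) (LinearMap.mul k H) LinearMap.id LinearMap.id h x
  simpa using this

theorem id_conv_antipode (v : C →ₗc[k] H) :
    conv v.toLinearMap (antipode k ∘ₗ v.toLinearMap) = cst 1 := by
  have : conv (LinearMap.id : H →ₗ[k] H) (antipode k) = cst 1 := by
    ext x
    have := HopfAlgebra.mul_antipode_lTensor_comul_apply (R := k) x
    rw [Algebra.algebraMap_eq_smul_one] at this
    exact this
  have h := congrArg (fun f => f ∘ₗ v.toLinearMap) this
  simpa only [conv_comp, cst_comp, LinearMap.id_comp] using h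

theorem antipode_conv_id (v : C →ₗc[k] H) :
    conv (antipode k ∘ₗ v.toLinearMap) v.toLinearMap = cst 1 := by
  have : conv (antipode k) (LinearMap.id : H →ₗ[k] H) = cst 1 := by
    ext x
    have := HopfAlgebra.mul_antipode_rTensor_comul_apply (R := k) x
    rw [Algebra.algebraMap_eq_smul_one] at this
    exact this
  have h := congrArg (fun f => f ∘ₗ v.toLinearMap) this
  simpa only [conv_comp, cst_comp, LinearMap.id_comp] using h

theorem antipode_mm : antipode k ∘ₗ (mm k H).toLinearMap =
    conv (antipode k ∘ₗ (qq k H).toLinearMap) (antipode k ∘ₗ (pp k H).toLinearMap) := by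
  ext h x
  have := sw_prR_prL (k := k) (LinearMap.mul k H) (antipode k) (antipode k) h x
  simpa [HopfAlgebra.antipode_mul_antidistrib] using this.symm

end Conv

section PartialRep

variable {k : Type*} [Field k] {H : Type*} [Ring H] [HopfAlgebra k H]
variable {C : Type*} [AddCommMonoid C] [Module k C] [Coalgebra k C]
variable {B : Type*} [Ring B] [Algebra k B]
variable {π : H →ₗ[k] B}

/-- Both relations, stated over `H ⊗ H`, imply that `π` is a partial representation. -/
theorem IsPartialRep.mk' (h1 : π 1 = 1)
    (h2 : conv (π ∘ₗ (pp k H).toLinearMap)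
        (conv (π ∘ₗ (qq k H).toLinearMap) (antip π ∘ₗ (qq k H).toLinearMap)) =
      conv (π ∘ₗ (mm k H).toLinearMap) (antip π ∘ₗ (qq k H).toLinearMap))
    (h3 : conv (conv (π ∘ₗ (pp k H).toLinearMap) (antip π ∘ₗ (pp k H).toLinearMap))
        (π ∘ₗ (qq k H).toLinearMap) =
      conv (π ∘ₗ (pp k H).toLinearMap)
        (π ∘ₗ conv (antipode k ∘ₗ (pp k H).toLinearMap) (qq k H).toLinearMap)) :
    IsPartialRep π where
  map_one := h1
  left_mul h x := by
    have := LinearMap.congr_fun h2 (h ⊗ₜ x)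
    rw [← conv_comp, conv, sw_prL_prR, sw_prR] at this
    exact this
  mul_right x h := by
    have := LinearMap.congr_fun h3 (x ⊗ₜ h)
    rw [← conv_comp, conv, sw_prL_prR, sw_prL] at this
    refine this.trans ?_
    congr 2
    ext y
    have := sw_prL_prR (k := k) (LinearMap.mul k H) (antipode k) LinearMap.id y h
    exact congrArg π this

theorem sw_linear_left (β : H →ₗ[k] H →ₗ[k] B) (u : C →ₗ[k] H) (v : C →ₗ[k] H)
    (Λ : H →ₗ[k] (H ⊗[k] H) →ₗ[k] B) (h : ∀ y z, β y z = Λ y (comul z)) :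
    sw β u v = sw Λ u (comul ∘ₗ v) := by
  have : sw Λ u (comul ∘ₗ v) = sw (Λ.compl₁₂ LinearMap.id comul) (LinearMap.id ∘ₗ u) v := by
    conv_lhs => rw [← LinearMap.id_comp u]
    rw [sw_comp₂]; rfl
  rw [this, LinearMap.id_comp]
  congr 1
  ext y z
  exact h y z

theorem sw_linear_right (β : H →ₗ[k] H →ₗ[k] B) (v : C →ₗ[k] H) (u : C →ₗ[k] H)
    (Λ : (H ⊗[k] H) →ₗ[k] H →ₗ[k] B) (h : ∀ z y, β z y = Λ (comul z) y) :
    sw β v u = sw Λ (comul ∘ₗ v) u := by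
  have : sw Λ (comul ∘ₗ v) u = sw (Λ.compl₁₂ comul LinearMap.id) v (LinearMap.id ∘ₗ u) := by
    conv_lhs => rw [← LinearMap.id_comp u]
    rw [sw_comp₂]; rfl
  rw [this, LinearMap.id_comp]
  congr 1
  ext y z
  exact h y z

/-- The first relation along a linear map `u` and a morphism of coalgebras `v`. -/
theorem IsPartialRep.rel_left (hπ : IsPartialRep π) (u : C →ₗ[k] H) (v : C →ₗc[k] H) :
    conv (π ∘ₗ u) (conv (π ∘ₗ v.toLinearMap) (antip π ∘ₗ v.toLinearMap)) =
      conv (π ∘ₗ conv u v.toLinearMap) (antip π ∘ₗ v.toLinearMap) := by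
  let Λ : H →ₗ[k] (H ⊗[k] H) →ₗ[k] B := TensorProduct.curry
    (TensorProduct.lift ((LinearMap.mul k B).compl₁₂ (π ∘ₗ LinearMap.mul' k H) (antip π)) ∘ₗ
      (TensorProduct.assoc k H H H).symm.toLinearMap)
  have hΛ : ∀ y a b, Λ y (a ⊗ₜ b) = π (y * a) * antip π b := fun y a b => by simp [Λ]
  have e1 : conv (π ∘ₗ u) (conv (π ∘ₗ v.toLinearMap) (antip π ∘ₗ v.toLinearMap)) =
      sw Λ u (comul ∘ₗ v.toLinearMap) := by
    rw [← conv_comp, conv, sw_comp₂]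
    refine sw_linear_left _ _ _ _ fun y z => (hπ.left_mul y z).trans ?_
    simp only [conv, sw, LinearMap.comp_apply]
    generalize comul (R := k) z = s
    induction s with
    | zero => simp
    | add x y hx hy => simp only [map_add, hx, hy]
    | tmul a b => simp [hΛ]
  have e2 : sw ((LinearMap.mul k B).compl₁₂ LinearMap.id (antip π))
      (sw ((LinearMap.mul k H).compr₂ π) u v.toLinearMap) v.toLinearMap =
      sw Λ u (sw (TensorProduct.mk k H H) v.toLinearMap v.toLinearMap) :=
    sw_assoc _ _ _ _ (fun x y w => by simp [hΛ]) _ _ _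
  rw [e1, comul_comp_coalgHom, ← e2, ← comp_sw, ← sw_comp₂, LinearMap.id_comp]

/-- The second relation along a linear map `u` and a morphism of coalgebras `v`. -/
theorem IsPartialRep.rel_right (hπ : IsPartialRep π) (u : C →ₗ[k] H) (v : C →ₗc[k] H) :
    conv (π ∘ₗ v.toLinearMap) (conv (antip π ∘ₗ v.toLinearMap) (π ∘ₗ u)) =
      conv (π ∘ₗ v.toLinearMap) (π ∘ₗ conv (antipode k ∘ₗ v.toLinearMap) u) := by
  rw [← conv_assoc]
  let Λ : (H ⊗[k] H) →ₗ[k] H →ₗ[k] B := TensorProduct.curry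
    (TensorProduct.lift ((LinearMap.mul k B).compl₁₂ π
      (π ∘ₗ LinearMap.mul' k H ∘ₗ (antipode k).rTensor H)) ∘ₗ
      (TensorProduct.assoc k H H H).toLinearMap)
  have hΛ : ∀ y a b, Λ (a ⊗ₜ b) y = π a * π (antipode k b * y) := fun y a b => by simp [Λ]
  have e1 : conv (conv (π ∘ₗ v.toLinearMap) (antip π ∘ₗ v.toLinearMap)) (π ∘ₗ u) =
      sw Λ (comul ∘ₗ v.toLinearMap) u := by
    rw [← conv_comp, conv, sw_comp₂]
    refine sw_linear_right _ _ _ _ fun z y => (hπ.mul_right z y).trans ?_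
    simp only [conv, sw, LinearMap.comp_apply]
    generalize comul (R := k) z = s
    induction s with
    | zero => simp
    | add x y hx hy => simp only [map_add, hx, hy, LinearMap.add_apply]
    | tmul a b => simp [hΛ]
  have e2 : sw Λ (sw (TensorProduct.mk k H H) v.toLinearMap v.toLinearMap) u =
      sw ((LinearMap.mul k B).compl₁₂ π LinearMap.id) v.toLinearMap
        (sw (((LinearMap.mul k H).compl₁₂ (antipode k) LinearMap.id).compr₂ π)
          v.toLinearMap u) :=
    sw_assoc _ _ _ _ (fun x y w => by simp [hΛ]) _ _ _
  rw [e1, comul_comp_coalgHom, e2, ← comp_sw, ← sw_comp₂, ← sw_comp₂, LinearMap.id_comp,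
    LinearMap.id_comp]

theorem IsPartialRep.comp_cst_one (hπ : IsPartialRep π) :
    π ∘ₗ (cst 1 : C →ₗ[k] H) = cst 1 := by rw [comp_cst, hπ.map_one]

/-- `π(v₁) π(S v₂) π(v₃) = π(v)`. -/
theorem IsPartialRep.triple (hπ : IsPartialRep π) (v : C →ₗc[k] H) :
    conv (π ∘ₗ v.toLinearMap) (conv (antip π ∘ₗ v.toLinearMap) (π ∘ₗ v.toLinearMap)) =
      π ∘ₗ v.toLinearMap := by
  rw [hπ.rel_right, antipode_conv_id, hπ.comp_cst_one, conv_one]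

/-- `π(S v₁) π(v₂) π(S v₃) = π(S v)`. -/
theorem IsPartialRep.triple' (hπ : IsPartialRep π) (v : C →ₗc[k] H) :
    conv (antip π ∘ₗ v.toLinearMap) (conv (π ∘ₗ v.toLinearMap) (antip π ∘ₗ v.toLinearMap)) =
      antip π ∘ₗ v.toLinearMap := by
  have := hπ.rel_left (antipode k ∘ₗ v.toLinearMap) v
  rwa [antipode_conv_id, hπ.comp_cst_one, one_conv] at this

theorem IsPartialRep.rel_left' (hπ : IsPartialRep π) (u : C →ₗ[k] H) (v : C →ₗc[k] H) :
    conv (π ∘ₗ u) (conv (antip π ∘ₗ v.toLinearMap) (π ∘ₗ v.toLinearMap)) =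
      conv (π ∘ₗ conv u (antipode k ∘ₗ v.toLinearMap)) (π ∘ₗ v.toLinearMap) := by
  conv_rhs => rw [← hπ.triple v, ← conv_assoc, ← conv_assoc, conv_assoc (π ∘ₗ _),
    hπ.rel_left, conv_assoc u, antipode_conv_id, conv_one]
  rw [conv_assoc]

theorem IsPartialRep.rel_right' (hπ : IsPartialRep π) (u : C →ₗ[k] H) (v : C →ₗc[k] H) :
    conv (antip π ∘ₗ v.toLinearMap) (conv (π ∘ₗ v.toLinearMap) (π ∘ₗ u)) =
      conv (antip π ∘ₗ v.toLinearMap) (π ∘ₗ conv v.toLinearMap u) := by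
  conv_rhs => rw [← hπ.triple' v, conv_assoc, conv_assoc, hπ.rel_right, ← conv_assoc (_ ∘ₗ _) _ u,
    antipode_conv_id, one_conv]

/-- `π(S h₁) π(h₂) π(x₁) π(S x₂) = π(x₁) π(S x₂) π(S h₁) π(h₂)`. -/
theorem IsPartialRep.comm_conv (hπ : IsPartialRep π) :
    conv (antip π ∘ₗ (pp k H).toLinearMap) (conv (π ∘ₗ (pp k H).toLinearMap)
      (conv (π ∘ₗ (qq k H).toLinearMap) (antip π ∘ₗ (qq k H).toLinearMap))) =
    conv (π ∘ₗ (qq k H).toLinearMap) (conv (antip π ∘ₗ (qq k H).toLinearMap)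
      (conv (antip π ∘ₗ (pp k H).toLinearMap) (π ∘ₗ (pp k H).toLinearMap))) := by
  have e1 : conv (antipode k ∘ₗ (pp k H).toLinearMap) (mm k H).toLinearMap =
      (qq k H).toLinearMap := by
    rw [← conv_pp_qq, ← conv_assoc, antipode_conv_id, one_conv]
  have e2 : conv (mm k H).toLinearMap (antipode k ∘ₗ (qq k H).toLinearMap) =
      (pp k H).toLinearMap := by
    rw [← conv_pp_qq, conv_assoc, id_conv_antipode, conv_one]
  have r1 := hπ.rel_left (antipode k ∘ₗ (pp k H).toLinearMap) (mm k H)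
  rw [e1] at r1
  have r2 := hπ.rel_right' (antipode k ∘ₗ (qq k H).toLinearMap) (mm k H)
  rw [e2] at r2
  have r3 := hπ.rel_left' (antipode k ∘ₗ (qq k H).toLinearMap) (pp k H)
  rw [← antipode_mm] at r3
  rw [hπ.rel_left, conv_pp_qq]
  calc conv (antip π ∘ₗ (pp k H).toLinearMap)
        (conv (π ∘ₗ (mm k H).toLinearMap) (antip π ∘ₗ (qq k H).toLinearMap))
      = conv (conv (antip π ∘ₗ (pp k H).toLinearMap)
          (conv (π ∘ₗ (mm k H).toLinearMap) (antip π ∘ₗ (mm k H).toLinearMap)))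
          (conv (π ∘ₗ (mm k H).toLinearMap) (antip π ∘ₗ (qq k H).toLinearMap)) := by
        conv_lhs => rw [← hπ.triple (mm k H)]
        simp only [conv_assoc]
    _ = conv (conv (π ∘ₗ (qq k H).toLinearMap) (antip π ∘ₗ (mm k H).toLinearMap))
          (conv (π ∘ₗ (mm k H).toLinearMap) (antip π ∘ₗ (qq k H).toLinearMap)) :=
        congrArg (fun f => conv f _) r1
    _ = conv (π ∘ₗ (qq k H).toLinearMap) (conv (antip π ∘ₗ (mm k H).toLinearMap)
          (π ∘ₗ (pp k H).toLinearMap)) := by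
        rw [conv_assoc]
        exact congrArg (conv _) r2
    _ = _ := congrArg (conv _) r3.symm

/-- The linear map `h ↦ ε_h = π(h₍₁₎) π(S(h₍₂₎))`. -/
abbrev eps (π : H →ₗ[k] B) : H →ₗ[k] B := conv π (antip π)

theorem IsPartialRep.eps_comm (hπ : IsPartialRep π) (h x : H) :
    conv (antip π) π h * eps π x = eps π x * conv (antip π) π h := by
  have := LinearMap.congr_fun hπ.comm_conv (h ⊗ₜ x)
  rw [← conv_assoc, ← conv_assoc (π ∘ₗ (qq k H).toLinearMap), ← conv_comp, ← conv_comp,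
    conv, sw_prL_prR, conv, sw_prR_prL] at this
  exact this

/-- The subalgebra generated by the elements `ε_h = π(h₍₁₎) π(S(h₍₂₎))`. -/
def epsAlg (π : H →ₗ[k] B) : Subalgebra k B := Algebra.adjoin k (Set.range (eps π))

theorem IsPartialRep.epsAlg_comm (hπ : IsPartialRep π) {a : B} (ha : a ∈ epsAlg π) (h : H) :
    conv (antip π) π h * a = a * conv (antip π) π h := by
  have : epsAlg π ≤ Subalgebra.centralizer k (Set.range (conv (antip π) π)) := by
    refine Algebra.adjoin_le ?_
    rintro _ ⟨x, rfl⟩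
    rw [SetLike.mem_coe, Subalgebra.mem_centralizer_iff]
    rintro _ ⟨y, rfl⟩
    exact hπ.eps_comm y x
  exact (Subalgebra.mem_centralizer_iff k).1 (this ha) _ ⟨h, rfl⟩

/-- The linear map `h ↦ (a ↦ π(h₍₁₎) a π(S(h₍₂₎)))`. -/
def adj (π : H →ₗ[k] B) : H →ₗ[k] Module.End k B :=
  conv (LinearMap.mul k B ∘ₗ π) ((LinearMap.mul k B).flip ∘ₗ antip π)

theorem cst_conv (a : B) (f : C →ₗ[k] B) : conv (cst a) f = LinearMap.mulLeft k a ∘ₗ f := by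
  rw [conv, sw_cst_left]; rfl

theorem conv_cst (a : B) (f : C →ₗ[k] B) : conv f (cst a) = LinearMap.mulRight k a ∘ₗ f := by
  rw [conv, sw_cst_right]; rfl

theorem adj_flip (π : H →ₗ[k] B) (a : B) :
    (adj π).flip a = conv π (conv (cst a) (antip π)) := by
  rw [cst_conv, adj]
  ext h
  simp only [LinearMap.flip_apply, conv, sw, LinearMap.comp_apply]
  generalize comul (R := k) h = s
  induction s with
  | zero => simp
  | add x y hx hy => simp only [map_add, hx, hy, LinearMap.add_apply]
  | tmul a b => simp

/-- `h · (k · a)`-type words: `adj h (G x) = π(h₁) G(x) π(S h₂)`. -/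
theorem adj_apply_tmul (π : H →ₗ[k] B) (G : H →ₗ[k] B) (h x : H) :
    adj π h (G x) = conv (π ∘ₗ (pp k H).toLinearMap) (conv (G ∘ₗ (qq k H).toLinearMap)
      (antip π ∘ₗ (pp k H).toLinearMap)) (h ⊗ₜ x) := by
  rw [conv, sw_prL, ← LinearMap.flip_apply (adj π), adj_flip, cst_conv]
  congr 2
  ext y
  exact (sw_prR_prL (k := k) (LinearMap.mul k B) (antip π) G y x).symm

theorem IsPartialRep.adj_conv (hπ : IsPartialRep π) {a : B} (ha : a ∈ epsAlg π)
    (v : C →ₗc[k] H) :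
    conv ((adj π).flip a ∘ₗ v.toLinearMap) (π ∘ₗ v.toLinearMap) =
      conv (π ∘ₗ v.toLinearMap) (cst a) := by
  rw [adj_flip, ← conv_comp]
  have e : conv (cst a) (conv (antip π) π) = conv (conv (antip π) π) (cst a) := by
    rw [cst_conv, conv_cst]
    ext h
    exact (hπ.epsAlg_comm ha h).symm
  have t := hπ.triple (CoalgHom.id k H)
  rw [conv_assoc, conv_assoc, e, ← conv_assoc]
  have t' : conv π (conv (antip π) π) = π := t
  rw [t', conv_comp, cst_comp]

theorem IsPartialRep.adj_mul (hπ : IsPartialRep π) {a : B} (ha : a ∈ epsAlg π) (b : B) :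
    (adj π).flip (a * b) = conv ((adj π).flip a) ((adj π).flip b) := by
  have h : conv ((adj π).flip a) π = conv π (cst a) := hπ.adj_conv ha (CoalgHom.id k H)
  have e : (cst (a * b) : H →ₗ[k] B) = conv (cst a) (cst b) := by rw [cst_conv, comp_cst]; rfl
  rw [adj_flip π b, ← conv_assoc, h, adj_flip, e]
  simp only [conv_assoc]

theorem adj_one (π : H →ₗ[k] B) : (adj π).flip 1 = eps π := by
  rw [adj_flip, one_conv]

theorem conv_mem (A : Subalgebra k B) {f g : C →ₗ[k] B} (hf : ∀ c, f c ∈ A) (hg : ∀ c, g c ∈ A)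
    (c : C) : conv f g c ∈ A := by
  simp only [conv, sw, LinearMap.comp_apply]
  generalize comul (R := k) c = s
  induction s with
  | zero => simp
  | add x y hx hy => simpa only [map_add] using add_mem hx hy
  | tmul a b => simpa using mul_mem (hf a) (hg b)

theorem eps_mem (π : H →ₗ[k] B) (h : H) : eps π h ∈ epsAlg π :=
  Algebra.subset_adjoin ⟨h, rfl⟩

theorem comp_mm_prod (π : H →ₗ[k] B) : antip π ∘ₗ (mm k H).toLinearMap =
    π ∘ₗ conv (antipode k ∘ₗ (qq k H).toLinearMap) (antipode k ∘ₗ (pp k H).toLinearMap) := by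
  rw [← antipode_mm]; rfl

/-- `π(h) ε_x = ε_{h₁ x} π(h₂)`. -/
theorem IsPartialRep.pi_eps (hπ : IsPartialRep π) :
    conv (π ∘ₗ (pp k H).toLinearMap) (eps π ∘ₗ (qq k H).toLinearMap) =
      conv (eps π ∘ₗ (mm k H).toLinearMap) (π ∘ₗ (pp k H).toLinearMap) := by
  have r3 := hπ.rel_left' (antipode k ∘ₗ (qq k H).toLinearMap) (pp k H)
  rw [← antipode_mm] at r3
  have r4 : conv (antip π ∘ₗ (mm k H).toLinearMap) (π ∘ₗ (pp k H).toLinearMap) =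
    conv (antip π ∘ₗ (qq k H).toLinearMap) (conv (antip π ∘ₗ (pp k H).toLinearMap)
      (π ∘ₗ (pp k H).toLinearMap)) := r3.symm
  rw [conv_comp, conv_comp, conv_assoc, r4, ← conv_assoc (π ∘ₗ (mm k H).toLinearMap),
    ← conv_pp_qq, ← hπ.rel_left, conv_assoc, conv_assoc, ← hπ.comm_conv]
  conv_lhs => rw [← hπ.triple (pp k H)]
  simp only [conv_assoc]

theorem IsPartialRep.adj_eps (hπ : IsPartialRep π) (h x : H) :
    adj π h (eps π x) = conv (eps π ∘ₗ (mm k H).toLinearMap) (eps π ∘ₗ (pp k H).toLinearMap)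
      (h ⊗ₜ x) := by
  rw [adj_apply_tmul, ← conv_assoc, hπ.pi_eps, conv_assoc, ← conv_comp π (antip π) (pp k H)]

theorem IsPartialRep.adj_eps_mem (hπ : IsPartialRep π) (h x : H) :
    adj π h (eps π x) ∈ epsAlg π :=
  (hπ.adj_eps h x).symm ▸
    conv_mem (epsAlg π) (f := eps π ∘ₗ (mm k H).toLinearMap) (g := eps π ∘ₗ (pp k H).toLinearMap)
      (fun c => eps_mem π (mm k H c)) (fun c => eps_mem π (pp k H c)) (h ⊗ₜ x)

theorem adj_one_mem (π : H →ₗ[k] B) (h : H) : adj π h 1 ∈ epsAlg π := by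
  have := LinearMap.congr_fun (adj_one π) h
  rw [LinearMap.flip_apply] at this
  exact this.symm ▸ eps_mem π h

theorem IsPartialRep.adj_mem (hπ : IsPartialRep π) {a : B} (ha : a ∈ epsAlg π) (h : H) :
    adj π h a ∈ epsAlg π := by
  revert h
  refine Algebra.adjoin_induction (R := k) (s := Set.range (eps π))
    (p := fun a _ => ∀ h, adj π h a ∈ epsAlg π) ?_ ?_ ?_ ?_ ha
  · rintro _ ⟨x, rfl⟩ h
    exact hπ.adj_eps_mem h x
  · intro r h
    have e : adj π h (algebraMap k B r) = r • adj π h 1 := by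
      rw [Algebra.algebraMap_eq_smul_one, map_smul]
    exact e.symm ▸ Subalgebra.smul_mem _ (adj_one_mem π h) r
  · intro x y _ _ h1 h2 h
    exact (map_add (adj π h) x y).symm ▸ add_mem (h1 h) (h2 h)
  · intro x y hx _ h1 h2 h
    have := LinearMap.congr_fun (hπ.adj_mul hx y) h
    rw [LinearMap.flip_apply] at this
    exact this.symm ▸ conv_mem (epsAlg π) (f := (adj π).flip x) (g := (adj π).flip y) h1 h2 h

/-- `h · (x · a) = ε_{h₁} (h₂ x · a)`. -/
theorem IsPartialRep.adj_adj (hπ : IsPartialRep π) {a : B} (ha : a ∈ epsAlg π) (h x : H) :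
    adj π h (adj π x a) = conv (eps π ∘ₗ (pp k H).toLinearMap)
      ((adj π).flip a ∘ₗ (mm k H).toLinearMap) (h ⊗ₜ x) := by
  have e1 := adj_apply_tmul π ((adj π).flip a) h x
  rw [LinearMap.flip_apply] at e1
  rw [e1]
  refine LinearMap.congr_fun ?_ _
  have r := hπ.rel_right (antipode k ∘ₗ (pp k H).toLinearMap) (qq k H)
  rw [← antipode_mm] at r
  have r' : conv (π ∘ₗ (qq k H).toLinearMap) (conv (antip π ∘ₗ (qq k H).toLinearMap)
      (antip π ∘ₗ (pp k H).toLinearMap)) =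
      conv (π ∘ₗ (qq k H).toLinearMap) (antip π ∘ₗ (mm k H).toLinearMap) := r
  have s := hπ.rel_right (mm k H).toLinearMap (pp k H)
  rw [← conv_pp_qq, ← conv_assoc (antipode k ∘ₗ _), antipode_conv_id, one_conv, conv_pp_qq] at s
  have d := hπ.adj_conv ha (qq k H)
  have t' := hπ.triple' (qq k H)
  conv_rhs => rw [conv_comp, adj_flip, conv_comp, conv_comp, cst_comp, conv_assoc,
    ← conv_assoc _ (π ∘ₗ (mm k H).toLinearMap), ← conv_assoc (π ∘ₗ (pp k H).toLinearMap), s,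
    conv_assoc, ← conv_assoc (π ∘ₗ (qq k H).toLinearMap), ← d, conv_assoc, ← r', adj_flip,
    conv_comp, conv_comp, cst_comp]
  conv_lhs => rw [adj_flip, conv_comp, conv_comp, cst_comp, ← t']
  simp only [conv_assoc]

theorem IsPartialRep.adj_adj_sw (hπ : IsPartialRep π) {a : B} (ha : a ∈ epsAlg π)
    (v : C →ₗc[k] H) (u : C →ₗ[k] H) :
    sw (adj π) v.toLinearMap ((adj π).flip a ∘ₗ u) =
      conv (eps π ∘ₗ v.toLinearMap) ((adj π).flip a ∘ₗ conv v.toLinearMap u) := by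
  let Λ : (H ⊗[k] H) →ₗ[k] H →ₗ[k] B := TensorProduct.curry
    (TensorProduct.lift ((LinearMap.mul k B).compl₁₂ (eps π)
      ((adj π).flip a ∘ₗ LinearMap.mul' k H)) ∘ₗ
      (TensorProduct.assoc k H H H).toLinearMap)
  have hΛ : ∀ y a' b, Λ (a' ⊗ₜ b) y = eps π a' * adj π (b * y) a := fun y a' b => by simp [Λ]
  have e1 : sw (adj π) v.toLinearMap ((adj π).flip a ∘ₗ u) =
      sw Λ (comul ∘ₗ v.toLinearMap) u := by
    rw [← LinearMap.id_comp v.toLinearMap, sw_comp₂]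
    refine sw_linear_right _ _ _ _ fun z y => (hπ.adj_adj ha z y).trans ?_
    rw [conv, sw_prL]
    simp only [sw, LinearMap.comp_apply]
    generalize comul (R := k) z = s
    induction s with
    | zero => simp
    | add x y hx hy => simp only [map_add, hx, hy, LinearMap.add_apply]
    | tmul a b =>
      rw [TensorProduct.map_tmul, TensorProduct.lift.tmul, hΛ]
      rfl
  have e2 : sw Λ (sw (TensorProduct.mk k H H) v.toLinearMap v.toLinearMap) u =
      sw ((LinearMap.mul k B).compl₁₂ (eps π) LinearMap.id) v.toLinearMap
        (sw ((LinearMap.mul k H).compr₂ ((adj π).flip a)) v.toLinearMap u) :=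
    sw_assoc _ _ _ _ (fun x y w => by simp [hΛ]) _ _ _
  rw [e1, comul_comp_coalgHom, e2, ← comp_sw, ← sw_comp₂, LinearMap.id_comp]

theorem IsPartialRep.eps_conv_adj (hπ : IsPartialRep π) (a : B) :
    conv (eps π) ((adj π).flip a) = (adj π).flip a := by
  have t : conv π (conv (antip π) π) = π := hπ.triple (CoalgHom.id k H)
  rw [adj_flip, ← conv_assoc, conv_assoc π, t]

/-- `h ↦ (a ↦ π(h₍₁₎) a π(S(h₍₂₎)))`, as a map into the endomorphisms of `epsAlg π`. -/
def IsPartialRep.adjAct (hπ : IsPartialRep π) : H →ₗ[k] Module.End k (epsAlg π) where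
  toFun h := (adj π h).restrict (p := (epsAlg π).toSubmodule) (q := (epsAlg π).toSubmodule)
    (fun _ ha => hπ.adj_mem ha h)
  map_add' h h' := by ext; simp [LinearMap.restrict_apply]
  map_smul' c h := by ext; simp [LinearMap.restrict_apply]

theorem IsPartialRep.coe_adjAct (hπ : IsPartialRep π) (h : H) (a : epsAlg π) :
    (hπ.adjAct h a : B) = adj π h a := rfl

theorem IsPartialRep.coe_conv_adjAct (hπ : IsPartialRep π) (f g : C →ₗ[k] H) (c : C)
    (a : epsAlg π) :
    ((conv (hπ.adjAct ∘ₗ f) (hπ.adjAct ∘ₗ g) c a : epsAlg π) : B) =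
      sw (adj π) f ((adj π).flip (a : B) ∘ₗ g) c := by
  simp only [conv, sw, LinearMap.comp_apply]
  generalize comul (R := k) c = s
  induction s with
  | zero => simp
  | add x y hx hy => simp only [map_add, hx, hy, LinearMap.add_apply, Subalgebra.coe_add]
  | tmul a b => simp [coe_adjAct]

theorem IsPartialRep.coe_conv_adjAct_antip (hπ : IsPartialRep π) (x : H) (a : epsAlg π) :
    ((conv hπ.adjAct (antip hπ.adjAct) x a : epsAlg π) : B) = eps π x * a := by
  have h1 := hπ.coe_conv_adjAct LinearMap.id (antipode k) x a
  have h2 := hπ.adj_adj_sw a.2 (CoalgHom.id k H) (antipode k)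
  have h3 := id_conv_antipode (CoalgHom.id k H)
  refine h1.trans ((LinearMap.congr_fun h2 x).trans ?_)
  have h4 : conv (CoalgHom.id k H).toLinearMap (antipode k) = cst 1 := h3
  rw [h4, comp_cst, conv_cst]
  have h5 : (adj π).flip (a : B) 1 = a := by
    have : (comul (R := k) (1 : H)) = 1 ⊗ₜ 1 := Bialgebra.comul_one
    rw [adj_flip, cst_conv]
    simp [conv, sw, this, hπ.map_one]
  rw [h5]; rfl

theorem IsPartialRep.adjAct_isPartialRep (hπ : IsPartialRep π) : IsPartialRep hπ.adjAct where
  map_one := by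
    ext a
    have : (comul (R := k) (1 : H)) = 1 ⊗ₜ 1 := Bialgebra.comul_one
    rw [coe_adjAct, adj]
    simp [conv, sw, this, hπ.map_one]
  left_mul h x := by
    ext a
    rw [Module.End.mul_apply, coe_adjAct, coe_conv_adjAct_antip]
    have l := LinearMap.congr_fun (hπ.adj_mul (eps_mem π x) (a : B)) h
    rw [LinearMap.flip_apply] at l
    rw [l]
    have r := hπ.coe_conv_adjAct (LinearMap.mulLeft k h) (antipode k) x a
    refine Eq.trans ?_ r.symm
    have r1 := LinearMap.congr_fun
      (hπ.adj_adj_sw a.2 (mm k H) (antipode k ∘ₗ (qq k H).toLinearMap)) (h ⊗ₜ x)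
    rw [← LinearMap.comp_assoc, sw_prR, ← conv_pp_qq, conv_assoc, id_conv_antipode, conv_one,
      conv_pp_qq] at r1
    refine Eq.trans ?_ r1.symm
    have e : (adj π).flip (eps π x) =
        conv (eps π ∘ₗ (mm k H).toLinearMap) (eps π ∘ₗ (pp k H).toLinearMap) ∘ₗ
          (TensorProduct.mk k H H).flip x := by
      ext y; exact hπ.adj_eps y x
    have r2 : conv (eps π ∘ₗ (mm k H).toLinearMap) ((adj π).flip (a : B) ∘ₗ (pp k H).toLinearMap) =
        conv (conv (eps π ∘ₗ (mm k H).toLinearMap) (eps π ∘ₗ (pp k H).toLinearMap))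
          ((adj π).flip (a : B) ∘ₗ (pp k H).toLinearMap) := by
      rw [conv_assoc, ← conv_comp, hπ.eps_conv_adj]
    rw [r2, e, conv, sw_prL']
  mul_right x h := by
    ext a
    rw [Module.End.mul_apply, coe_conv_adjAct_antip]
    have r := hπ.coe_conv_adjAct LinearMap.id (LinearMap.mulRight k h ∘ₗ antipode k) x a
    refine Eq.trans ?_ r.symm
    have r1 := LinearMap.congr_fun
      (hπ.adj_adj_sw a.2 (CoalgHom.id k H) (LinearMap.mulRight k h ∘ₗ antipode k)) x
    refine Eq.trans ?_ r1.symm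
    have e : conv (CoalgHom.id k H).toLinearMap (LinearMap.mulRight k h ∘ₗ antipode k) =
        cst h := by
      have h3 : conv (CoalgHom.id k H).toLinearMap (antipode k) = cst 1 :=
        id_conv_antipode (CoalgHom.id k H)
      rw [← conv_cst, ← conv_assoc, h3, one_conv]
    rw [e, comp_cst, conv_cst]
    rfl

end PartialRep

/-! ### Diagonal actions -/

section Diagonal

variable {k : Type*} [Field k] {H : Type*} [Ring H] [HopfAlgebra k H]
variable {C : Type*} [AddCommMonoid C] [Module k C] [Coalgebra k C]
variable {B : Type*} [Ring B] [Algebra k B]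

variable (k H) in
/-- `h ↦ h ⊗ 1`. -/
abbrev inL : H →ₗ[k] H ⊗[k] H :=
  (Algebra.TensorProduct.includeLeft : H →ₐ[k] H ⊗[k] H).toLinearMap

variable (k H) in
/-- `h ↦ 1 ⊗ h`. -/
abbrev inR : H →ₗ[k] H ⊗[k] H :=
  (Algebra.TensorProduct.includeRight : H →ₐ[k] H ⊗[k] H).toLinearMap

theorem conv_comm_prL_prR {α β : H →ₗ[k] B} (hc : ∀ x y, Commute (α x) (β y)) :
    conv (α ∘ₗ (pp k H).toLinearMap) (β ∘ₗ (qq k H).toLinearMap) =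
      conv (β ∘ₗ (qq k H).toLinearMap) (α ∘ₗ (pp k H).toLinearMap) := by
  ext h x
  have h1 := sw_prL_prR (k := k) (LinearMap.mul k B) α β h x
  have h2 := sw_prR_prL (k := k) (LinearMap.mul k B) α β h x
  exact h1.trans ((hc h x).trans h2.symm)

theorem inL_conv_inR (f g : C →ₗ[k] H) :
    conv (inL k H ∘ₗ f) (inR k H ∘ₗ g) = sw (TensorProduct.mk k H H) f g := by
  rw [conv, sw_comp₂]
  congr 1
  ext x y
  simp

theorem comul_eq_conv : (comul : H →ₗ[k] H ⊗[k] H) = conv (inL k H) (inR k H) := by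
  have := inL_conv_inR (k := k) (LinearMap.id : H →ₗ[k] H) LinearMap.id
  have h2 := comul_comp_coalgHom (CoalgHom.id k H)
  exact h2.trans this.symm

theorem comul_comp_antipode : (comul : H →ₗ[k] H ⊗[k] H) ∘ₗ antipode k =
    conv (inR k H ∘ₗ antipode k) (inL k H ∘ₗ antipode k) := by
  have hl : conv (LinearMap.id : H →ₗ[k] H) (antipode k) = cst 1 :=
    id_conv_antipode (CoalgHom.id k H)
  have hr : conv (antipode k) (LinearMap.id : H →ₗ[k] H) = cst 1 :=
    antipode_conv_id (CoalgHom.id k H)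
  have e1 : conv (comul ∘ₗ antipode k) (comul : H →ₗ[k] H ⊗[k] H) = cst 1 := by
    have h := algHom_comp_conv (Bialgebra.comulAlgHom k H) (antipode k) LinearMap.id
    rw [hr, comp_cst, AlgHom.toLinearMap_apply, map_one] at h
    exact h.symm
  have e2 := congrArg (fun f => inR k H ∘ₗ f) hl
  have e3 := congrArg (fun f => inL k H ∘ₗ f) hl
  simp only [algHom_comp_conv, comp_cst, AlgHom.toLinearMap_apply, map_one,
    LinearMap.comp_id] at e2 e3
  have e4 : conv (comul : H →ₗ[k] H ⊗[k] H)
      (conv (inR k H ∘ₗ antipode k) (inL k H ∘ₗ antipode k)) = cst 1 := by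
    rw [comul_eq_conv, conv_assoc, ← conv_assoc (inR k H), e2, one_conv, e3]
  have e5 := congrArg (conv (comul ∘ₗ antipode k)) e4
  rw [← conv_assoc, e1, one_conv, conv_one] at e5
  exact e5.symm

theorem comul_comp_antipode_conv (f : C →ₗc[k] H) (g : C →ₗc[k] H) :
    (comul : H →ₗ[k] H ⊗[k] H) ∘ₗ conv (antipode k ∘ₗ f.toLinearMap) g.toLinearMap =
      conv (inR k H ∘ₗ (antipode k ∘ₗ f.toLinearMap))
        (conv (inL k H ∘ₗ conv (antipode k ∘ₗ f.toLinearMap) g.toLinearMap)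
          (inR k H ∘ₗ g.toLinearMap)) := by
  have e1 := algHom_comp_conv (Bialgebra.comulAlgHom k H) (antipode k ∘ₗ f.toLinearMap)
    g.toLinearMap
  rw [Bialgebra.toLinearMap_comulAlgHom, ← LinearMap.comp_assoc, comul_comp_antipode, conv_comp,
    comul_comp_coalgHom g, ← inL_conv_inR] at e1
  rw [e1, algHom_comp_conv]
  simp only [conv_assoc, LinearMap.comp_assoc]

section

variable (α : H →ₗ[k] B) (β : H →ₐ[k] B)

/-- The linear map `x ⊗ y ↦ α(x) β(y)`. -/
def tmulMap : H ⊗[k] H →ₗ[k] B :=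
  TensorProduct.lift ((LinearMap.mul k B).compl₁₂ α β.toLinearMap)

theorem tmulMap_comul : tmulMap α β ∘ₗ comul = conv α β.toLinearMap := by
  have := sw_comp₂ (LinearMap.mul k B) α β.toLinearMap (LinearMap.id : H →ₗ[k] H) LinearMap.id
  rw [LinearMap.comp_id, LinearMap.comp_id] at this
  rw [conv, this, sw, TensorProduct.map_id, LinearMap.id_comp]
  rfl

theorem tmulMap_inL : tmulMap α β ∘ₗ inL k H = α := by
  ext x; simp [tmulMap]

theorem tmulMap_conv_inR (T : C →ₗ[k] H ⊗[k] H) (c : C →ₗ[k] H) :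
    tmulMap α β ∘ₗ conv T (inR k H ∘ₗ c) = conv (tmulMap α β ∘ₗ T) (β.toLinearMap ∘ₗ c) := by
  rw [conv, comp_sw]
  conv_lhs => rw [← LinearMap.id_comp T]
  rw [sw_comp₂, conv, sw_comp₂]
  congr 1
  ext x y z
  simp [tmulMap, mul_assoc]

variable {α β}

theorem tmulMap_inR_conv (hc : ∀ x y, Commute (α x) (β y)) (T : C →ₗ[k] H ⊗[k] H)
    (c : C →ₗ[k] H) :
    tmulMap α β ∘ₗ conv (inR k H ∘ₗ c) T = conv (β.toLinearMap ∘ₗ c) (tmulMap α β ∘ₗ T) := by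
  rw [conv, comp_sw]
  conv_lhs => rw [← LinearMap.id_comp T]
  rw [sw_comp₂, conv, sw_comp₂]
  congr 1
  ext x y z
  simp only [tmulMap, LinearMap.compl₁₂_apply, LinearMap.compr₂_apply, LinearMap.mul_apply',
    TensorProduct.AlgebraTensorModule.curry_apply, TensorProduct.curry_apply,
    LinearMap.restrictScalars_apply, AlgHom.toLinearMap_apply, LinearMap.id_apply,
    Algebra.TensorProduct.includeRight_apply, Algebra.TensorProduct.tmul_mul_tmul, one_mul,
    TensorProduct.lift.tmul, map_mul]
  rw [← mul_assoc, (hc y x).eq, mul_assoc]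

theorem conv_comp_antipode (hc : ∀ x y, Commute (α x) (β y)) :
    antip (conv α β.toLinearMap) = conv (antip β.toLinearMap) (antip α) := by
  rw [antip, ← tmulMap_comul, LinearMap.comp_assoc, comul_comp_antipode, tmulMap_inR_conv hc,
    ← LinearMap.comp_assoc, tmulMap_inL]

theorem algHom_conv_antip (v : C →ₗc[k] H) :
    conv (β.toLinearMap ∘ₗ v.toLinearMap) (antip β.toLinearMap ∘ₗ v.toLinearMap) = cst 1 := by
  have := congrArg (fun f => β.toLinearMap ∘ₗ f) (id_conv_antipode v)
  simp only [algHom_comp_conv, comp_cst, AlgHom.toLinearMap_apply, map_one] at this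
  exact this

/-- The convolution product of a partial representation and a commuting representation is
a partial representation. -/
theorem IsPartialRep.conv_algHom (hα : IsPartialRep α) (hc : ∀ x y, Commute (α x) (β y)) :
    IsPartialRep (conv α β.toLinearMap) := by
  have hS := conv_comp_antipode hc
  have key : ∀ v : H ⊗[k] H →ₗc[k] H, conv (conv α β.toLinearMap ∘ₗ v.toLinearMap)
      (antip (conv α β.toLinearMap) ∘ₗ v.toLinearMap) =
      conv (α ∘ₗ v.toLinearMap) (antip α ∘ₗ v.toLinearMap) := fun v => by
    rw [hS, conv_comp, conv_comp, conv_assoc, ← conv_assoc (β.toLinearMap ∘ₗ v.toLinearMap),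
      algHom_conv_antip, one_conv]
  refine IsPartialRep.mk' ?_ ?_ ?_
  · have : (comul (R := k) (1 : H)) = 1 ⊗ₜ 1 := Bialgebra.comul_one
    simp [conv, sw, this, hα.map_one]
  · have c1 := conv_comm_prL_prR (k := k) (H := H) (α := β.toLinearMap) (β := α)
      (fun x y => (hc y x).symm)
    have c2 := conv_comm_prL_prR (k := k) (H := H) (α := β.toLinearMap) (β := antip α)
      (fun x y => (hc _ x).symm)
    have e : conv (β.toLinearMap ∘ₗ (mm k H).toLinearMap)
        (antip β.toLinearMap ∘ₗ (qq k H).toLinearMap) =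
        β.toLinearMap ∘ₗ (pp k H).toLinearMap := by
      have : conv (mm k H).toLinearMap (antipode k ∘ₗ (qq k H).toLinearMap) =
          (pp k H).toLinearMap := by
        rw [← conv_pp_qq, conv_assoc, id_conv_antipode, conv_one]
      have := congrArg (fun f => β.toLinearMap ∘ₗ f) this
      simp only [algHom_comp_conv] at this
      exact this
    rw [key, hS, conv_comp, conv_comp, conv_comp (antip β.toLinearMap), conv_assoc,
      ← conv_assoc _ (α ∘ₗ _) (antip α ∘ₗ _), c1, conv_assoc, c2]
    conv_rhs => rw [conv_assoc, ← conv_assoc _ (antip β.toLinearMap ∘ₗ _), e, c2,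
      ← conv_assoc, ← conv_pp_qq, ← hα.rel_left]
    simp only [conv_assoc]
  · have e : conv α β.toLinearMap ∘ₗ
        conv (antipode k ∘ₗ (pp k H).toLinearMap) (qq k H).toLinearMap =
        conv (antip β.toLinearMap ∘ₗ (pp k H).toLinearMap)
          (conv (α ∘ₗ conv (antipode k ∘ₗ (pp k H).toLinearMap) (qq k H).toLinearMap)
            (β.toLinearMap ∘ₗ (qq k H).toLinearMap)) := by
      rw [← tmulMap_comul, LinearMap.comp_assoc, comul_comp_antipode_conv, tmulMap_inR_conv hc,
        tmulMap_conv_inR, ← LinearMap.comp_assoc (conv _ _) (inL k H) (tmulMap α β), tmulMap_inL]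
      rfl
    rw [key, e, conv_comp, conv_comp]
    conv_rhs => rw [conv_assoc, ← conv_assoc (β.toLinearMap ∘ₗ _), algHom_conv_antip, one_conv,
      ← conv_assoc, ← hα.rel_right]
    simp only [conv_assoc]

end

end Diagonal

/-! ### The partial Hopf algebra -/

section HPar

variable (k H : Type u) [Field k] [Ring H] [HopfAlgebra k H]

/-- The relations imposing that `H → H_par` is a partial representation. -/
inductive HPar.Rel : TensorAlgebra k H → TensorAlgebra k H → Prop
  | one : HPar.Rel (TensorAlgebra.ι k 1) 1
  | left_mul (h x : H) : HPar.Rel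
      (TensorAlgebra.ι k h * conv (TensorAlgebra.ι k) (antip (TensorAlgebra.ι k)) x)
      (conv (TensorAlgebra.ι k ∘ₗ LinearMap.mulLeft k h) (antip (TensorAlgebra.ι k)) x)
  | mul_right (x h : H) : HPar.Rel
      (conv (TensorAlgebra.ι k) (antip (TensorAlgebra.ι k)) x * TensorAlgebra.ι k h)
      (conv (TensorAlgebra.ι k) (TensorAlgebra.ι k ∘ₗ LinearMap.mulRight k h ∘ₗ antipode k) x)

/-- The partial Hopf algebra `H_par`: the quotient of the tensor algebra of `H` by the relations
of a partial representation. -/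
def HPar : Type u := RingQuot (HPar.Rel k H)

instance : Ring (HPar k H) := inferInstanceAs (Ring (RingQuot (HPar.Rel k H)))

instance : Algebra k (HPar k H) := inferInstanceAs (Algebra k (RingQuot (HPar.Rel k H)))

namespace HPar

/-- The quotient map from the tensor algebra. -/
def quot : TensorAlgebra k H →ₐ[k] HPar k H := RingQuot.mkAlgHom k (HPar.Rel k H)

/-- The universal partial representation `h ↦ [h]`. -/
def mk : H →ₗ[k] HPar k H := (quot k H).toLinearMap ∘ₗ TensorAlgebra.ι k

theorem mk_isPartialRep : IsPartialRep (mk k H) where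
  map_one := (RingQuot.mkAlgHom_rel k Rel.one).trans (map_one (quot k H))
  left_mul h x := by
    have h1 : quot k H _ = quot k H _ := RingQuot.mkAlgHom_rel k (Rel.left_mul h x)
    rw [map_mul, algHom_conv_apply, algHom_conv_apply] at h1
    exact h1
  mul_right x h := by
    have h1 : quot k H _ = quot k H _ := RingQuot.mkAlgHom_rel k (Rel.mul_right x h)
    rw [map_mul, algHom_conv_apply, algHom_conv_apply] at h1
    exact h1

variable {k H} {B : Type*} [Ring B] [Algebra k B]

/-- The algebra map `H_par → B`, `[h] ↦ π(h)`, induced by a partial representation `π`. -/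
def lift (π : H →ₗ[k] B) (hπ : IsPartialRep π) : HPar k H →ₐ[k] B :=
  RingQuot.liftAlgHom k ⟨TensorAlgebra.lift k π, by
    have e : (TensorAlgebra.lift k π).toLinearMap ∘ₗ TensorAlgebra.ι k = π :=
      TensorAlgebra.ι_comp_lift π
    intro a b hab
    cases hab with
    | one => simpa using hπ.map_one
    | left_mul h x =>
      rw [map_mul, algHom_conv_apply, algHom_conv_apply]
      have := hπ.left_mul h x
      rw [← e] at this
      exact this
    | mul_right x h =>
      rw [map_mul, algHom_conv_apply, algHom_conv_apply]
      have := hπ.mul_right x h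
      rw [← e] at this
      exact this⟩

theorem lift_mk (π : H →ₗ[k] B) (hπ : IsPartialRep π) (h : H) : lift π hπ (mk k H h) = π h :=
  (RingQuot.liftAlgHom_mkAlgHom_apply k (s := HPar.Rel k H) (TensorAlgebra.lift k π) _
    (TensorAlgebra.ι k h)).trans (TensorAlgebra.lift_ι_apply π h)

theorem induction_mk {p : HPar k H → Prop} (halg : ∀ c : k, p (algebraMap k _ c))
    (hmk : ∀ h : H, p (mk k H h)) (hadd : ∀ x y, p x → p y → p (x + y))
    (hmul : ∀ x y, p x → p y → p (x * y)) (y : HPar k H) : p y := by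
  obtain ⟨t, rfl⟩ : ∃ t, quot k H t = y := RingQuot.mkAlgHom_surjective k (HPar.Rel k H) y
  induction t using TensorAlgebra.induction with
  | algebraMap r => rw [AlgHom.commutes]; exact halg r
  | ι x => exact hmk x
  | mul a b ha hb => rw [map_mul]; exact hmul _ _ ha hb
  | add a b ha hb => rw [map_add]; exact hadd _ _ ha hb

end HPar

end HPar

/-! ### Partial modules -/

/-- A partial `H`-module: a vector space `M` with a partial representation `H → End_k(M)`. -/
structure PMod (k H : Type u) [Field k] [Ring H] [HopfAlgebra k H] where
  carrier : Type u
  [addCommGroup : AddCommGroup carrier]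
  [module : Module k carrier]
  act : H →ₗ[k] Module.End k carrier
  isPartialRep : IsPartialRep act

attribute [instance] PMod.addCommGroup PMod.module

namespace PMod

variable {k H : Type u} [Field k] [Ring H] [HopfAlgebra k H]

instance : CoeSort (PMod k H) (Type u) := ⟨PMod.carrier⟩

/-- A morphism of partial modules: a linear map `f` with `f(h • m) = h • f(m)`. -/
@[ext]
structure Hom (M N : PMod k H) where
  toLin : M →ₗ[k] N
  map_act : ∀ (h : H) (m : M), toLin (M.act h m) = N.act h (toLin m)

instance : Category (PMod k H) where
  Hom := Hom
  id M := ⟨LinearMap.id, fun _ _ => rfl⟩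
  comp f g := ⟨g.toLin ∘ₗ f.toLin, fun h m => by simp [f.map_act, g.map_act]⟩

@[simp] theorem id_toLin (M : PMod k H) : Hom.toLin (𝟙 M) = LinearMap.id := rfl

@[simp] theorem comp_toLin {L M N : PMod k H} (f : L ⟶ M) (g : M ⟶ N) :
    Hom.toLin (f ≫ g) = Hom.toLin g ∘ₗ Hom.toLin f := rfl

/-- The action of `H_par` on a partial module. -/
def par (M : PMod k H) : HPar k H →ₐ[k] Module.End k M := HPar.lift M.act M.isPartialRep

theorem map_par {M N : PMod k H} (f : M ⟶ N) (y : HPar k H) (m : M) :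
    Hom.toLin f (M.par y m) = N.par y (Hom.toLin f m) := by
  induction y using HPar.induction_mk generalizing m with
  | halg c => simp
  | hmk h => simp only [par, HPar.lift_mk]; exact Hom.map_act f h m
  | hadd x y hx hy => simp only [map_add, LinearMap.add_apply, hx, hy]
  | hmul x y hx hy => simp only [map_mul, Module.End.mul_apply, hx, hy]

variable (k H) in
/-- `H_par` as a partial module: `h • x = [h] x`. -/
def hPar : PMod k H where
  carrier := HPar k H
  act := (Algebra.lmul k (HPar k H)).toLinearMap ∘ₗ HPar.mk k H
  isPartialRep := (HPar.mk_isPartialRep k H).algHom_comp _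

variable (k H) in
/-- The subalgebra `A_par` of `H_par` generated by the elements `ε_h = [h₍₁₎][S(h₍₂₎)]`, as a
partial module: `h • a = [h₍₁₎] a [S(h₍₂₎)]`. -/
def aPar : PMod k H where
  carrier := epsAlg (HPar.mk k H)
  act := (HPar.mk_isPartialRep k H).adjAct
  isPartialRep := (HPar.mk_isPartialRep k H).adjAct_isPartialRep

/-- The partial module `M ⊗ H` with `h • (m ⊗ x) = h₍₁₎ • m ⊗ h₍₂₎ x`. -/
def tensorH (M : PMod k H) : PMod k H where
  carrier := M ⊗[k] H
  act := sw (TensorProduct.mapBilinear (.id k) M H M H) M.act (LinearMap.mul k H)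
  isPartialRep := by
    have e : sw (TensorProduct.mapBilinear (.id k) M H M H) M.act (LinearMap.mul k H) =
        conv ((Module.End.rTensorAlgHom k M H).toLinearMap ∘ₗ M.act)
          ((Module.End.lTensorAlgHom k H M).comp (Algebra.lmul k H)).toLinearMap := by
      have h := sw_comp₂ (LinearMap.mul k (Module.End k (M ⊗[k] H)))
        (Module.End.rTensorAlgHom k M H).toLinearMap (Module.End.lTensorAlgHom k H M).toLinearMap
        M.act (LinearMap.mul k H)
      refine Eq.trans ?_ h.symm
      congr 1
      ext f g m x
      rfl
    rw [e]
    refine (M.isPartialRep.algHom_comp _).conv_algHom fun x y => ?_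
    ext m z
    rfl

/-- `{M, N} = Hom(M ⊗ H, N)`, the space of morphisms of partial modules `M ⊗ H → N`. -/
def homObj (M N : PMod k H) : Submodule k (M.tensorH →ₗ[k] N) where
  carrier := {f | ∀ (h : H) (t : M.tensorH), f (M.tensorH.act h t) = N.act h (f t)}
  add_mem' hf hg h t := by simp [hf h t, hg h t]
  zero_mem' h t := by simp
  smul_mem' c f hf h t := by simp [hf h t]

/-- The right multiplication `m ⊗ y ↦ m ⊗ y h` on `M ⊗ H`. -/
def tensorHRight (M : PMod k H) (h : H) : M.tensorH →ₗ[k] M.tensorH :=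
  (LinearMap.mulRight k h).lTensor M

theorem tensorHRight_act (M : PMod k H) (h l : H) (t : M.tensorH) :
    M.tensorHRight h (M.tensorH.act l t) = M.tensorH.act l (M.tensorHRight h t) := by
  have e : ∀ s : H ⊗[k] H, ∀ t : M ⊗[k] H,
      (LinearMap.mulRight k h).lTensor M (TensorProduct.lift
        (TensorProduct.mapBilinear (.id k) M H M H)
        (TensorProduct.map M.act (LinearMap.mul k H) s) t) =
      TensorProduct.lift (TensorProduct.mapBilinear (.id k) M H M H)
        (TensorProduct.map M.act (LinearMap.mul k H) s)
        ((LinearMap.mulRight k h).lTensor M t) := by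
    intro s t
    induction s with
    | zero => simp
    | add x y hx hy => simp only [map_add, LinearMap.add_apply, hx, hy]
    | tmul a b =>
      induction t with
      | zero => simp
      | add x y hx hy => simp only [map_add, hx, hy]
      | tmul m x => simp [mul_assoc]
  exact e (comul l) t

theorem tensorHRight_one (M : PMod k H) : M.tensorHRight (1 : H) = LinearMap.id :=
  TensorProduct.ext' fun m x => congrArg (m ⊗ₜ[k] ·) (mul_one x)

theorem tensorHRight_mul (M : PMod k H) (h l : H) :
    M.tensorHRight (h * l) = M.tensorHRight l ∘ₗ M.tensorHRight h :=
  TensorProduct.ext' fun m x => congrArg (m ⊗ₜ[k] ·) (mul_assoc x h l).symm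

theorem tensorHRight_add (M : PMod k H) (h l : H) :
    M.tensorHRight (h + l) = M.tensorHRight h + M.tensorHRight l :=
  TensorProduct.ext' fun m x =>
    (congrArg (m ⊗ₜ[k] ·) (mul_add x h l)).trans (TensorProduct.tmul_add _ _ _)

theorem tensorHRight_zero (M : PMod k H) : M.tensorHRight (0 : H) = 0 :=
  TensorProduct.ext' fun m x =>
    (congrArg (m ⊗ₜ[k] ·) (mul_zero x)).trans (TensorProduct.tmul_zero _ _)

/-- The `H`-action on `{M, N}`: `(h ⇀ f)(m ⊗ y) = f(m ⊗ y h)`. -/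
instance (M N : PMod k H) : Module H (homObj M N) where
  smul h f := ⟨f.1 ∘ₗ M.tensorHRight h, fun l t => by
    rw [LinearMap.comp_apply, LinearMap.comp_apply, tensorHRight_act]; exact f.2 l _⟩
  one_smul f := Subtype.ext (congrArg (f.1 ∘ₗ ·) M.tensorHRight_one)
  mul_smul h l f := Subtype.ext (congrArg (f.1 ∘ₗ ·) (M.tensorHRight_mul h l))
  smul_zero _ := rfl
  smul_add _ _ _ := rfl
  add_smul h l f := Subtype.ext
    ((congrArg (f.1 ∘ₗ ·) (M.tensorHRight_add h l)).trans (LinearMap.comp_add _ _ _))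
  zero_smul f := Subtype.ext
    ((congrArg (f.1 ∘ₗ ·) M.tensorHRight_zero).trans (LinearMap.comp_zero _))

/-- The functor `{M, -}` from partial modules to global modules. -/
def homFunctor (M : PMod k H) : PMod k H ⥤ ModuleCat.{u} H where
  obj N := ModuleCat.of H (homObj M N)
  map {N P} g := ModuleCat.ofHom
    { toFun f := ⟨Hom.toLin g ∘ₗ f.1, fun h t => by
        simp only [LinearMap.comp_apply]; rw [f.2 h t, Hom.map_act]⟩
      map_add' f f' := by apply Subtype.ext; exact LinearMap.comp_add _ _ _
      map_smul' _ _ := rfl }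

/-! ### The standard dilation -/

/-- The space `Hom_k(H, M)`. -/
def RegHom (k H : Type u) [Field k] [Ring H] [HopfAlgebra k H] (M : Type u) [AddCommGroup M]
    [Module k M] : Type u := H →ₗ[k] M

section RegHom

variable {M : Type u} [AddCommGroup M] [Module k M]

instance : AddCommGroup (RegHom k H M) := inferInstanceAs (AddCommGroup (H →ₗ[k] M))

instance : Module k (RegHom k H M) := inferInstanceAs (Module k (H →ₗ[k] M))

instance : FunLike (RegHom k H M) H M := inferInstanceAs (FunLike (H →ₗ[k] M) H M)

@[ext] theorem RegHom.ext {f g : RegHom k H M} (h : ∀ x : H, f x = g x) : f = g :=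
  LinearMap.ext h

/-- The `H`-action on `Hom_k(H, M)`: `(h ⇀ f)(x) = f(x h)`. -/
instance : Module H (RegHom k H M) where
  smul h f := LinearMap.comp (show H →ₗ[k] M from f) (LinearMap.mulRight k h)
  one_smul f := LinearMap.ext fun x => congrArg f (mul_one x)
  mul_smul h l f := LinearMap.ext fun x => congrArg f (mul_assoc x h l).symm
  smul_zero _ := rfl
  smul_add _ _ _ := rfl
  add_smul h l f := LinearMap.ext fun x =>
    (congrArg f (mul_add x h l)).trans (map_add (show H →ₗ[k] M from f) _ _)
  zero_smul f := LinearMap.ext fun x =>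
    (congrArg f (mul_zero x)).trans (map_zero (show H →ₗ[k] M from f))

@[simp] theorem RegHom.smul_apply (h : H) (f : RegHom k H M) (x : H) : (h • f) x = f (x * h) := rfl

instance : SMulCommClass H k (RegHom k H M) := ⟨fun _ _ _ => rfl⟩

instance : IsScalarTower k H (RegHom k H M) := ⟨fun c h f => RegHom.ext fun x =>
  (congrArg f (mul_smul_comm c x h)).trans (map_smul (show H →ₗ[k] M from f) c _)⟩

/-- Postcomposition with a linear map `M → N`. -/
def RegHom.postcomp {N : Type u} [AddCommGroup N] [Module k N] (g : M →ₗ[k] N) :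
    RegHom k H M →ₗ[H] RegHom k H N where
  toFun f := LinearMap.comp g (show H →ₗ[k] M from f)
  map_add' _ _ := LinearMap.comp_add _ _ _
  map_smul' _ _ := rfl

@[simp] theorem RegHom.postcomp_apply {N : Type u} [AddCommGroup N] [Module k N] (g : M →ₗ[k] N)
    (f : RegHom k H M) (x : H) : RegHom.postcomp g f x = g (f x) := rfl

end RegHom

/-- `φ : M → Hom_k(H, M)`, `φ(m)(h) = h • m`. -/
def dilMap (M : PMod k H) (m : M) : RegHom k H M := M.act.flip m

@[simp] theorem dilMap_apply (M : PMod k H) (m : M) (h : H) : M.dilMap m h = M.act h m := rfl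

/-- The standard dilation of `M`: the `H`-submodule of `Hom_k(H, M)` generated by `φ(M)`. -/
def dilation (M : PMod k H) : Submodule H (RegHom k H M) := Submodule.span H (Set.range M.dilMap)

theorem postcomp_mem {M N : PMod k H} (g : M →ₗ[k] N)
    (hg : ∀ (m : M), RegHom.postcomp g (M.dilMap m) ∈ N.dilation)
    {f : RegHom k H M} (hf : f ∈ M.dilation) : RegHom.postcomp g f ∈ N.dilation := by
  have : M.dilation ≤ N.dilation.comap (RegHom.postcomp g) := by
    refine Submodule.span_le.2 ?_
    rintro _ ⟨m, rfl⟩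
    exact hg m
  exact this hf

theorem postcomp_dilMap {M N : PMod k H} (g : M ⟶ N) (m : M) :
    RegHom.postcomp (Hom.toLin g) (M.dilMap m) = N.dilMap (Hom.toLin g m) := by
  ext x; exact Hom.map_act g x m

variable (k H) in
/-- The dilation functor `D`, sending a partial module to (the global module underlying) its
standard dilation. -/
def dilationFunctor : PMod k H ⥤ ModuleCat.{u} H where
  obj M := ModuleCat.of H M.dilation
  map {M N} g := ModuleCat.ofHom ((RegHom.postcomp (Hom.toLin g)).restrict
    (p := M.dilation) (q := N.dilation) fun _ hf => postcomp_mem _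
      (fun m => (postcomp_dilMap g m).symm ▸ Submodule.subset_span ⟨_, rfl⟩) hf)

/-! ### The functor `D(H_par) ⊗_{H_par} -` -/

/-- The right multiplication `x ↦ x y` on `H_par`. -/
def hParRight (y : HPar k H) : hPar k H →ₗ[k] hPar k H :=
  show HPar k H →ₗ[k] HPar k H from LinearMap.mulRight k y

theorem postcomp_hParRight (y : HPar k H) (x : hPar k H) :
    RegHom.postcomp (hParRight y) ((hPar k H).dilMap x) =
      (hPar k H).dilMap (hParRight y x) := by
  ext h
  exact mul_assoc (HPar.mk k H h) (show HPar k H from x) y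

/-- The right action of `H_par` on the standard dilation of `H_par`:
`(h ⇀ φ(x)) ◁ y = h ⇀ φ(x y)`, that is, `(f ◁ y)(h) = f(h) y`. -/
def dilRight (y : HPar k H) : (hPar k H).dilation →ₗ[H] (hPar k H).dilation :=
  (RegHom.postcomp (hParRight y)).restrict fun _ hf =>
    postcomp_mem _ (fun x => (postcomp_hParRight y x).symm ▸ Submodule.subset_span ⟨_, rfl⟩) hf

/-- The relations `(f ◁ y) ⊗ m = f ⊗ y m` of the balanced tensor product. Since `◁` is `H`-linear,
the set of these relations is stable under `H`. -/
def balanced (M : PMod k H) : Submodule H ((hPar k H).dilation ⊗[k] M) :=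
  Submodule.span H {z | ∃ (f : (hPar k H).dilation) (y : HPar k H) (m : M),
    z = dilRight y f ⊗ₜ[k] m - f ⊗ₜ[k] M.par y m}

/-- `D(H_par) ⊗_{H_par} M`, with `H` acting on the left factor. -/
abbrev parTensor (M : PMod k H) : Type u := ((hPar k H).dilation ⊗[k] M) ⧸ balanced M

/-- The `H`-linear map `f ⊗ m ↦ f ⊗ g(m)`. -/
def lTensorDil {M N : PMod k H} (g : M →ₗ[k] N) :
    (hPar k H).dilation ⊗[k] M →ₗ[H] (hPar k H).dilation ⊗[k] N :=
  TensorProduct.AlgebraTensorModule.map LinearMap.id g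

variable (k H) in
/-- The functor `D(H_par) ⊗_{H_par} -` from partial modules to global modules. -/
def parTensorFunctor : PMod k H ⥤ ModuleCat.{u} H where
  obj M := ModuleCat.of H (parTensor M)
  map {M N} g := ModuleCat.ofHom ((balanced M).mapQ (balanced N) (lTensorDil (Hom.toLin g)) (by
    refine Submodule.span_le.2 ?_
    rintro _ ⟨f, y, m, rfl⟩
    refine Submodule.subset_span ⟨f, y, Hom.toLin g m, ?_⟩
    simp [lTensorDil, map_par]))
  map_id M := by
    have e : lTensorDil (Hom.toLin (𝟙 M)) = LinearMap.id :=
      LinearMap.ext fun t => LinearMap.congr_fun (TensorProduct.map_id (R := k)) t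
    refine ModuleCat.hom_ext (Submodule.linearMap_qext _ (LinearMap.ext fun t => ?_))
    exact congrArg (balanced M).mkQ (LinearMap.congr_fun e t)
  map_comp {L M N} f g := by
    have e : lTensorDil (Hom.toLin (f ≫ g)) =
        lTensorDil (Hom.toLin g) ∘ₗ lTensorDil (Hom.toLin f) :=
      LinearMap.ext fun t => LinearMap.congr_fun
        (TensorProduct.map_comp (R := k) LinearMap.id (Hom.toLin g) LinearMap.id (Hom.toLin f)) t
    refine ModuleCat.hom_ext (Submodule.linearMap_qext _ (LinearMap.ext fun t => ?_))
    exact congrArg (balanced N).mkQ (LinearMap.congr_fun e t)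

end PMod

/-! ### Pointed Hopf algebras -/

section Pointed

variable (k : Type*) {C : Type*} [Field k] [AddCommGroup C] [Module k C] [Coalgebra k C]

/-- A subcoalgebra: a subspace `D` with `Δ(D) ⊆ D ⊗ D`. -/
def IsSubcoalgebra (D : Submodule k C) : Prop :=
  ∀ x ∈ D, comul (R := k) x ∈ LinearMap.range (TensorProduct.mapIncl D D)

/-- A simple subcoalgebra: a nonzero one whose only subcoalgebras are `0` and itself. -/
structure IsSimpleSubcoalgebra (D : Submodule k C) : Prop where
  isSubcoalgebra : IsSubcoalgebra k D
  ne_bot : D ≠ ⊥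
  eq_bot_or_eq : ∀ E : Submodule k C, E ≤ D → IsSubcoalgebra k E → E = ⊥ ∨ E = D

variable (C) in
/-- A coalgebra is pointed if all of its simple subcoalgebras are one-dimensional. -/
def IsPointed : Prop := ∀ D : Submodule k C, IsSimpleSubcoalgebra k D → Module.finrank k D = 1

end Pointed

/-- A functor from partial modules to global modules is exact if it sends short exact sequences
`0 → L → M → N → 0` to short exact sequences. -/
def IsExactFunctor {k H : Type u} [Field k] [Ring H] [HopfAlgebra k H]
    (F : PMod k H ⥤ ModuleCat.{u} H) : Prop :=
  ∀ (L M N : PMod k H) (f : L ⟶ M) (g : M ⟶ N),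
    Function.Injective f.toLin → Function.Exact f.toLin g.toLin → Function.Surjective g.toLin →
    Function.Injective (F.map f) ∧ Function.Exact (F.map f) (F.map g) ∧
      Function.Surjective (F.map g)

end PartialHopf

end

/-! For a partial module `M`, call `f : H → M` covariant if `ε_{h₁} f(h₂ x) = h • f(x)` for all `h`,
`x`. The proof identifies the standard dilation with the module of covariant functions
(`dilation_eq_covariant`), and does so by a formula that is uniform in `M`.

Covariance is what morphisms out of `A_par ⊗ N` see. Such a morphism `u` is determined by the
functions `x ↦ u(1 ⊗ x n)`, since `A_par ⊗ N` is generated by `1 ⊗ N` under `A_par ⊆ H_par`. As `h •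
(1 ⊗ n) = ε_{h₁} ⊗ h₂ n`, these functions are covariant, and conversely every `H`-linear map from
`N` into covariant functions arises in this way. Once dilations are covariant functions, `A_par ⊗ -`
is left adjoint to `D`, and `N = H` gives `D ≅ {A_par, -}`.

Every element of the dilation is covariant because `ε_{h₁} π(h₂ x) = π(h) π(x)`. For the converse, a
covariant `f` and a grouplike `g` satisfy `g • φ(f(g⁻¹)) = ε_{(-)g} * f`, where `*` is the
convolution action. Subtracting such terms for all `g` in the finite group `G` leaves `∏_g (1 -
ε_{(-)g}) * f`. The factors are commuting convolution idempotents, and the product vanishes at each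
grouplike `x`, because its factor for `g = x⁻¹` takes the value `1 - ε_1 = 0` there.

On a pointed coalgebra a convolution idempotent `e` vanishing on grouplikes is zero
(`IsPointed.eq_zero_of_isIdempotentElem`). It suffices to restrict to finite-dimensional
subcoalgebras `C`. There the functionals vanishing on grouplikes lie in the Jacobson radical of the
dual algebra, by the duality between simple subcoalgebras and maximal two-sided ideals. This radical
is nilpotent, so `e`, which lies in `rad(C*) ⊗ B`, is both nilpotent and idempotent.

The outcome is a dual basis formula `f = ∑ l • φ(y f(x))` whose finite list of triples `(l, y, x)`
depends neither on `M` nor on `f` (`exists_dualSum_eq`). Applied to `H_par`, it recovers an element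
of `D(H_par) ⊗_{H_par} M` from its image in `D(M)`, so `D(H_par) ⊗_{H_par} - ≅ D`, and tensor-Hom
adjunction supplies the right adjoint. Exactness is elementary: covariant functions behave well
under kernels, and generators of the dilation lift along surjections. -/

noncomputable section

namespace PartialHopf

/-! ### Two-sided ideals of a finite-dimensional algebra -/

section SimpleQuotient

variable {A : Type*} [Ring A]

/-- A simple submodule has a nonzero coordinate projection, which is an isomorphism by Schur's
lemma. -/
theorem isIsotypicOfType_pi {V ι : Type*} [AddCommGroup V] [Module A V] [IsSimpleModule A V] :
    IsIsotypicOfType A (ι → V) V := fun m _ => by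
  obtain ⟨x, hx, hx0⟩ := m.ne_bot_iff.1 (isSimpleModule_iff_isAtom.1 ‹_›).1
  obtain ⟨i, hi⟩ := Function.ne_iff.1 hx0
  let p : m →ₗ[A] V := LinearMap.proj i ∘ₗ m.subtype
  have hp : p ≠ 0 := fun h => hi (LinearMap.congr_fun h ⟨x, hx⟩)
  exact ⟨LinearEquiv.ofBijective p (LinearMap.bijective_of_ne_zero hp)⟩

/-- In a finite-dimensional algebra, the annihilator of a simple module is a maximal two-sided
ideal. -/
theorem eq_annihilator_or_eq_top (k : Type*) [Field k] [Algebra k A] [Module.Finite k A]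
    (m : Ideal A) [m.IsMaximal] (Q : Ideal A) [Q.IsTwoSided]
    (hQ : Module.annihilator A (A ⧸ m) ≤ Q) : Q = Module.annihilator A (A ⧸ m) ∨ Q = ⊤ := by
  set P := Module.annihilator A (A ⧸ m) with hP
  have : IsSimpleModule A (A ⧸ m) := isSimpleModule_iff_isCoatom.2 (Ideal.isMaximal_def.1 ‹_›)
  have : Module.Finite k (A ⧸ m) :=
    Module.Finite.of_surjective (m.mkQ.restrictScalars k) m.mkQ_surjective
  obtain ⟨n, s, hs⟩ := Module.Finite.exists_fin (R := k) (M := A ⧸ m)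
  -- The vectors `s i` span `A ⧸ m` over `k`, and scalars commute with `A`, so an element killing
  -- all of them kills `A ⧸ m`. Thus `A ⧸ P` embeds in a finite power of the simple module `A ⧸ m`.
  let j : A →ₗ[A] (Fin n → A ⧸ m) := LinearMap.pi fun i => LinearMap.toSpanSingleton A _ (s i)
  have hj : LinearMap.ker j = P := by
    ext a
    rw [LinearMap.mem_ker, hP, Module.mem_annihilator]
    refine ⟨fun h v => ?_, fun h => funext fun i => h _⟩
    have hv : v ∈ Submodule.span k (Set.range s) := hs ▸ Submodule.mem_top
    induction hv using Submodule.span_induction with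
    | mem x hx => obtain ⟨i, rfl⟩ := hx; exact congrFun h i
    | zero => exact smul_zero _
    | add x y _ _ hx hy => rw [smul_add, hx, hy, add_zero]
    | smul c x _ hx => rw [smul_comm, hx, smul_zero]
  let i : (A ⧸ P) →ₗ[A] (Fin n → A ⧸ m) := P.liftQ j hj.ge
  have hi : Function.Injective i := LinearMap.ker_eq_bot.1 (Submodule.ker_liftQ_eq_bot _ _ _ hj.le)
  have : IsSemisimpleModule A (A ⧸ P) := IsSemisimpleModule.of_injective i hi
  have iso : IsIsotypic A (A ⧸ P) := (isIsotypicOfType_pi.of_injective i hi).isIsotypic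
  -- An endomorphism of the left module `A ⧸ P` is determined by the image of `1`, hence is induced
  -- by a right multiplication. Two-sidedness of `Q` therefore makes its image fully invariant.
  have key := isIsotypic_iff_isFullyInvariant_imp_bot_or_top.1 iso (Submodule.map P.mkQ Q) (by
    rintro f _ ⟨q, hq, rfl⟩
    obtain ⟨c, hc⟩ := P.mkQ_surjective (f (P.mkQ 1))
    refine ⟨q * c, Q.mul_mem_right c hq, ?_⟩
    have h1 : P.mkQ q = q • P.mkQ 1 := by rw [← map_smul, smul_eq_mul, mul_one]
    rw [h1, map_smul, ← hc, ← map_smul, smul_eq_mul])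
  rcases key with h | h
  · left
    refine le_antisymm ?_ hQ
    have h' := LinearMap.le_ker_iff_map.2 h
    rwa [Submodule.ker_mkQ] at h'
  · right
    have := Submodule.comap_map_eq P.mkQ Q
    rwa [h, Submodule.comap_top, Submodule.ker_mkQ, sup_eq_left.2 hQ, eq_comm] at this

end SimpleQuotient

/-! ### Subcoalgebras as bimodules over the dual algebra -/

section Subcoalgebra

variable {k : Type*} [Field k]

/-- The coordinate functionals of a basis of `W` already separate the elements of `V ⊗ W`. -/
theorem eq_zero_of_lTensor_dual {V W : Type*} [AddCommGroup V] [Module k V] [AddCommGroup W]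
    [Module k W] (t : V ⊗[k] W)
    (h : ∀ β : W →ₗ[k] k, TensorProduct.rid k V (β.lTensor V t) = 0) : t = 0 := by
  classical
  let b := Module.Basis.ofVectorSpace k W
  refine (TensorProduct.equivFinsuppOfBasisRight (M := V) b).injective (Finsupp.ext fun i => ?_)
  have e : ∀ s : V ⊗[k] W, TensorProduct.equivFinsuppOfBasisRight (M := V) b s i =
      TensorProduct.rid k V ((b.coord i).lTensor V s) := fun s => by
    induction s with
    | zero => simp
    | add x y hx hy => simp only [map_add, Finsupp.add_apply, hx, hy]
    | tmul v w => simp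
  rw [e, h, map_zero]; rfl

/-- Linear projections `p` onto `D` and `q` onto `E` fix `t` when applied to the respective factor,
as one sees after contracting the other factor. So `p ⊗ q` exhibits `t` as an element of `D ⊗ E`. -/
theorem mem_range_mapIncl {V W : Type*} [AddCommGroup V] [Module k V] [AddCommGroup W]
    [Module k W] (D : Submodule k V) (E : Submodule k W) (t : V ⊗[k] W)
    (hD : ∀ β : W →ₗ[k] k, TensorProduct.rid k V (β.lTensor V t) ∈ D)
    (hE : ∀ α : V →ₗ[k] k, TensorProduct.lid k W (α.rTensor W t) ∈ E) :
    t ∈ LinearMap.range (TensorProduct.mapIncl D E) := by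
  obtain ⟨p, hp⟩ := D.subtype.exists_leftInverse_of_injective D.ker_subtype
  obtain ⟨q, hq⟩ := E.subtype.exists_leftInverse_of_injective E.ker_subtype
  have hp' : ∀ x ∈ D, D.subtype (p x) = x := fun x hx =>
    congrArg Subtype.val (LinearMap.congr_fun hp ⟨x, hx⟩)
  have hq' : ∀ x ∈ E, E.subtype (q x) = x := fun x hx =>
    congrArg Subtype.val (LinearMap.congr_fun hq ⟨x, hx⟩)
  have h1 : (D.subtype ∘ₗ p).rTensor W t = t := by
    rw [← sub_eq_zero]
    refine eq_zero_of_lTensor_dual _ fun β => ?_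
    have e : ∀ s : V ⊗[k] W, TensorProduct.rid k V (β.lTensor V ((D.subtype ∘ₗ p).rTensor W s)) =
        D.subtype (p (TensorProduct.rid k V (β.lTensor V s))) := fun s => by
      induction s with
      | zero => simp
      | add x y hx hy => simp only [map_add, hx, hy]
      | tmul v w => simp
    rw [map_sub, map_sub, e, hp' _ (hD β), sub_self]
  have h2 : (E.subtype ∘ₗ q).lTensor V t = t := by
    rw [← sub_eq_zero, ← (TensorProduct.comm k V W).map_eq_zero_iff]
    refine eq_zero_of_lTensor_dual _ fun α => ?_
    have e0 : ∀ s : V ⊗[k] W, TensorProduct.rid k W (α.lTensor W (TensorProduct.comm k V W s)) =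
        TensorProduct.lid k W (α.rTensor W s) := fun s => by
      induction s with
      | zero => simp
      | add x y hx hy => simp only [map_add, hx, hy]
      | tmul v w => simp
    have e : ∀ s : V ⊗[k] W, TensorProduct.lid k W (α.rTensor W ((E.subtype ∘ₗ q).lTensor V s)) =
        E.subtype (q (TensorProduct.lid k W (α.rTensor W s))) := fun s => by
      induction s with
      | zero => simp
      | add x y hx hy => simp only [map_add, hx, hy]
      | tmul v w => simp
    rw [e0, map_sub, map_sub, e, hq' _ (hE α), sub_self]
  refine ⟨TensorProduct.map p q t, ?_⟩
  conv_rhs => rw [← h1, ← h2]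
  rw [TensorProduct.mapIncl, ← LinearMap.comp_apply, ← TensorProduct.map_comp,
    ← LinearMap.comp_apply, LinearMap.rTensor_comp_lTensor]

variable {C : Type*} [AddCommGroup C] [Module k C] [Coalgebra k C]

/-- `x ↦ α(x₍₂₎) x₍₁₎`. -/
def hitL (α : C →ₗ[k] k) : C →ₗ[k] C := sw (LinearMap.lsmul k C).flip LinearMap.id α

/-- `x ↦ α(x₍₁₎) x₍₂₎`. -/
def hitR (α : C →ₗ[k] k) : C →ₗ[k] C := sw (LinearMap.lsmul k C) α LinearMap.id

theorem hitL_apply (α : C →ₗ[k] k) (x : C) :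
    hitL α x = TensorProduct.rid k C (α.lTensor C (comul x)) := by
  simp only [hitL, sw, LinearMap.comp_apply]
  generalize comul (R := k) x = s
  induction s with
  | zero => simp
  | add x y hx hy => simp only [map_add, hx, hy]
  | tmul a1 a2 => simp

theorem hitR_apply (α : C →ₗ[k] k) (x : C) :
    hitR α x = TensorProduct.lid k C (α.rTensor C (comul x)) := by
  simp only [hitR, sw, LinearMap.comp_apply]
  generalize comul (R := k) x = s
  induction s with
  | zero => simp
  | add x y hx hy => simp only [map_add, hx, hy]
  | tmul a1 a2 => simp

theorem comp_hitR (φ : C →ₗ[k] C) (α : C →ₗ[k] k) :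
    φ ∘ₗ hitR α = sw (LinearMap.lsmul k C) α φ := by
  rw [hitR, comp_sw]
  have := sw_comp₂ (C := C) (LinearMap.lsmul k C) LinearMap.id φ α LinearMap.id
  rw [LinearMap.id_comp, LinearMap.comp_id] at this
  rw [this]
  congr 1
  ext a
  simp

theorem comp_hitL (φ : C →ₗ[k] C) (α : C →ₗ[k] k) :
    φ ∘ₗ hitL α = sw (LinearMap.lsmul k C).flip φ α := by
  rw [hitL, comp_sw]
  have := sw_comp₂ (C := C) (LinearMap.lsmul k C).flip φ LinearMap.id LinearMap.id α
  rw [LinearMap.id_comp, LinearMap.comp_id] at this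
  rw [this]
  congr 1
  ext a
  simp

/-- Makes `hitR α` the transpose of left convolution by `α`. Together with the version for `hitL`
this turns one-sided stability of subspaces into ideal conditions in the dual algebra. -/
theorem dual_comp_hitR (α β : C →ₗ[k] k) : β ∘ₗ hitR α = conv α β := by
  rw [hitR, comp_sw]
  have := sw_comp₂ (C := C) (LinearMap.mul k k) LinearMap.id β α LinearMap.id
  rw [LinearMap.id_comp, LinearMap.comp_id] at this
  rw [conv, this]
  congr 1
  ext a
  simp

theorem dual_comp_hitL (α β : C →ₗ[k] k) : α ∘ₗ hitL β = conv α β := by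
  rw [hitL, comp_sw]
  have := sw_comp₂ (C := C) (LinearMap.mul k k) α LinearMap.id LinearMap.id β
  rw [LinearMap.id_comp, LinearMap.comp_id] at this
  rw [conv, this]
  congr 1
  ext a
  simp [mul_comm]

theorem hitR_hitR (α β : C →ₗ[k] k) : hitR β ∘ₗ hitR α = hitR (conv α β) := by
  rw [comp_hitR, hitR, hitR, conv]
  exact (sw_assoc _ _ _ _ (fun x y w => mul_smul x y w) _ _ _).symm

theorem hitL_hitL (α β : C →ₗ[k] k) : hitL β ∘ₗ hitL α = hitL (conv β α) := by
  rw [comp_hitL, hitL, hitL, conv]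
  exact sw_assoc _ _ _ _ (fun x y w => by
    simp only [LinearMap.flip_apply, LinearMap.lsmul_apply, LinearMap.mul_apply']
    rw [smul_smul, mul_comm]) _ _ _

/-- Coassociativity: the two actions of the dual algebra form a bimodule structure. -/
theorem hitL_hitR (α β : C →ₗ[k] k) : hitL β ∘ₗ hitR α = hitR α ∘ₗ hitL β := by
  rw [comp_hitR, comp_hitL, hitL, hitR]
  exact (sw_assoc _ _ _ _ (fun x y w => smul_comm w x y) _ _ _).symm

theorem hitL_counit : hitL (counit : C →ₗ[k] k) = LinearMap.id := by
  ext x; rw [hitL_apply, lTensor_counit_comul]; simp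

theorem hitR_counit : hitR (counit : C →ₗ[k] k) = LinearMap.id := by
  ext x; rw [hitR_apply, rTensor_counit_comul]; simp

theorem IsSubcoalgebra.hitL_mem {D : Submodule k C} (hD : IsSubcoalgebra k D) (α : C →ₗ[k] k)
    {x : C} (hx : x ∈ D) : hitL α x ∈ D := by
  obtain ⟨t, ht⟩ := hD x hx
  rw [hitL_apply, ← ht]
  clear ht
  induction t with
  | zero => simp
  | add x y hx hy => simpa only [map_add] using D.add_mem hx hy
  | tmul a b => simpa [TensorProduct.mapIncl] using D.smul_mem _ a.2

theorem IsSubcoalgebra.hitR_mem {D : Submodule k C} (hD : IsSubcoalgebra k D) (α : C →ₗ[k] k)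
    {x : C} (hx : x ∈ D) : hitR α x ∈ D := by
  obtain ⟨t, ht⟩ := hD x hx
  rw [hitR_apply, ← ht]
  clear ht
  induction t with
  | zero => simp
  | add x y hx hy => simpa only [map_add] using D.add_mem hx hy
  | tmul a b => simpa [TensorProduct.mapIncl] using D.smul_mem _ b.2

/-- Stability under both actions says that every contraction of `Δ(x)`, on either side, lies in `D`,
which is the criterion of `mem_range_mapIncl`. -/
theorem isSubcoalgebra_of_hit {D : Submodule k C} (hL : ∀ α : C →ₗ[k] k, ∀ x ∈ D, hitL α x ∈ D)
    (hR : ∀ α : C →ₗ[k] k, ∀ x ∈ D, hitR α x ∈ D) : IsSubcoalgebra k D := fun x hx =>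
  mem_range_mapIncl D D _ (fun β => hitL_apply β x ▸ hL β x hx)
    (fun β => hitR_apply β x ▸ hR β x hx)

/-- Every element of a coalgebra lies in a finite-dimensional subcoalgebra. -/
theorem exists_isSubcoalgebra_mem (x : C) :
    ∃ D : Submodule k C, IsSubcoalgebra k D ∧ Module.Finite k D ∧ x ∈ D := by
  -- Every `hitL β y` is a combination of the left tensor legs of one finite expression for `Δ(y)`.
  -- The right legs serve `hitR` in the same way.
  have fL : ∀ y : C, ∃ F : Submodule k C, F.FG ∧ ∀ β : C →ₗ[k] k, hitL (k := k) β y ∈ F := fun y => by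
    refine ⟨Submodule.span k ((ℛ k y).left '' (ℛ k y).index),
      Submodule.fg_span ((Finset.finite_toSet _).image _), fun β => ?_⟩
    rw [hitL_apply, ← (ℛ k y).eq, map_sum, map_sum]
    refine Submodule.sum_mem _ fun i hi => ?_
    rw [LinearMap.lTensor_tmul, TensorProduct.rid_tmul]
    exact Submodule.smul_mem _ _ (Submodule.subset_span ⟨i, hi, rfl⟩)
  have fR : ∀ y : C, ∃ F : Submodule k C, F.FG ∧ ∀ β : C →ₗ[k] k, hitR β y ∈ F := fun y => by
    refine ⟨Submodule.span k ((ℛ k y).right '' (ℛ k y).index),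
      Submodule.fg_span ((Finset.finite_toSet _).image _), fun β => ?_⟩
    rw [hitR_apply, ← (ℛ k y).eq, map_sum, map_sum]
    refine Submodule.sum_mem _ fun i hi => ?_
    rw [LinearMap.rTensor_tmul, TensorProduct.lid_tmul]
    exact Submodule.smul_mem _ _ (Submodule.subset_span ⟨i, hi, rfl⟩)
  -- The sub-bimodule generated by `x`. Its finiteness comes from applying the two bounds in
  -- succession: `hitL β x` ranges in the span of a finite set `s`, and each `y ∈ s` has a finitely
  -- generated orbit under `hitR`.
  let D : Submodule k C := Submodule.span k {z | ∃ α β : C →ₗ[k] k, z = hitR α (hitL β x)}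
  have hfin : Module.Finite k D := by
    obtain ⟨F, ⟨s, rfl⟩, hF⟩ := fL x
    choose G hG hG' using fR
    have hfg : (⨆ y ∈ s, G y).FG := Submodule.fg_biSup s G fun y _ => hG y
    have : Module.Finite k (⨆ y ∈ s, G y : Submodule k C) := Module.Finite.of_fg hfg
    refine Submodule.finiteDimensional_of_le (S₂ := ⨆ y ∈ s, G y) (Submodule.span_le.2 ?_)
    rintro _ ⟨α, β, rfl⟩
    have h := hF β
    generalize hitL β x = w at h
    induction h using Submodule.span_induction with
    | mem y hy => exact (le_iSup₂_of_le (f := fun y (_ : y ∈ s) => G y) y hy le_rfl) (hG' y α)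
    | zero => simp
    | add y z _ _ hy hz => rw [map_add]; exact Submodule.add_mem _ hy hz
    | smul c y _ hy => rw [map_smul]; exact Submodule.smul_mem _ c hy
  refine ⟨D, isSubcoalgebra_of_hit (fun γ y hy => ?_) (fun γ y hy => ?_), hfin, ?_⟩
  · have : D ≤ D.comap (hitL γ) := by
      refine Submodule.span_le.2 ?_
      rintro _ ⟨α, β, rfl⟩
      refine Submodule.subset_span ⟨α, conv γ β, ?_⟩
      rw [← hitL_hitL]
      exact LinearMap.congr_fun (hitL_hitR α γ) (hitL β x)
    exact this hy
  · have : D ≤ D.comap (hitR γ) := by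
      refine Submodule.span_le.2 ?_
      rintro _ ⟨α, β, rfl⟩
      refine Submodule.subset_span ⟨conv α γ, β, ?_⟩
      rw [← hitR_hitR]; rfl
    exact this hy
  · refine Submodule.subset_span ⟨counit, counit, ?_⟩
    rw [hitL_counit, hitR_counit]; rfl

end Subcoalgebra

/-! ### Pointed coalgebras and the radical of the dual algebra -/

section Pointed

variable {k : Type*} [Field k] {C : Type*} [AddCommGroup C] [Module k C]
  {D : Type*} [AddCommGroup D] [Module k D]

theorem mapIncl_injective (D : Submodule k C) :
    Function.Injective (TensorProduct.mapIncl D D) :=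
  TensorProduct.map_injective_of_flat_flat _ _ D.subtype_injective D.subtype_injective

theorem exists_dual_extension (i : D →ₗ[k] C) (hi : Function.Injective i) (α : D →ₗ[k] k) :
    ∃ β : C →ₗ[k] k, β ∘ₗ i = α := by
  obtain ⟨p, hp⟩ := i.exists_leftInverse_of_injective (LinearMap.ker_eq_bot.2 hi)
  exact ⟨α ∘ₗ p, by rw [LinearMap.comp_assoc, hp, LinearMap.comp_id]⟩

variable [Coalgebra k C] [Coalgebra k D]

/-- The comultiplication of a subcoalgebra. -/
def IsSubcoalgebra.comul {D : Submodule k C} (hD : IsSubcoalgebra k D) : D →ₗ[k] D ⊗[k] D :=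
  (LinearEquiv.ofInjective _ (mapIncl_injective D)).symm.toLinearMap ∘ₗ
    (Coalgebra.comul ∘ₗ D.subtype).codRestrict _ fun x => hD x x.2

theorem IsSubcoalgebra.mapIncl_comul {D : Submodule k C} (hD : IsSubcoalgebra k D) (x : D) :
    TensorProduct.mapIncl D D (hD.comul x) = Coalgebra.comul (R := k) (x : C) :=
  congrArg Subtype.val ((LinearEquiv.ofInjective _ (mapIncl_injective D)).apply_symm_apply
    ((Coalgebra.comul ∘ₗ D.subtype).codRestrict _ (fun x => hD x x.2) x))

/-- A subcoalgebra is a coalgebra. -/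
abbrev IsSubcoalgebra.coalgebra {D : Submodule k C} (hD : IsSubcoalgebra k D) :
    Coalgebra k D where
  comul := hD.comul
  counit := counit ∘ₗ D.subtype
  coassoc := by
    ext x
    refine TensorProduct.map_injective_of_flat_flat _ _ D.subtype_injective
      (mapIncl_injective D) ?_
    have e1 : ∀ t : D ⊗[k] D, TensorProduct.map D.subtype (TensorProduct.mapIncl D D)
        (TensorProduct.assoc k D D D (hD.comul.rTensor D t)) =
        TensorProduct.assoc k C C C (Coalgebra.comul.rTensor C (TensorProduct.mapIncl D D t)) := by
      intro t
      induction t with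
      | zero => simp
      | add x y hx hy => simp only [map_add, hx, hy]
      | tmul a b =>
        have := hD.mapIncl_comul a
        simp only [LinearMap.rTensor_tmul, TensorProduct.mapIncl, TensorProduct.map_tmul,
          Submodule.subtype_apply] at this ⊢
        rw [← this]
        generalize hD.comul a = s
        induction s with
        | zero => simp
        | add x y hx hy => simp only [map_add, TensorProduct.add_tmul, hx, hy]
        | tmul a1 a2 => simp
    have e2 : ∀ t : D ⊗[k] D, TensorProduct.map D.subtype (TensorProduct.mapIncl D D)
        (hD.comul.lTensor D t) =
        Coalgebra.comul.lTensor C (TensorProduct.mapIncl D D t) := by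
      intro t
      induction t with
      | zero => simp
      | add x y hx hy => simp only [map_add, hx, hy]
      | tmul a b =>
        have := hD.mapIncl_comul b
        simp only [LinearMap.lTensor_tmul, TensorProduct.map_tmul, this]
        simp
    have h := coassoc_apply (R := k) (x : C)
    rw [← hD.mapIncl_comul, ← e1, ← e2] at h
    exact h
  rTensor_counit_comp_comul := by
    ext x
    refine (TensorProduct.map_injective_of_flat_flat (LinearMap.id : k →ₗ[k] k) _
      Function.injective_id D.subtype_injective) ?_
    have e : ∀ t : D ⊗[k] D, TensorProduct.map LinearMap.id D.subtype
        ((counit ∘ₗ D.subtype).rTensor D t) =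
        counit.rTensor C (TensorProduct.mapIncl D D t) := fun t => by
      induction t with
      | zero => simp
      | add x y hx hy => simp only [map_add, hx, hy]
      | tmul a b => simp [TensorProduct.mapIncl]
    rw [LinearMap.comp_apply, e, hD.mapIncl_comul, rTensor_counit_comul]
    simp
  lTensor_counit_comp_comul := by
    ext x
    refine (TensorProduct.map_injective_of_flat_flat _ (LinearMap.id : k →ₗ[k] k)
      D.subtype_injective Function.injective_id) ?_
    have e : ∀ t : D ⊗[k] D, TensorProduct.map D.subtype LinearMap.id
        ((counit ∘ₗ D.subtype).lTensor D t) =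
        counit.lTensor C (TensorProduct.mapIncl D D t) := fun t => by
      induction t with
      | zero => simp
      | add x y hx hy => simp only [map_add, hx, hy]
      | tmul a b => simp [TensorProduct.mapIncl]
    rw [LinearMap.comp_apply, e, hD.mapIncl_comul, lTensor_counit_comul]
    simp

theorem IsSubcoalgebra.map {E : Submodule k D} (hE : IsSubcoalgebra k E) (i : D →ₗc[k] C) :
    IsSubcoalgebra k (E.map i.toLinearMap) := by
  rintro _ ⟨x, hx, rfl⟩
  have h := hE x hx
  rw [TensorProduct.range_mapIncl] at h ⊢
  have h2 := LinearMap.congr_fun i.map_comp_comul x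
  rw [LinearMap.comp_apply, LinearMap.comp_apply] at h2
  rw [← h2, Submodule.map₂_map_map]
  have h3 := Submodule.mem_map_of_mem
    (f := TensorProduct.map i.toLinearMap i.toLinearMap) h
  rw [Submodule.map_map₂] at h3
  exact h3

/-- A coalgebra map is linear over the dual algebra of its target, which acts on the source by
pullback of functionals. -/
theorem coalgHom_hitL (i : D →ₗc[k] C) (α : C →ₗ[k] k) (x : D) :
    i (hitL (α ∘ₗ i.toLinearMap) x) = hitL α (i x) := by
  have h := LinearMap.congr_fun (sw_comp (LinearMap.lsmul k C).flip LinearMap.id α i) x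
  refine Eq.trans ?_ h.symm
  have h2 := LinearMap.congr_fun (comp_sw i.toLinearMap (LinearMap.lsmul k D).flip
    LinearMap.id (α ∘ₗ i.toLinearMap)) x
  refine h2.trans (LinearMap.congr_fun ?_ x)
  have h3 := sw_comp₂ (C := D) (LinearMap.lsmul k C).flip i.toLinearMap LinearMap.id LinearMap.id
    (α ∘ₗ i.toLinearMap)
  rw [LinearMap.comp_id, LinearMap.id_comp] at h3
  rw [LinearMap.id_comp, h3]
  congr 1
  ext a
  simp

theorem coalgHom_hitR (i : D →ₗc[k] C) (α : C →ₗ[k] k) (x : D) :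
    i (hitR (α ∘ₗ i.toLinearMap) x) = hitR α (i x) := by
  have h := LinearMap.congr_fun (sw_comp (LinearMap.lsmul k C) α LinearMap.id i) x
  refine Eq.trans ?_ h.symm
  have h2 := LinearMap.congr_fun (comp_sw i.toLinearMap (LinearMap.lsmul k D)
    (α ∘ₗ i.toLinearMap) LinearMap.id) x
  refine h2.trans (LinearMap.congr_fun ?_ x)
  have h3 := sw_comp₂ (C := D) (LinearMap.lsmul k C) LinearMap.id i.toLinearMap
    (α ∘ₗ i.toLinearMap) LinearMap.id
  rw [LinearMap.comp_id, LinearMap.id_comp] at h3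
  rw [LinearMap.id_comp, h3]
  congr 1
  ext a
  simp

/-- By injectivity each functional on `D` is pulled back from `C`, so stability under the
functionals of `C` suffices. -/
theorem IsSubcoalgebra.comap {F : Submodule k C} (hF : IsSubcoalgebra k F) (i : D →ₗc[k] C)
    (hi : Function.Injective i) : IsSubcoalgebra k (F.comap i.toLinearMap) := by
  refine isSubcoalgebra_of_hit (fun α x hx => ?_) (fun α x hx => ?_)
  · obtain ⟨β, rfl⟩ := exists_dual_extension i.toLinearMap hi α
    change i (hitL (β ∘ₗ i.toLinearMap) x) ∈ F
    rw [coalgHom_hitL]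
    exact hF.hitL_mem β hx
  · obtain ⟨β, rfl⟩ := exists_dual_extension i.toLinearMap hi α
    change i (hitR (β ∘ₗ i.toLinearMap) x) ∈ F
    rw [coalgHom_hitR]
    exact hF.hitR_mem β hx

/-- The image of a simple subcoalgebra is again simple, since subcoalgebras of the image pull back.
This is what allows passage to finite-dimensional subcoalgebras. -/
theorem IsPointed.of_injective (h : IsPointed k C) (i : D →ₗc[k] C) (hi : Function.Injective i) :
    IsPointed k D := fun E hE => by
  have hi' : Function.Injective i.toLinearMap := hi
  rw [← h (E.map i.toLinearMap), (E.equivMapOfInjective i.toLinearMap hi').finrank_eq]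
  refine ⟨hE.1.map i, fun h0 => hE.ne_bot ?_, fun F hF hF' => ?_⟩
  · exact Submodule.map_injective_of_injective hi' (h0.trans (Submodule.map_bot _).symm)
  · have e : (F.comap i.toLinearMap).map i.toLinearMap = F :=
      Submodule.map_comap_eq_self (hF.trans LinearMap.map_le_range)
    have hle : F.comap i.toLinearMap ≤ E :=
      (Submodule.comap_mono hF).trans (Submodule.comap_map_eq_of_injective hi' E).le
    rcases hE.eq_bot_or_eq _ hle (hF'.comap i hi) with h0 | h0
    · left; rw [← e, h0, Submodule.map_bot]
    · right; rw [← e, h0]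

/-- A one-dimensional subcoalgebra is spanned by a grouplike element. -/
theorem exists_isGroupLikeElem_span {E : Submodule k C} (hE : IsSubcoalgebra k E)
    (h1 : Module.finrank k E = 1) :
    ∃ g : C, IsGroupLikeElem k g ∧ E = Submodule.span k {g} := by
  obtain ⟨⟨v, hvE⟩, hv0, hv⟩ := finrank_eq_one_iff'.1 h1
  have hE' : E = Submodule.span k {v} := by
    refine le_antisymm (fun w hw => ?_) ((Submodule.span_singleton_le_iff_mem _ _).2 hvE)
    obtain ⟨c, hc⟩ := hv ⟨w, hw⟩
    exact Submodule.mem_span_singleton.2 ⟨c, congrArg Subtype.val hc⟩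
  obtain ⟨c, hc⟩ : ∃ c : k, comul (R := k) v = c • (v ⊗ₜ[k] v) := by
    have h := hE v hvE
    rw [TensorProduct.range_mapIncl, hE', Submodule.map₂_span_singleton_eq_map,
      Submodule.map_span, Set.image_singleton, Submodule.mem_span_singleton] at h
    obtain ⟨c, hc⟩ := h
    exact ⟨c, hc.symm⟩
  -- The counit axiom forces `c ε(v) = 1`, so the rescaled generator `c • v` has counit one and is
  -- grouplike.
  have hcv : (c * counit (R := k) v) • v = v := by
    have h := congrArg (TensorProduct.lid k C) (rTensor_counit_comul (R := k) v)
    rw [hc] at h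
    simpa [mul_smul] using h
  have hc1 : c * counit (R := k) v = 1 := by
    have hv0' : v ≠ 0 := fun h => hv0 (Subtype.ext h)
    exact smul_left_injective k hv0' (hcv.trans (one_smul k _).symm)
  have hc0 : c ≠ 0 := left_ne_zero_of_mul_eq_one hc1
  refine ⟨c • v, ⟨by rw [map_smul, smul_eq_mul, hc1], ?_⟩, ?_⟩
  · rw [map_smul, hc, TensorProduct.smul_tmul_smul, smul_smul]
  · rw [hE', Submodule.span_singleton_smul_eq hc0.isUnit]

/-- Identifies the product of the convolution ring with `conv`, so that idempotents, powers and
radicals can be used for it. -/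
theorem mul_eq_conv {B : Type*} [Ring B] [Algebra k B] (f g : WithConv (C →ₗ[k] B)) :
    f * g = WithConv.toConv (conv f.ofConv g.ofConv) := rfl

/-- The common kernel in `C` of an ideal of the dual algebra. -/
def perp (P : Ideal (WithConv (C →ₗ[k] k))) : Submodule k C where
  carrier := {x | ∀ α ∈ P, α x = 0}
  add_mem' hx hy α hα := by rw [map_add, hx α hα, hy α hα, add_zero]
  zero_mem' α _ := map_zero _
  smul_mem' c x hx α hα := by rw [map_smul, hx α hα, smul_zero]

/-- The two actions are transposes of the multiplications, and `P` absorbs multiplication on both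
sides. -/
theorem isSubcoalgebra_perp (P : Ideal (WithConv (C →ₗ[k] k))) [P.IsTwoSided] :
    IsSubcoalgebra k (perp P) := by
  refine isSubcoalgebra_of_hit (fun β x hx α hα => ?_) (fun β x hx α hα => ?_)
  · exact (LinearMap.congr_fun (dual_comp_hitL α.ofConv β) x).trans
      (hx _ (P.mul_mem_right (WithConv.toConv β) hα))
  · exact (LinearMap.congr_fun (dual_comp_hitR β α.ofConv) x).trans
      (hx _ (P.mul_mem_left (WithConv.toConv β) hα))

/-- The ideal of functionals vanishing on a subcoalgebra. -/
def IsSubcoalgebra.annihilator {E : Submodule k C} (hE : IsSubcoalgebra k E) :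
    Ideal (WithConv (C →ₗ[k] k)) where
  carrier := {α | ∀ x ∈ E, α x = 0}
  add_mem' {α β} hα hβ x hx := by
    rw [WithConv.ofConv_add, LinearMap.add_apply, hα x hx, hβ x hx, add_zero]
  zero_mem' _ _ := rfl
  smul_mem' β α hα x hx :=
    (LinearMap.congr_fun (dual_comp_hitR β.ofConv α.ofConv) x).symm.trans
      (hα _ (hE.hitR_mem β.ofConv hx))

theorem IsSubcoalgebra.isTwoSided_annihilator {E : Submodule k C} (hE : IsSubcoalgebra k E) :
    hE.annihilator.IsTwoSided :=
  ⟨fun {α} β hα x hx => (LinearMap.congr_fun (dual_comp_hitL α.ofConv β.ofConv) x).symm.trans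
      (hα _ (hE.hitL_mem β.ofConv hx))⟩

/-- Double annihilator theorem: in finite dimension an ideal is recovered from its common kernel. -/
theorem mem_of_forall_perp [Module.Finite k C] (P : Ideal (WithConv (C →ₗ[k] k)))
    {α : WithConv (C →ₗ[k] k)} (h : ∀ x ∈ perp P, α x = 0) : α ∈ P := by
  let W : Submodule k (Module.Dual k C) :=
    (P.restrictScalars k).comap (WithConv.linearEquiv k (C →ₗ[k] k)).symm.toLinearMap
  have hW : W.dualCoannihilator.dualAnnihilator = W := Subspace.dualCoannihilator_dualAnnihilator_eq
  have : α.ofConv ∈ W.dualCoannihilator.dualAnnihilator := by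
    rw [Submodule.mem_dualAnnihilator]
    refine fun x hx => h x fun β hβ => ?_
    exact (Submodule.mem_dualCoannihilator (Φ := W) x).1 hx β.ofConv hβ
  rw [hW] at this
  exact this

/-- Taking annihilators reverses inclusions: a subcoalgebra inside the common kernel gives a
two-sided ideal containing the annihilator of the simple module. By `eq_annihilator_or_eq_top` only
the two extreme ideals occur, and they correspond to the whole kernel and to zero. -/
theorem isSimpleSubcoalgebra_perp [Module.Finite k C] (m : Ideal (WithConv (C →ₗ[k] k)))
    [m.IsMaximal] : IsSimpleSubcoalgebra k
      (perp (Module.annihilator (WithConv (C →ₗ[k] k)) (WithConv (C →ₗ[k] k) ⧸ m))) where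
  isSubcoalgebra := isSubcoalgebra_perp _
  ne_bot h := by
    have h1 : (1 : WithConv (C →ₗ[k] k)) ∈
        Module.annihilator (WithConv (C →ₗ[k] k)) (WithConv (C →ₗ[k] k) ⧸ m) :=
      mem_of_forall_perp _ fun x hx => by
        rw [h, Submodule.mem_bot] at hx
        rw [hx, map_zero]
    have h2 := Module.mem_annihilator.1 h1 (m.mkQ 1)
    rw [one_smul, Submodule.mkQ_apply, Submodule.Quotient.mk_eq_zero] at h2
    exact (Ideal.ne_top_iff_one m).1 (Ideal.IsMaximal.ne_top ‹_›) h2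
  eq_bot_or_eq E hE hE' := by
    have := hE'.isTwoSided_annihilator
    have : Module.Finite k (WithConv (C →ₗ[k] k)) :=
      Module.Finite.equiv (WithConv.linearEquiv k (C →ₗ[k] k)).symm
    rcases eq_annihilator_or_eq_top k m hE'.annihilator
      (fun α hα x hx => hE hx α hα) with h | h
    · right
      refine le_antisymm hE fun x hx => by_contra fun hxE => ?_
      obtain ⟨f, hfx, hf⟩ := Submodule.exists_le_ker_of_notMem hxE
      refine hfx (hx (WithConv.toConv f) ?_)
      rw [← h]
      exact fun y hy => hf hy
    · left
      refine (Submodule.eq_bot_iff _).2 fun x hx => by_contra fun hx0 => ?_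
      have hx0' : x ∉ (⊥ : Submodule k C) := fun h => hx0 ((Submodule.mem_bot k).1 h)
      obtain ⟨f, hfx, -⟩ := Submodule.exists_le_ker_of_notMem hx0'
      have : WithConv.toConv f ∈ hE'.annihilator := h ▸ Submodule.mem_top
      exact hfx (this x hx)

/-- In the dual algebra of a finite-dimensional pointed coalgebra, the functionals vanishing on
all grouplike elements lie in the Jacobson radical. -/
theorem IsPointed.mem_jacobson [Module.Finite k C] (h : IsPointed k C)
    {α : WithConv (C →ₗ[k] k)} (hα : ∀ g : C, IsGroupLikeElem k g → α g = 0) :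
    α ∈ Ring.jacobson (WithConv (C →ₗ[k] k)) := by
  rw [Ring.jacobson_eq_sInf_isMaximal, Ideal.mem_sInf]
  intro m hm
  have : m.IsMaximal := hm
  -- The simple subcoalgebra attached to `m` is a line through a grouplike, on which `α` vanishes.
  -- By the double annihilator, `α` kills the simple module `A ⧸ m`, `A` being the dual algebra, and
  -- in particular the class of `1`; so `α ∈ m`.
  have hs := isSimpleSubcoalgebra_perp m
  obtain ⟨g, hg, hE⟩ := exists_isGroupLikeElem_span hs.isSubcoalgebra (h _ hs)
  have h1 : α ∈ Module.annihilator (WithConv (C →ₗ[k] k)) (WithConv (C →ₗ[k] k) ⧸ m) := by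
    refine mem_of_forall_perp _ fun x hx => ?_
    rw [hE, Submodule.mem_span_singleton] at hx
    obtain ⟨c, rfl⟩ := hx
    rw [map_smul, hα g hg, smul_zero]
  have h2 := Module.mem_annihilator.1 h1 (m.mkQ 1)
  rwa [← map_smul, smul_eq_mul, mul_one, Submodule.mkQ_apply, Submodule.Quotient.mk_eq_zero] at h2

variable {B : Type*} [Ring B] [Algebra k B]

/-- The linear map `c ↦ α(c) b`. -/
def dualSMul (α : WithConv (C →ₗ[k] k)) (b : B) : WithConv (C →ₗ[k] B) :=
  WithConv.toConv (LinearMap.toSpanSingleton k B b ∘ₗ α.ofConv)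

theorem dualSMul_mul (α β : WithConv (C →ₗ[k] k)) (b b' : B) :
    dualSMul α b * dualSMul β b' = dualSMul (α * β) (b * b') := by
  rw [mul_eq_conv, mul_eq_conv, dualSMul, dualSMul, dualSMul, conv, sw_comp₂, comp_sw]
  congr 2
  ext
  simp

/-- In finite dimension `Hom(C, B)` is `C* ⊗ B`. Vanishing on grouplikes puts `e` in `J ⊗ B` with
`J` the radical of `C*`, and `J` is nilpotent because `C*` is artinian. -/
theorem exists_pow_eq_zero [Module.Finite k C] (h : IsPointed k C)
    (e : WithConv (C →ₗ[k] B)) (he : ∀ g : C, IsGroupLikeElem k g → e g = 0) :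
    ∃ n : ℕ, e ^ n = 0 := by
  have hfin : Module.Finite k (WithConv (C →ₗ[k] k)) :=
    Module.Finite.equiv (WithConv.linearEquiv k (C →ₗ[k] k)).symm
  have : IsArtinianRing (WithConv (C →ₗ[k] k)) := IsArtinianRing.of_finite k _
  let J := Ring.jacobson (WithConv (C →ₗ[k] k))
  have hJ : J.IsTwoSided := inferInstanceAs (Ring.jacobson _).IsTwoSided
  obtain ⟨n, hn⟩ : IsNilpotent J := IsSemiprimaryRing.isNilpotent
  -- `S n` plays the role of `J ^ n ⊗ B` inside `Hom(C, B)`.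
  let S : ℕ → Submodule k (WithConv (C →ₗ[k] B)) := fun n =>
    Submodule.span k {f | ∃ α ∈ J ^ n, ∃ b, f = dualSMul α b}
  have h1 : e ∈ S 1 := by
    -- Expanding `e` in a basis of its finite-dimensional range writes it as a finite sum of terms
    -- `α_i b_i`. The coordinates `α_i` vanish wherever `e` does, in particular on grouplikes.
    let R := LinearMap.range e.ofConv
    let b := Module.finBasis k R
    let p : C →ₗ[k] R := e.ofConv.rangeRestrict
    have : e = ∑ i, dualSMul (WithConv.toConv (b.coord i ∘ₗ p)) (b i : B) := by
      refine WithConv.ext (LinearMap.ext fun c => ?_)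
      have := congrArg Subtype.val (b.sum_repr (p c))
      rw [AddSubmonoidClass.coe_finsetSum] at this
      rw [WithConv.ofConv_sum, LinearMap.sum_apply]
      exact this.symm
    rw [this]
    refine Submodule.sum_mem _ fun i _ => Submodule.subset_span ⟨_, ?_, _, rfl⟩
    rw [Submodule.pow_one]
    refine h.mem_jacobson fun g hg => ?_
    have hp : p g = 0 := Subtype.ext (he g hg)
    change b.coord i (p g) = 0
    rw [hp, map_zero]
  have hmul : ∀ a b, ∀ f ∈ S a, ∀ g ∈ S b, f * g ∈ S (a + b) := by
    intro a b f hf g hg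
    induction hf using Submodule.span_induction with
    | zero => rw [zero_mul]; exact Submodule.zero_mem _
    | add x y _ _ hx hy => rw [add_mul]; exact Submodule.add_mem _ hx hy
    | smul c x _ hx => rw [smul_mul_assoc]; exact Submodule.smul_mem _ c hx
    | mem x hx =>
      obtain ⟨α, hα, b1, rfl⟩ := hx
      induction hg using Submodule.span_induction with
      | zero => rw [mul_zero]; exact Submodule.zero_mem _
      | add x y _ _ hx hy => rw [mul_add]; exact Submodule.add_mem _ hx hy
      | smul c x _ hx => rw [mul_smul_comm]; exact Submodule.smul_mem _ c hx
      | mem x hx =>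
        obtain ⟨β, hβ, b2, rfl⟩ := hx
        rw [dualSMul_mul]
        refine Submodule.subset_span ⟨_, ?_, _, rfl⟩
        rw [Ideal.IsTwoSided.pow_add]
        exact Ideal.mul_mem_mul hα hβ
  have hpow : ∀ n : ℕ, e ^ (n + 1) ∈ S (n + 1) := by
    intro n
    induction n with
    | zero => simpa using h1
    | succ n ih => rw [pow_succ]; exact hmul _ _ _ ih _ h1
  refine ⟨n + 1, ?_⟩
  have h2 := hpow n
  have h3 : S (n + 1) = ⊥ := by
    refine Submodule.span_eq_bot.2 ?_
    rintro _ ⟨α, hα, b, rfl⟩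
    rw [Submodule.pow_succ, hn, Ideal.zero_eq_bot, Ideal.bot_mul, Submodule.mem_bot] at hα
    rw [hα]
    refine WithConv.ext (LinearMap.ext fun c => ?_)
    exact zero_smul k b
  rwa [h3, Submodule.mem_bot] at h2

/-- On a pointed coalgebra, a convolution idempotent vanishing on grouplikes is zero. -/
theorem IsPointed.eq_zero_of_isIdempotentElem (h : IsPointed k C) (e : WithConv (C →ₗ[k] B))
    (hid : IsIdempotentElem e) (he : ∀ g : C, IsGroupLikeElem k g → e g = 0) : e = 0 := by
  refine WithConv.ext (LinearMap.ext fun x => ?_)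
  -- Vanishing is tested at one element at a time, so the finite-dimensional nilpotency result
  -- applies to a subcoalgebra containing it.
  obtain ⟨D, hD, hfin, hx⟩ := exists_isSubcoalgebra_mem (k := k) x
  let _ := hD.coalgebra
  let i : D →ₗc[k] C :=
    { D.subtype with
      counit_comp := rfl
      map_comp_comul := LinearMap.ext fun x => hD.mapIncl_comul x }
  have hi : Function.Injective i := D.subtype_injective
  let e' : WithConv (D →ₗ[k] B) := WithConv.toConv (e.ofConv ∘ₗ i.toLinearMap)
  have hid' : IsIdempotentElem e' := by
    have := LinearMap.convMul_comp_coalgHom_distrib e e i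
    rw [hid.eq] at this
    exact (WithConv.ext this).symm
  obtain ⟨n, hn⟩ := exists_pow_eq_zero (h.of_injective i hi) e' fun g hg => he _ (hg.map i)
  -- An idempotent equals its positive powers; the exponent `n + 1` covers the case `n = 0`.
  have h0 : e' = 0 := by rw [← hid'.pow_succ_eq n, pow_succ, hn, zero_mul]
  exact LinearMap.congr_fun (congrArg WithConv.ofConv h0) ⟨x, hx⟩

end Pointed

/-! ### The commuting idempotents attached to grouplike elements -/

section EpsRight

variable {k : Type*} [Field k] {H : Type*} [Ring H] [HopfAlgebra k H]
variable {B : Type*} [Ring B] [Algebra k B] {π : H →ₗ[k] B}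

theorem IsPartialRep.eps_conv_eps (hπ : IsPartialRep π) : conv (eps π) (eps π) = eps π := by
  have := hπ.eps_conv_adj 1
  rwa [adj_one] at this

/-- The partial representation relation brings `S(h₂)` and `h₃ x` under one `π`, where the antipode
cancels. -/
theorem IsPartialRep.conv_pp_mm (hπ : IsPartialRep π) :
    conv (π ∘ₗ (pp k H).toLinearMap) (conv (antip π ∘ₗ (pp k H).toLinearMap)
      (π ∘ₗ (mm k H).toLinearMap)) =
    conv (π ∘ₗ (pp k H).toLinearMap) (π ∘ₗ (qq k H).toLinearMap) := by
  have s := hπ.rel_right (mm k H).toLinearMap (pp k H)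
  rwa [← conv_pp_qq, ← conv_assoc (antipode k ∘ₗ _), antipode_conv_id, one_conv,
    conv_pp_qq] at s

/-- Both sides equal `π(h₁) ε_x π(S h₂)`: the right one by `pi_eps`, the left one by `conv_pp_mm`
and the relation splitting `π(x₁) π(S(h x₂))`. -/
theorem IsPartialRep.conv_eps_pp_mm (hπ : IsPartialRep π) :
    conv (eps π ∘ₗ (pp k H).toLinearMap) (eps π ∘ₗ (mm k H).toLinearMap) =
      conv (eps π ∘ₗ (mm k H).toLinearMap) (eps π ∘ₗ (pp k H).toLinearMap) := by
  have r := hπ.rel_right (antipode k ∘ₗ (pp k H).toLinearMap) (qq k H)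
  rw [← antipode_mm] at r
  have r' : conv (π ∘ₗ (qq k H).toLinearMap) (conv (antip π ∘ₗ (qq k H).toLinearMap)
      (antip π ∘ₗ (pp k H).toLinearMap)) =
      conv (π ∘ₗ (qq k H).toLinearMap) (antip π ∘ₗ (mm k H).toLinearMap) := r
  conv_rhs => rw [conv_comp π (antip π) (pp k H), ← conv_assoc, ← hπ.pi_eps]
  rw [conv_comp, conv_comp, conv_comp, conv_assoc, ← conv_assoc (antip π ∘ₗ _), ← conv_assoc,
    hπ.conv_pp_mm, conv_assoc, ← r']
  simp only [conv_assoc]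

theorem comp_mm_flip {X : Type*} [AddCommMonoid X] [Module k X] (f : H →ₗ[k] X) (y : H) :
    (f ∘ₗ (mm k H).toLinearMap) ∘ₗ (TensorProduct.mk k H H).flip y =
      f ∘ₗ LinearMap.mulRight k y := by
  ext x
  simp

/-- `ε_{h₁} ε_{h₂ y} = ε_{h₁ y} ε_{h₂}`. -/
theorem IsPartialRep.eps_conv_eps_mulRight (hπ : IsPartialRep π) (y : H) :
    conv (eps π) (eps π ∘ₗ LinearMap.mulRight k y) =
      conv (eps π ∘ₗ LinearMap.mulRight k y) (eps π) := by
  ext h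
  have := LinearMap.congr_fun hπ.conv_eps_pp_mm (h ⊗ₜ y)
  rwa [conv, sw_prL, conv, sw_prL', comp_mm_flip] at this

/-- `ε_{h₁} π(h₂ y) = π(h) π(y)`. -/
theorem IsPartialRep.eps_conv_mulRight (hπ : IsPartialRep π) (y : H) :
    conv (eps π) (π ∘ₗ LinearMap.mulRight k y) = LinearMap.mulRight k (π y) ∘ₗ π := by
  ext h
  have := LinearMap.congr_fun hπ.conv_pp_mm (h ⊗ₜ y)
  rwa [← conv_assoc, ← conv_comp, conv, sw_prL, comp_mm_flip, conv, sw_prL_prR] at this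

/-- Right multiplication by a grouplike element is a morphism of coalgebras. -/
def mulRightGroupLike (g : GroupLike k H) : H →ₗc[k] H :=
  { LinearMap.mulRight k (g : H) with
    counit_comp := by ext x; simp [g.2.counit_eq_one]
    map_comp_comul := by
      ext x
      simp only [LinearMap.comp_apply, LinearMap.mulRight_apply, Bialgebra.comul_mul,
        g.2.comul_eq_tmul_self]
      generalize comul (R := k) x = s
      induction s with
      | zero => simp
      | add x y hx hy => simp only [map_add, add_mul, hx, hy]
      | tmul a b => simp }

theorem mulRightGroupLike_toLinearMap (g : GroupLike k H) :
    (mulRightGroupLike g).toLinearMap = LinearMap.mulRight k (g : H) := rfl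

theorem mulRight_comp_mulRight (y z : H) :
    LinearMap.mulRight k y ∘ₗ LinearMap.mulRight k z = LinearMap.mulRight k (z * y) := by
  ext x; simp [mul_assoc]

theorem val_mul_val_inv (g : GroupLike k H) : (g : H) * (g⁻¹ : GroupLike k H) = 1 := by
  rw [← GroupLike.val_mul, mul_inv_cancel, GroupLike.val_one]

/-- The element `h ↦ ε_{h g}` of the convolution algebra. -/
def epsRight (π : H →ₗ[k] B) (g : GroupLike k H) : WithConv (H →ₗ[k] B) :=
  WithConv.toConv (eps π ∘ₗ (mulRightGroupLike g).toLinearMap)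

theorem IsPartialRep.isIdempotentElem_epsRight (hπ : IsPartialRep π) (g : GroupLike k H) :
    IsIdempotentElem (epsRight π g) := by
  rw [IsIdempotentElem, mul_eq_conv, epsRight, ← conv_comp, hπ.eps_conv_eps]

/-- Translating by `g` reduces to commuting `ε` with `h ↦ ε_{h y}` for `y = g⁻¹ g'`. The translation
respects convolution because `g` is grouplike. -/
theorem IsPartialRep.commute_epsRight (hπ : IsPartialRep π) (g g' : GroupLike k H) :
    Commute (epsRight π g) (epsRight π g') := by
  have e : epsRight π g' = WithConv.toConv ((eps π ∘ₗ LinearMap.mulRight k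
      ((g⁻¹ * g' : GroupLike k H) : H)) ∘ₗ (mulRightGroupLike g).toLinearMap) := by
    rw [epsRight, mulRightGroupLike_toLinearMap, mulRightGroupLike_toLinearMap,
      LinearMap.comp_assoc, mulRight_comp_mulRight, ← GroupLike.val_mul, mul_inv_cancel_left]
  rw [Commute, SemiconjBy, mul_eq_conv, mul_eq_conv, e, epsRight, ← conv_comp, ← conv_comp,
    hπ.eps_conv_eps_mulRight]

/-- The element `∏_g (1 - ε_{- g})` of the convolution algebra. -/
def epsProd (π : H →ₗ[k] B) (l : List (GroupLike k H)) : WithConv (H →ₗ[k] B) :=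
  (l.map fun g => 1 - epsRight π g).prod

theorem IsPartialRep.isIdempotentElem_epsProd (hπ : IsPartialRep π) (l : List (GroupLike k H)) :
    IsIdempotentElem (epsProd π l) := by
  have hc : ∀ g g', Commute (1 - epsRight π g) (1 - epsRight π g') := fun g g' =>
    (Commute.one_left _).sub_left ((Commute.one_right _).sub_right (hπ.commute_epsRight g g'))
  induction l with
  | nil => exact IsIdempotentElem.one
  | cons g l ih =>
    rw [epsProd, List.map_cons, List.prod_cons]
    refine IsIdempotentElem.mul_of_commute ?_ (hπ.isIdempotentElem_epsRight g).one_sub ih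
    refine Commute.list_prod_right _ _ fun x hx => ?_
    obtain ⟨g', -, rfl⟩ := List.mem_map.1 hx
    exact hc g g'

theorem IsPartialRep.eps_one (hπ : IsPartialRep π) : eps π 1 = 1 := by
  have : (comul (R := k) (1 : H)) = 1 ⊗ₜ 1 := Bialgebra.comul_one
  simp [sw, this, hπ.map_one]

/-- The product is idempotent, so on a pointed coalgebra it only has to vanish at grouplikes. -/
theorem IsPartialRep.epsProd_eq_zero (hπ : IsPartialRep π) (hH : IsPointed k H)
    (l : List (GroupLike k H)) (hl : ∀ g, g ∈ l) : epsProd π l = 0 := by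
  refine hH.eq_zero_of_isIdempotentElem _ (hπ.isIdempotentElem_epsProd l) fun x hx => ?_
  -- Evaluation at a grouplike is multiplicative for convolution, so one vanishing factor is enough.
  -- At `x` it is the factor for `g = x⁻¹`, equal to `1 - ε_1 = 0`.
  let ev : WithConv (H →ₗ[k] B) →* B :=
    { toFun f := f x
      map_one' := by simp [hx.counit_eq_one]
      map_mul' f g := by simp [hx.comul_eq_tmul_self] }
  change ev (epsProd π l) = 0
  rw [epsProd, map_list_prod]
  refine List.prod_eq_zero (List.mem_map.2 ⟨_, List.mem_map.2 ⟨(⟨x, hx⟩ : GroupLike k H)⁻¹, hl _,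
    rfl⟩, ?_⟩)
  change (1 : WithConv (H →ₗ[k] B)) x - eps π (x * ((⟨x, hx⟩ : GroupLike k H)⁻¹ : GroupLike k H)) = 0
  have h1 : x * ((⟨x, hx⟩ : GroupLike k H)⁻¹ : GroupLike k H) = 1 := val_mul_val_inv ⟨x, hx⟩
  rw [h1, hπ.eps_one, LinearMap.convOne_apply, hx.counit_eq_one, _root_.map_one, sub_self]

end EpsRight

/-! ### Covariant functions and the dual basis formula -/

namespace PMod

section ConvAction

variable {k : Type*} [Field k] {C : Type*} [AddCommMonoid C] [Module k C] [Coalgebra k C]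
  {M : Type*} [AddCommGroup M] [Module k M]

/-- The action `c ↦ A(c₍₁₎)(f(c₍₂₎))` of the convolution algebra `Hom(C, End(M))` on
`Hom(C, M)`. -/
abbrev convAct (A : C →ₗ[k] Module.End k M) (f : C →ₗ[k] M) : C →ₗ[k] M :=
  sw (LinearMap.id : Module.End k M →ₗ[k] M →ₗ[k] M) A f

theorem conv_convAct (A A' : C →ₗ[k] Module.End k M) (f : C →ₗ[k] M) :
    convAct (conv A A') f = convAct A (convAct A' f) :=
  sw_assoc _ _ _ _ (fun _ _ _ => rfl) _ _ _

theorem one_convAct (f : C →ₗ[k] M) :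
    convAct (1 : WithConv (C →ₗ[k] Module.End k M)).ofConv f = f := by
  have : (1 : WithConv (C →ₗ[k] Module.End k M)).ofConv = cst 1 := by
    ext c; simp [cst, Algebra.algebraMap_eq_smul_one]
  rw [this, convAct, sw_cst_left]; rfl

theorem sub_convAct (A A' : C →ₗ[k] Module.End k M) (f : C →ₗ[k] M) :
    convAct (A - A') f = convAct A f - convAct A' f := by
  ext c
  simp only [convAct, sw, LinearMap.comp_apply, LinearMap.sub_apply]
  generalize comul (R := k) c = s
  induction s with
  | zero => simp
  | add x y hx hy => simp only [map_add, hx, hy]; abel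
  | tmul a b => simp

end ConvAction

variable {k H : Type u} [Field k] [Ring H] [HopfAlgebra k H]

section

variable {X : Type*} [AddCommGroup X] [Module k X]

theorem conv_apply_left (A A' : H →ₗ[k] Module.End k X) (v : X) :
    (conv A A').flip v = convAct A (A'.flip v) := by
  ext h
  simp only [LinearMap.flip_apply, conv, convAct, sw, LinearMap.comp_apply]
  generalize comul (R := k) h = s
  induction s with
  | zero => simp
  | add x y hx hy => simp only [map_add, hx, hy, LinearMap.add_apply]
  | tmul a b => simp

end

/-- The linear map underlying an element of `RegHom k H M`. -/
abbrev RegHom.lin {M : Type u} [AddCommGroup M] [Module k M] (f : RegHom k H M) : H →ₗ[k] M := f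

/-- The `H`-submodule of the `f : H → M` with `ε_{h₁} f(h₂ x) = h • f(x)`. -/
def covariant (M : PMod k H) : Submodule H (RegHom k H M) where
  carrier := {f | ∀ h x : H,
    convAct (eps M.act) (RegHom.lin f ∘ₗ LinearMap.mulRight k x) h = M.act h (f x)}
  add_mem' {f g} hf hg h x := by
    have e : convAct (eps M.act) (RegHom.lin (f + g) ∘ₗ LinearMap.mulRight k x) =
        convAct (eps M.act) (RegHom.lin f ∘ₗ LinearMap.mulRight k x) +
        convAct (eps M.act) (RegHom.lin g ∘ₗ LinearMap.mulRight k x) := by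
      have e0 : RegHom.lin (f + g) ∘ₗ LinearMap.mulRight k x =
        RegHom.lin f ∘ₗ LinearMap.mulRight k x + RegHom.lin g ∘ₗ LinearMap.mulRight k x := rfl
      rw [e0, convAct, sw, TensorProduct.map_add_right, LinearMap.add_comp, LinearMap.comp_add]
      rfl
    have e1 : (f + g) x = f x + g x := rfl
    rw [e, LinearMap.add_apply, hf h x, hg h x, e1, map_add]
  zero_mem' h x := by
    have e0 : RegHom.lin (0 : RegHom k H M) ∘ₗ LinearMap.mulRight k x = 0 := rfl
    have e1 : (0 : RegHom k H M) x = 0 := rfl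
    rw [e0, convAct, sw, TensorProduct.map_zero_right, LinearMap.zero_comp, LinearMap.comp_zero,
      e1, map_zero, LinearMap.zero_apply]
  smul_mem' l f hf h x := by
    have e0 : RegHom.lin (l • f) ∘ₗ LinearMap.mulRight k x =
        RegHom.lin f ∘ₗ LinearMap.mulRight k (x * l) := by
      rw [← mulRight_comp_mulRight]; rfl
    rw [e0]
    exact hf h (x * l)

/-- On a generator `φ(m)` covariance is the identity `ε_{h₁} π(h₂ x) = π(h) π(x)` applied to `m`. -/
theorem dilation_le_covariant (M : PMod k H) : M.dilation ≤ M.covariant := by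
  refine Submodule.span_le.2 ?_
  rintro _ ⟨m, rfl⟩ h x
  have := M.isPartialRep.eps_conv_mulRight x
  have := LinearMap.congr_fun (congrArg (fun f => LinearMap.flip f m) this) h
  rw [conv_apply_left] at this
  exact this

theorem smul_dilMap_mem (M : PMod k H) (h : H) (m : M) : h • M.dilMap m ∈ M.dilation :=
  Submodule.smul_mem _ _ (Submodule.subset_span ⟨m, rfl⟩)

theorem dilMap_sub (M : PMod k H) (m n : M) : M.dilMap (m - n) = M.dilMap m - M.dilMap n :=
  map_sub (LinearMap.flip M.act) m n

theorem dilMap_zero (M : PMod k H) : M.dilMap (0 : M) = 0 := map_zero (LinearMap.flip M.act)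

theorem dilMap_neg (M : PMod k H) (m : M) : M.dilMap (-m) = -M.dilMap m :=
  map_neg (LinearMap.flip M.act) m

theorem RegHom.sub_apply {M : Type u} [AddCommGroup M] [Module k M] (f g : RegHom k H M) (x : H) :
    (f - g) x = f x - g x := rfl

theorem par_mk (M : PMod k H) (h : H) : M.par (HPar.mk k H h) = M.act h := HPar.lift_mk _ _ _

/-- For covariant `f`, `f(g⁻¹) ∈ M` generates the function `x ↦ ε_{x₁ g} f(x₂)` in the standard
dilation. -/
theorem smul_dilMap_inv {M : PMod k H} {f : RegHom k H M} (hf : f ∈ M.covariant)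
    (g : GroupLike k H) : (g : H) • M.dilMap (f (g⁻¹ : GroupLike k H)) =
      convAct (epsRight M.act g).ofConv (RegHom.lin f) := by
  refine RegHom.ext fun x => ?_
  refine (hf (x * g) (g⁻¹ : GroupLike k H)).symm.trans ?_
  have := LinearMap.congr_fun (sw_comp (LinearMap.id : Module.End k M →ₗ[k] M →ₗ[k] M)
    (eps M.act) (RegHom.lin f ∘ₗ LinearMap.mulRight k ((g⁻¹ : GroupLike k H) : H))
    (mulRightGroupLike g)) x
  refine this.trans ?_
  rw [mulRightGroupLike_toLinearMap, LinearMap.comp_assoc, mulRight_comp_mulRight, val_mul_val_inv,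
    LinearMap.mulRight_one, LinearMap.comp_id]
  rfl

/-- The sum `∑ l • φ(y f(x))` over a list of triples `(l, y, x)`. -/
def dualSum (F : List (H × HPar k H × H)) (M : PMod k H) (f : RegHom k H M) : RegHom k H M :=
  (F.map fun t => t.1 • M.dilMap (M.par t.2.1 (f t.2.2))).sum

theorem dualSum_mem (F : List (H × HPar k H × H)) (M : PMod k H) (f : RegHom k H M) :
    dualSum F M f ∈ M.dilation := by
  refine list_sum_mem fun x hx => ?_
  obtain ⟨t, -, rfl⟩ := List.mem_map.1 hx
  exact smul_dilMap_mem _ _ _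

/-- The value of `l • φ(y f(z))` at `x` is `[x l] y f(z)`. Allowing coefficients in `H_par` in the
triples makes sums of this form closed under evaluating and reinserting. -/
theorem smul_dilMap_dualSum (g x : H) (F : List (H × HPar k H × H)) (M : PMod k H)
    (f : RegHom k H M) : g • M.dilMap (dualSum F M f x) =
      dualSum (F.map fun t => (g, HPar.mk k H (x * t.1) * t.2.1, t.2.2)) M f := by
  induction F with
  | nil =>
    have : dualSum [] M f x = 0 := rfl
    rw [this, dilMap_zero, smul_zero]; rfl
  | cons t F ih =>
    have e : dualSum (t :: F) M f x =
        M.act (x * t.1) (M.par t.2.1 (f t.2.2)) + dualSum F M f x := rfl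
    have e2 : M.dilMap (M.act (x * t.1) (M.par t.2.1 (f t.2.2)) + dualSum F M f x) =
      M.dilMap (M.act (x * t.1) (M.par t.2.1 (f t.2.2))) + M.dilMap (dualSum F M f x) :=
      map_add (LinearMap.flip M.act) _ _
    have e3 : M.par (HPar.mk k H (x * t.1) * t.2.1) (f t.2.2) =
        M.act (x * t.1) (M.par t.2.1 (f t.2.2)) := by
      rw [map_mul, par_mk]; rfl
    rw [e, e2, smul_add, ih, ← e3]
    rfl

theorem dualSum_neg (F : List (H × HPar k H × H)) (M : PMod k H) (f : RegHom k H M) :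
    dualSum (F.map fun t => (t.1, -t.2.1, t.2.2)) M f = -dualSum F M f := by
  induction F with
  | nil => exact neg_zero.symm
  | cons t F ih =>
    rw [List.map_cons, dualSum, List.map_cons, List.sum_cons, ← dualSum, ih]
    simp only [map_neg, LinearMap.neg_apply, dilMap_neg, smul_neg]
    rw [dualSum, dualSum, List.map_cons, List.sum_cons, neg_add]

theorem dualSum_append (F G : List (H × HPar k H × H)) (M : PMod k H) (f : RegHom k H M) :
    dualSum (F ++ G) M f = dualSum F M f + dualSum G M f := by
  rw [dualSum, List.map_append, List.sum_append]; rfl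

/-- Each grouplike `g` replaces the remainder `r` by `r - g • φ(r(g⁻¹))`, which by `smul_dilMap_inv`
is the action of `1 - ε_{(-)g}` on `r`. The quantifiers are ordered so that the list serves all `M`
and `f` simultaneously; injectivity of `theta` depends on this. -/
theorem exists_sub_dualSum_eq (l : List (GroupLike k H)) :
    ∃ F : List (H × HPar k H × H), ∀ (M : PMod k H) (f : RegHom k H M), f ∈ M.covariant →
      f - dualSum F M f = convAct (epsProd M.act l).ofConv (RegHom.lin f) := by
  induction l with
  | nil =>
    refine ⟨[], fun M f _ => ?_⟩
    have : dualSum [] M f = 0 := rfl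
    rw [this, sub_zero]
    exact (one_convAct _).symm
  | cons g l ih =>
    obtain ⟨F, hF⟩ := ih
    -- With `r = f - dualSum F M f`, the correction `g • φ(r(g⁻¹))` is `g • φ(f(g⁻¹))` minus `g • φ`
    -- of the old sum at `g⁻¹`. The first gives the single new triple, the second the negated
    -- transformed copy of `F`.
    refine ⟨F ++ ((g : H), (1 : HPar k H), ((g⁻¹ : GroupLike k H) : H)) ::
      (F.map fun t => ((g : H), HPar.mk k H (((g⁻¹ : GroupLike k H) : H) * t.1) * t.2.1,
        t.2.2)).map fun t => (t.1, -t.2.1, t.2.2), fun M f hf => ?_⟩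
    -- The remainder stays covariant because the subtracted sum lies in the dilation.
    have hr : f - dualSum F M f ∈ M.covariant :=
      M.covariant.sub_mem hf (M.dilation_le_covariant (dualSum_mem F M f))
    have h1 := smul_dilMap_inv hr g
    have e : convAct (epsProd M.act (g :: l)).ofConv (RegHom.lin f) =
        (f - dualSum F M f) - (g : H) •
          M.dilMap ((f - dualSum F M f) (g⁻¹ : GroupLike k H)) := by
      have e0 : (epsProd M.act (g :: l)).ofConv = conv
          ((1 : WithConv (H →ₗ[k] Module.End k M)).ofConv - (epsRight M.act g).ofConv)
          (epsProd M.act l).ofConv := rfl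
      rw [h1, e0, conv_convAct, sub_convAct, one_convAct, ← hF M f hf]
      rfl
    have hcons : ∀ (t : H × HPar k H × H) (G : List (H × HPar k H × H)), dualSum (t :: G) M f =
        t.1 • M.dilMap (M.par t.2.1 (f t.2.2)) + dualSum G M f := fun _ _ => rfl
    rw [e, RegHom.sub_apply, dilMap_sub, smul_sub, smul_dilMap_dualSum, dualSum_append, hcons,
      dualSum_neg, map_one, Module.End.one_apply]
    abel

/-- The dual basis property: a covariant `f` is a universal combination of its values. -/
theorem exists_dualSum_eq (hH : IsPointed k H) (hG : Finite (GroupLike k H)) :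
    ∃ F : List (H × HPar k H × H), ∀ (M : PMod k H) (f : RegHom k H M), f ∈ M.covariant →
      dualSum F M f = f := by
  have := Fintype.ofFinite (GroupLike k H)
  obtain ⟨F, hF⟩ := exists_sub_dualSum_eq (k := k) (Finset.univ : Finset (GroupLike k H)).toList
  refine ⟨F, fun M f hf => (sub_eq_zero.1 ((hF M f hf).trans ?_)).symm⟩
  rw [M.isPartialRep.epsProd_eq_zero hH _ fun g => Finset.mem_toList.2 (Finset.mem_univ g)]
  refine RegHom.ext fun x => ?_
  change convAct 0 _ x = 0
  rw [convAct, sw, TensorProduct.map_zero_left, LinearMap.zero_comp, LinearMap.comp_zero,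
    LinearMap.zero_apply]

theorem dilation_eq_covariant (hH : IsPointed k H) (hG : Finite (GroupLike k H)) (M : PMod k H) :
    M.dilation = M.covariant := by
  obtain ⟨F, hF⟩ := exists_dualSum_eq hH hG
  exact le_antisymm M.dilation_le_covariant fun f hf => hF M f hf ▸ dualSum_mem F M f

end PMod

/-- In `α(h₁) β(h₂) β(S h₃) α(S h₄)` the inner factors cancel, `β` being multiplicative. Hence
tensoring with a global module does not alter the operators `ε_h`. -/
theorem eps_conv_algHom {k : Type*} [Field k] {H : Type*} [Ring H] [HopfAlgebra k H]
    {B : Type*} [Ring B] [Algebra k B] {α : H →ₗ[k] B} {β : H →ₐ[k] B}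
    (hc : ∀ x y, Commute (α x) (β y)) : eps (conv α β.toLinearMap) = eps α := by
  have h : conv β.toLinearMap (antip β.toLinearMap) = cst 1 :=
    algHom_conv_antip (CoalgHom.id k H)
  rw [eps, conv_comp_antipode hc, conv_assoc, ← conv_assoc β.toLinearMap, h, one_conv]

namespace PMod

variable {k H : Type u} [Field k] [Ring H] [HopfAlgebra k H]

/-! ### Morphisms out of `A_par ⊗ N` -/

section ATensor

variable (N : Type u) [AddCommGroup N] [Module k N] [Module H N] [IsScalarTower k H N]

theorem sw_mapBilinear_eq_conv (M : PMod k H) :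
    sw (TensorProduct.mapBilinear (.id k) M N M N) M.act (Algebra.lsmul k k N).toLinearMap =
      conv ((Module.End.rTensorAlgHom k M N).toLinearMap ∘ₗ M.act)
        ((Module.End.lTensorAlgHom k N M).comp
          (Algebra.lsmul k k N : H →ₐ[k] Module.End k N)).toLinearMap := by
  have h := sw_comp₂ (LinearMap.mul k (Module.End k (M ⊗[k] N)))
    (Module.End.rTensorAlgHom k M N).toLinearMap (Module.End.lTensorAlgHom k N M).toLinearMap
    M.act (Algebra.lsmul k k N : H →ₐ[k] Module.End k N).toLinearMap
  refine Eq.trans ?_ h.symm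
  congr 1
  ext f g m x
  rfl

theorem commute_rTensor_lTensor (M : PMod k H) (x y : H) :
    Commute (((Module.End.rTensorAlgHom k M N).toLinearMap ∘ₗ M.act) x)
      (((Module.End.lTensorAlgHom k N M).comp
        (Algebra.lsmul k k N : H →ₐ[k] Module.End k N)) y) := by
  ext m z
  rfl

/-- The partial module `M ⊗ N`, for a partial module `M` and a global module `N`. -/
def tensorGlobal (M : PMod k H) : PMod k H where
  carrier := M ⊗[k] N
  act := sw (TensorProduct.mapBilinear (.id k) M N M N) M.act (Algebra.lsmul k k N).toLinearMap
  isPartialRep := by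
    rw [sw_mapBilinear_eq_conv]
    exact (M.isPartialRep.algHom_comp _).conv_algHom (commute_rTensor_lTensor N M)

theorem eps_tensorGlobal (M : PMod k H) (h : H) :
    eps (M.tensorGlobal N).act h = Module.End.rTensorAlgHom k M N (eps M.act h) := by
  have e : (M.tensorGlobal N).act = _ := sw_mapBilinear_eq_conv N M
  have e2 := LinearMap.congr_fun (eps_conv_algHom (commute_rTensor_lTensor N M)) h
  refine (congrArg (fun π => eps π h) e).trans (e2.trans ?_)
  exact (algHom_conv_apply (Module.End.rTensorAlgHom k M N) M.act (antip M.act) h).symm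

theorem par_eps (M : PMod k H) (h : H) : M.par (eps (HPar.mk k H) h) = eps M.act h := by
  have e : M.par.toLinearMap ∘ₗ HPar.mk k H = M.act := LinearMap.ext fun h => par_mk M h
  rw [algHom_conv_apply, e, ← e]; rfl

variable (k H) in
/-- The left multiplication of `A_par` on itself. -/
def aParMul : epsAlg (HPar.mk k H) →ₐ[k] Module.End k (aPar k H) :=
  Algebra.lmul k (epsAlg (HPar.mk k H))

/-- `A_par` acts on `A_par ⊗ N` by left multiplication. -/
theorem par_tensorGlobal (a : epsAlg (HPar.mk k H)) :
    ((aPar k H).tensorGlobal N).par a =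
      Module.End.rTensorAlgHom k (aPar k H) N (aParMul k H a) := by
  have e : ((aPar k H).tensorGlobal N).par.comp (epsAlg (HPar.mk k H)).val =
      (Module.End.rTensorAlgHom k (aPar k H) N).comp (aParMul k H) := by
    refine AlgHom.adjoin_ext (s := Set.range (eps (HPar.mk k H))) ?_
    rintro _ ⟨h, rfl⟩
    refine (par_eps _ h).trans ((eps_tensorGlobal N _ h).trans ?_)
    refine congrArg (Module.End.rTensorAlgHom k (aPar k H) N) ?_
    exact LinearMap.ext fun b => Subtype.ext
      ((HPar.mk_isPartialRep k H).coe_conv_adjAct_antip h b)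
  exact DFunLike.congr_fun e a

variable {N} {M : PMod k H}

variable (k H) in
/-- The unit of `A_par`. -/
def aParOne : aPar k H := (1 : epsAlg (HPar.mk k H))

/-- The map `x ↦ u(1 ⊗ x n)` of a morphism `u : A_par ⊗ N → M`. -/
def unitEval (u : (aPar k H).tensorGlobal N ⟶ M) (n : N) : RegHom k H M :=
  Hom.toLin u ∘ₗ (TensorProduct.mk k (aPar k H) N (aParOne k H)) ∘ₗ
    (LinearMap.flip (Algebra.lsmul k k N : H →ₐ[k] Module.End k N).toLinearMap n)

theorem unitEval_apply (u : (aPar k H).tensorGlobal N ⟶ M) (n : N) (x : H) :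
    unitEval u n x = Hom.toLin u ((aParOne k H) ⊗ₜ[k] (x • n)) := rfl

/-- Shows that `1 ⊗ N` generates `A_par ⊗ N` over `H_par`, so a morphism is determined by its values
there. -/
theorem tmul_eq_par (a : epsAlg (HPar.mk k H)) (n : N) :
    ((show aPar k H from a) ⊗ₜ[k] n : (aPar k H) ⊗[k] N) =
      ((aPar k H).tensorGlobal N).par a ((aParOne k H) ⊗ₜ[k] n : (aPar k H) ⊗[k] N) := by
  rw [par_tensorGlobal]
  exact congrArg (fun b : epsAlg (HPar.mk k H) => ((show aPar k H from b) ⊗ₜ[k] n :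
    (aPar k H) ⊗[k] N)) (mul_one a).symm

theorem toLin_tmul (u : (aPar k H).tensorGlobal N ⟶ M) (a : epsAlg (HPar.mk k H)) (n : N) :
    Hom.toLin u ((show aPar k H from a) ⊗ₜ[k] n : (aPar k H) ⊗[k] N) =
      M.par a (unitEval u n 1) := by
  rw [tmul_eq_par, unitEval_apply, one_smul]
  exact map_par u _ _

/-- Since `h • 1 = ε_h` in `A_par`, the diagonal action on `1 ⊗ n` produces `ε_{h₁} ⊗ h₂ n`. -/
theorem act_one_tmul (h : H) (n : N) :
    ((aPar k H).tensorGlobal N).act h ((aParOne k H) ⊗ₜ[k] n : (aPar k H) ⊗[k] N) =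
      convAct ((Module.End.rTensorAlgHom k (aPar k H) N).toLinearMap ∘ₗ eps (aPar k H).act)
        (TensorProduct.mk k (aPar k H) N (aParOne k H) ∘ₗ
          LinearMap.flip (Algebra.lsmul k k N : H →ₐ[k] Module.End k N).toLinearMap n) h := by
  have e1 : ∀ a : H, (aPar k H).act a (aParOne k H) = eps (aPar k H).act a (aParOne k H) := by
    intro a
    refine Subtype.ext ?_
    refine Eq.trans ?_ ((HPar.mk_isPartialRep k H).coe_conv_adjAct_antip a 1).symm
    refine (LinearMap.congr_fun (adj_one (HPar.mk k H)) a).trans ?_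
    exact (mul_one _).symm
  have e2 : ∀ s : H ⊗[k] H, TensorProduct.lift (TensorProduct.mapBilinear (.id k) (aPar k H) N
      (aPar k H) N) (TensorProduct.map (aPar k H).act (Algebra.lsmul k k N).toLinearMap s)
      ((aParOne k H) ⊗ₜ[k] n) = TensorProduct.lift (LinearMap.id : Module.End k
        ((aPar k H) ⊗[k] N) →ₗ[k] _) (TensorProduct.map
        ((Module.End.rTensorAlgHom k (aPar k H) N).toLinearMap ∘ₗ eps (aPar k H).act)
        (TensorProduct.mk k (aPar k H) N (aParOne k H) ∘ₗ
        LinearMap.flip (Algebra.lsmul k k N : H →ₐ[k] Module.End k N).toLinearMap n) s) := by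
    intro s
    induction s with
    | zero => simp
    | add x y hx hy => simp only [map_add, LinearMap.add_apply, hx, hy]
    | tmul a b => exact congrArg (· ⊗ₜ[k] (b • n)) (e1 a)
  exact e2 (comul h)

theorem comp_convAct {C X Y : Type*} [AddCommMonoid C] [Module k C] [Coalgebra k C]
    [AddCommGroup X] [Module k X] [AddCommGroup Y] [Module k Y] (φ : X →ₗ[k] Y)
    (A : C →ₗ[k] Module.End k X) (A' : C →ₗ[k] Module.End k Y) (f : C →ₗ[k] X)
    (h : ∀ c x, φ (A c x) = A' c (φ x)) : φ ∘ₗ convAct A f = convAct A' (φ ∘ₗ f) := by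
  ext c
  simp only [convAct, sw, LinearMap.comp_apply]
  generalize comul (R := k) c = s
  induction s with
  | zero => simp
  | add x y hx hy => simp only [map_add, hx, hy]
  | tmul a b => simp [h]

/-- This is where covariance originates: apply `u` to `h • (1 ⊗ x n) = ε_{h₁} ⊗ h₂ x n` and use that
`u` commutes with each `ε`, as an element of `H_par`. -/
theorem unitEval_mem (u : (aPar k H).tensorGlobal N ⟶ M) (n : N) :
    unitEval u n ∈ M.covariant := by
  intro h x
  have e1 := congrArg (Hom.toLin u) (act_one_tmul (k := k) h (x • n))
  have e2 := comp_convAct (Hom.toLin u)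
    ((Module.End.rTensorAlgHom k (aPar k H) N).toLinearMap ∘ₗ eps (aPar k H).act) (eps M.act)
    (TensorProduct.mk k (aPar k H) N (aParOne k H) ∘ₗ
        LinearMap.flip (Algebra.lsmul k k N : H →ₐ[k] Module.End k N).toLinearMap (x • n))
    (fun a t => by
      rw [← par_eps]
      refine Eq.trans ?_ (map_par u _ _)
      rw [par_eps, eps_tensorGlobal]
      rfl)
  refine Eq.trans ?_ (((LinearMap.congr_fun e2 h).symm.trans e1.symm).trans
    (Hom.map_act u h _))
  refine congrArg (fun f => convAct (eps M.act) f h) (LinearMap.ext fun y => ?_)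
  change Hom.toLin u (_ ⊗ₜ[k] ((y * x) • n)) = Hom.toLin u (_ ⊗ₜ[k] (y • x • n))
  rw [mul_smul]

theorem smul_unitEval (u : (aPar k H).tensorGlobal N ⟶ M) (h : H) (n : N) :
    h • unitEval u n = unitEval u (h • n) := by
  refine RegHom.ext fun x => ?_
  rw [RegHom.smul_apply, unitEval_apply, unitEval_apply, mul_smul]

/-- `∑ (h₁ · a) f(h₂) = h • (a f(1))` for covariant `f`. -/
theorem convAct_adj {f : RegHom k H M} (hf : f ∈ M.covariant) (a : epsAlg (HPar.mk k H)) (h : H) :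
    convAct (M.par.toLinearMap ∘ₗ (adj (HPar.mk k H)).flip (a : HPar k H)) (RegHom.lin f) h =
      M.act h (M.par a (f 1)) := by
  have hπ := HPar.mk_isPartialRep k H
  -- With `h · a = (h₁ · a) ε_{h₂}`, the operator `ε` can be absorbed by covariance, `ε_{h₁} f(h₂) =
  -- h • f(1)`. Then `(h₁ · a) [h₂] = [h] a` finishes.
  have e1 : (adj (HPar.mk k H)).flip (a : HPar k H) =
      conv ((adj (HPar.mk k H)).flip (a : HPar k H)) (eps (HPar.mk k H)) := by
    have := hπ.adj_mul a.2 1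
    rwa [mul_one, adj_one] at this
  have e2 : conv ((adj (HPar.mk k H)).flip (a : HPar k H)) (HPar.mk k H) =
      conv (HPar.mk k H) (cst (a : HPar k H)) := hπ.adj_conv a.2 (CoalgHom.id k H)
  have e3 : M.par.toLinearMap ∘ₗ HPar.mk k H = M.act := LinearMap.ext fun h => par_mk M h
  have e4 : M.par.toLinearMap ∘ₗ eps (HPar.mk k H) = eps M.act :=
    LinearMap.ext fun h => par_eps M h
  have e5 : convAct (eps M.act) (RegHom.lin f) = M.act.flip (f 1) := by
    ext x
    have := hf x 1
    rwa [LinearMap.mulRight_one, LinearMap.comp_id] at this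
  rw [e1, algHom_comp_conv, e4, conv_convAct, e5, ← e3,
    ← conv_apply_left (M.par.toLinearMap ∘ₗ (adj (HPar.mk k H)).flip (a : HPar k H))
      (M.par.toLinearMap ∘ₗ HPar.mk k H), ← algHom_comp_conv, e2, conv_cst]
  simp

theorem RegHom.algebraMap_smul {M : Type u} [AddCommGroup M] [Module k M] (c : k)
    (f : RegHom k H M) (x : H) : (algebraMap k H c • f) x = c • f x := by
  rw [RegHom.smul_apply, ← Algebra.commutes, ← Algebra.smul_def]
  exact map_smul (RegHom.lin f) c x

/-- The linear map `n ↦ F(n)(1)`. -/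
def evalOne (F : N →ₗ[H] RegHom k H M) : N →ₗ[k] M where
  toFun n := F n 1
  map_add' n n' := by rw [map_add]; rfl
  map_smul' c n := by
    rw [← algebraMap_smul H c n, map_smul, RegHom.algebraMap_smul]; rfl

/-- The linear map `a ⊗ n ↦ a F(n)(1)`. -/
def ofUnitEvalLin (F : N →ₗ[H] RegHom k H M) : (aPar k H) ⊗[k] N →ₗ[k] M :=
  TensorProduct.lift (show epsAlg (HPar.mk k H) →ₗ[k] N →ₗ[k] M from
    LinearMap.lcomp k M (evalOne F) ∘ₗ M.par.toLinearMap ∘ₗ (epsAlg (HPar.mk k H)).val.toLinearMap)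

theorem ofUnitEvalLin_tmul (F : N →ₗ[H] RegHom k H M) (a : epsAlg (HPar.mk k H)) (n : N) :
    ofUnitEvalLin F ((show aPar k H from a) ⊗ₜ[k] n) = M.par a (F n 1) := rfl

/-- The morphism `a ⊗ n ↦ a F(n)(1)` associated with an `H`-linear map `F` into the covariant
functions. -/
def ofUnitEval (F : N →ₗ[H] RegHom k H M) (hF : ∀ n, F n ∈ M.covariant) :
    (aPar k H).tensorGlobal N ⟶ M where
  toLin := ofUnitEvalLin F
  map_act h t := by
    have key : ∀ t : (aPar k H) ⊗[k] N,
        ofUnitEvalLin F (((aPar k H).tensorGlobal N).act h t) = M.act h (ofUnitEvalLin F t) := by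
      intro t
      induction t with
      | zero =>
        have : ((aPar k H).tensorGlobal N).act h (0 : (aPar k H) ⊗[k] N) = (0 : _ ⊗[k] _) :=
          map_zero (((aPar k H).tensorGlobal N).act h)
        rw [this, map_zero, map_zero]
      | add x y hx hy =>
        have : ((aPar k H).tensorGlobal N).act h (x + y : (aPar k H) ⊗[k] N) =
          (((aPar k H).tensorGlobal N).act h x + ((aPar k H).tensorGlobal N).act h y : _ ⊗[k] _) :=
          map_add (((aPar k H).tensorGlobal N).act h) x y
        rw [this, map_add (ofUnitEvalLin F) x y, map_add (M.act h), ← hx, ← hy]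
        exact map_add (ofUnitEvalLin F) _ _
      | tmul a n =>
        -- By `H`-linearity `F(y n)(1) = F(n)(y)`, so the image of `h • (a ⊗ n)` is the sum `(h₁ ·
        -- a) F(n)(h₂)` treated by `convAct_adj`.
        refine Eq.trans ?_ (convAct_adj (hF n) a h)
        have e : ∀ s : H ⊗[k] H, ofUnitEvalLin F (TensorProduct.lift
            (TensorProduct.mapBilinear (.id k) (aPar k H) N (aPar k H) N) (TensorProduct.map
            (aPar k H).act (Algebra.lsmul k k N).toLinearMap s) (a ⊗ₜ[k] n)) =
            TensorProduct.lift (LinearMap.id : Module.End k M →ₗ[k] _) (TensorProduct.map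
            (M.par.toLinearMap ∘ₗ (adj (HPar.mk k H)).flip
              ((show epsAlg (HPar.mk k H) from a) : HPar k H)) (RegHom.lin (F n)) s) := by
          intro s
          induction s with
          | zero => simp
          | add x y hx hy => simp only [map_add, LinearMap.add_apply, hx, hy]
          | tmul x y =>
            refine (ofUnitEvalLin_tmul F _ (y • n)).trans ?_
            rw [map_smul, RegHom.smul_apply, one_mul]
            rfl
        exact e (comul h)
    exact key t

theorem ofUnitEval_tmul (F : N →ₗ[H] RegHom k H M) (hF : ∀ n, F n ∈ M.covariant)
    (a : epsAlg (HPar.mk k H)) (n : N) :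
    Hom.toLin (ofUnitEval F hF) ((show aPar k H from a) ⊗ₜ[k] n : (aPar k H) ⊗[k] N) =
      M.par a (F n 1) := rfl

theorem unitEval_ofUnitEval (F : N →ₗ[H] RegHom k H M) (hF : ∀ n, F n ∈ M.covariant) (n : N) :
    unitEval (ofUnitEval F hF) n = F n := by
  refine RegHom.ext fun x => ?_
  refine (ofUnitEval_tmul F hF 1 (x • n)).trans ?_
  rw [map_smul, RegHom.smul_apply, one_mul, OneMemClass.coe_one, map_one, Module.End.one_apply]

theorem hom_ext_unitEval {u v : (aPar k H).tensorGlobal N ⟶ M}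
    (h : ∀ n, unitEval u n = unitEval v n) : u = v := by
  refine Hom.ext (TensorProduct.ext' fun a n => ?_)
  exact (toLin_tmul u a n).trans ((congrArg (fun f : RegHom k H M =>
    M.par (show epsAlg (HPar.mk k H) from a : HPar k H) (f 1)) (h n)).trans (toLin_tmul v a n).symm)

end ATensor

end PMod

namespace PMod

variable {k H : Type u} [Field k] [Ring H] [HopfAlgebra k H]

/-! ### Exactness -/

/-- Injectivity and vanishing of the composite are checked pointwise. Exactness in the middle uses
the covariant description, surjectivity the description by generators. -/
theorem dilationFunctor_exact (hD : ∀ M : PMod k H, M.dilation = M.covariant) :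
    IsExactFunctor (dilationFunctor k H) := by
  intro L M N f g hf hfg hg
  refine ⟨fun u v huv => ?_, fun y => ⟨fun hy => ?_, ?_⟩, fun y => ?_⟩
  · refine Subtype.ext (RegHom.ext fun x => hf ?_)
    exact congrArg (fun w : M.dilation => (w : RegHom k H M) x) huv
  · let y₀ : RegHom k H M := (show M.dilation from y).1
    have hy' : ∀ x, ∃ l, Hom.toLin f l = y₀ x := fun x =>
      (hfg _).1 (congrArg (fun w : N.dilation => (w : RegHom k H N) x) hy)
    let e := LinearEquiv.ofInjective (Hom.toLin f) hf
    -- The pointwise preimage under the injective map `f`; its covariance may be tested after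
    -- applying `f`, which commutes with every `ε`.
    let u : RegHom k H L := e.symm.toLinearMap ∘ₗ
      (RegHom.lin y₀).codRestrict (LinearMap.range (Hom.toLin f)) hy'
    have hu : ∀ x, Hom.toLin f (u x) = y₀ x := fun x =>
      congrArg Subtype.val (e.apply_symm_apply ⟨y₀ x, hy' x⟩)
    have huE : u ∈ L.covariant := by
      intro h x
      refine hf ?_
      have hyE : y₀ ∈ M.covariant := hD M ▸ (show M.dilation from y).2
      have e1 := comp_convAct (Hom.toLin f) (eps L.act) (eps M.act)
        (RegHom.lin u ∘ₗ LinearMap.mulRight k x) (fun a t => by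
          rw [← par_eps, ← par_eps]; exact map_par f _ _)
      refine (LinearMap.congr_fun e1 h).trans ?_
      refine Eq.trans ?_ ((hyE h x).trans ((congrArg (M.act h) (hu x)).symm.trans
        (Hom.map_act f h (u x)).symm))
      refine congrArg (fun f => convAct (eps M.act) f h) (LinearMap.ext fun z => hu (z * x))
    exact ⟨⟨u, (hD L).symm ▸ huE⟩, Subtype.ext (RegHom.ext hu)⟩
  · rintro ⟨u, rfl⟩
    exact Subtype.ext (RegHom.ext fun x => (hfg _).2 ⟨_, rfl⟩)
  · obtain ⟨y, hy⟩ := y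
    have : ∀ y ∈ N.dilation, ∃ v ∈ M.dilation, RegHom.postcomp (Hom.toLin g) v = y := by
      intro y hy
      induction hy using Submodule.span_induction with
      | mem x hx =>
        obtain ⟨n, rfl⟩ := hx
        obtain ⟨m, rfl⟩ := hg n
        exact ⟨M.dilMap m, Submodule.subset_span ⟨m, rfl⟩, postcomp_dilMap g m⟩
      | zero => exact ⟨0, zero_mem _, map_zero _⟩
      | add x y _ _ hx hy =>
        obtain ⟨v, hv, rfl⟩ := hx
        obtain ⟨w, hw, rfl⟩ := hy
        exact ⟨v + w, add_mem hv hw, map_add _ _ _⟩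
      | smul h x _ hx =>
        obtain ⟨v, hv, rfl⟩ := hx
        exact ⟨h • v, Submodule.smul_mem _ h hv, map_smul _ _ _⟩
    obtain ⟨v, hv, hvy⟩ := this y hy
    exact ⟨⟨v, hv⟩, Subtype.ext hvy⟩

/-! ### The isomorphism with `{A_par, -}` -/

/-- An element of `{A_par, M}` as a morphism of partial modules. -/
def homObjHom {M : PMod k H} (F : homObj (aPar k H) M) : (aPar k H).tensorGlobal H ⟶ M :=
  ⟨F.1, F.2⟩

/-- `F ↦ F(1 ⊗ -)`. -/
def homObjToDilation (hD : ∀ M : PMod k H, M.dilation = M.covariant) (M : PMod k H) :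
    homObj (aPar k H) M →ₗ[H] M.dilation where
  toFun F := ⟨unitEval (homObjHom F) 1, (hD M).symm ▸ unitEval_mem _ _⟩
  map_add' _ _ := rfl
  map_smul' h F := by
    refine Subtype.ext (RegHom.ext fun x => ?_)
    change F.1 (aParOne k H ⊗ₜ[k] ((x * 1) * h)) = F.1 (aParOne k H ⊗ₜ[k] ((x * h) * 1))
    rw [mul_one, mul_one]

/-- The correspondence between morphisms `A_par ⊗ N → M` and `H`-linear maps from `N` to covariant
functions, for `N = H`: an `H`-linear map from `H` amounts to the image of `1`. -/
theorem homObjToDilation_bijective (hD : ∀ M : PMod k H, M.dilation = M.covariant)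
    (M : PMod k H) : Function.Bijective (homObjToDilation hD M) := by
  constructor
  · intro F G h
    have h1 : unitEval (homObjHom F) 1 = unitEval (homObjHom G) 1 := congrArg Subtype.val h
    have h2 : homObjHom F = homObjHom G := hom_ext_unitEval fun n => by
      rw [← mul_one n, ← smul_eq_mul, ← smul_unitEval, ← smul_unitEval, h1]
    exact Subtype.ext (congrArg Hom.toLin h2)
  · intro f
    let F : H →ₗ[H] RegHom k H M := LinearMap.toSpanSingleton H _ (f : RegHom k H M)
    have hF : ∀ n, F n ∈ M.covariant := fun n => hD M ▸ M.dilation.smul_mem n f.2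
    let u := ofUnitEval F hF
    refine ⟨⟨Hom.toLin u, Hom.map_act u⟩, Subtype.ext ?_⟩
    exact (unitEval_ofUnitEval F hF 1).trans (one_smul H _)

/-- The natural isomorphism `D ≅ {A_par, -}`. -/
def dilationIsoHom (hD : ∀ M : PMod k H, M.dilation = M.covariant) :
    dilationFunctor k H ≅ homFunctor (aPar k H) :=
  (NatIso.ofComponents (fun M => (LinearEquiv.ofBijective (homObjToDilation hD M)
    (homObjToDilation_bijective hD M)).toModuleIso) (fun _ => rfl)).symm

/-! ### The isomorphism with `D(H_par) ⊗ -` -/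

variable (k H) in
/-- The left multiplication of `H_par` on itself. -/
def hParMul : HPar k H →ₐ[k] Module.End k (hPar k H) := Algebra.lmul k (HPar k H)

theorem par_hPar (y x : HPar k H) : (hPar k H).par y x = y * x := by
  have e : (hPar k H).par = hParMul k H := by
    refine AlgHom.ext fun y => ?_
    induction y using HPar.induction_mk with
    | halg c => rw [AlgHom.commutes, AlgHom.commutes]
    | hmk h => exact par_mk _ h
    | hadd x y hx hy => rw [map_add, map_add, hx, hy]
    | hmul x y hx hy => rw [map_mul, map_mul, hx, hy]
  exact LinearMap.congr_fun (DFunLike.congr_fun e y) x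

/-- The linear map `y ↦ y m` from `H_par`. -/
def parEval (M : PMod k H) (m : M) : hPar k H →ₗ[k] M :=
  show HPar k H →ₗ[k] M from M.par.toLinearMap.flip m

theorem postcomp_parEval_dilMap (M : PMod k H) (m : M) (y : HPar k H) :
    RegHom.postcomp (parEval M m) ((hPar k H).dilMap y) = M.dilMap (M.par y m) := by
  refine RegHom.ext fun x => ?_
  change M.par (HPar.mk k H x * y) m = M.act x (M.par y m)
  rw [map_mul, par_mk]; rfl

/-- The bilinear map `(f, m) ↦ (x ↦ f(x) m)`. -/
def thetaBilin (M : PMod k H) : (hPar k H).dilation →ₗ[H] M →ₗ[k] M.dilation where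
  toFun f :=
    { toFun m := ⟨RegHom.postcomp (parEval M m) (f : RegHom k H (hPar k H)),
        postcomp_mem _ (fun y => (postcomp_parEval_dilMap M m y).symm ▸
          Submodule.subset_span ⟨_, rfl⟩) f.2⟩
      map_add' m n := Subtype.ext (RegHom.ext fun x =>
        map_add (M.par ((f : RegHom k H (hPar k H)) x)) m n)
      map_smul' c m := Subtype.ext (RegHom.ext fun x =>
        map_smul (M.par ((f : RegHom k H (hPar k H)) x)) c m) }
  map_add' f g := LinearMap.ext fun m => Subtype.ext (map_add (RegHom.postcomp (parEval M m))
    (f : RegHom k H (hPar k H)) (g : RegHom k H (hPar k H)))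
  map_smul' h f := LinearMap.ext fun m => Subtype.ext (map_smul (RegHom.postcomp (parEval M m))
    h (f : RegHom k H (hPar k H)))

/-- The `H`-linear map `f ⊗ m ↦ (x ↦ f(x) m)`. -/
def thetaLift (M : PMod k H) : (hPar k H).dilation ⊗[k] M →ₗ[H] M.dilation :=
  TensorProduct.AlgebraTensorModule.lift (thetaBilin M)

theorem thetaLift_tmul (M : PMod k H) (f : (hPar k H).dilation) (m : M) (x : H) :
    (thetaLift M (f ⊗ₜ[k] m) : RegHom k H M) x =
      M.par ((f : RegHom k H (hPar k H)) x) m := rfl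

theorem balanced_le_ker_thetaLift (M : PMod k H) :
    balanced M ≤ LinearMap.ker (thetaLift M) := by
  refine Submodule.span_le.2 ?_
  rintro _ ⟨f, y, m, rfl⟩
  rw [SetLike.mem_coe, LinearMap.mem_ker, map_sub, sub_eq_zero]
  refine Subtype.ext (RegHom.ext fun x => ?_)
  rw [thetaLift_tmul, thetaLift_tmul]
  exact LinearMap.congr_fun (map_mul M.par (show HPar k H from (f : RegHom k H (hPar k H)) x) y) m

/-- The `H`-linear map `D(H_par) ⊗_{H_par} M → D(M)`, `f ⊗ m ↦ (x ↦ f(x) m)`. -/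
def theta (M : PMod k H) : parTensor M →ₗ[H] M.dilation :=
  (balanced M).liftQ (thetaLift M) (balanced_le_ker_thetaLift M)

/-- The element `l ⇀ φ(y)` of the dilation of `H_par`. -/
def dilGen (l : H) (y : HPar k H) : (hPar k H).dilation :=
  ⟨l • (hPar k H).dilMap y, smul_dilMap_mem _ _ _⟩

theorem dilRight_dilGen (l : H) (y z : HPar k H) : dilRight z (dilGen l y) = dilGen l (y * z) := by
  refine Subtype.ext ?_
  change RegHom.postcomp (hParRight z) (l • (hPar k H).dilMap y) = l • (hPar k H).dilMap (y * z)
  exact (map_smul _ _ _).trans (congrArg (l • ·) (postcomp_hParRight z y))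

/-- The dual basis formula on `H_par` reads `f = ∑ (l ⇀ φ(y)) ◁ f(x)`. Moving `f(x)` across the
balanced tensor product expresses `f ⊗ m` through the values `f(x) m` of its image, which gives
injectivity. -/
theorem theta_bijective (hH : IsPointed k H) (hG : Finite (GroupLike k H)) (M : PMod k H) :
    Function.Bijective (theta M) := by
  obtain ⟨F, hF⟩ := exists_dualSum_eq hH hG
  constructor
  · have key : ∀ z : (hPar k H).dilation ⊗[k] M, (balanced M).mkQ z =
        (F.map fun t => (balanced M).mkQ (dilGen t.1 t.2.1 ⊗ₜ[k]
          (thetaLift M z : RegHom k H M) t.2.2)).sum := by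
      intro z
      induction z with
      | zero =>
        rw [map_zero, List.sum_eq_zero]
        intro x hx
        obtain ⟨t, -, rfl⟩ := List.mem_map.1 hx
        have : ((thetaLift M 0 : M.dilation) : RegHom k H M) t.2.2 = 0 := by
          rw [map_zero]; rfl
        rw [this, TensorProduct.tmul_zero, map_zero]
      | add x y hx hy =>
        rw [map_add, hx, hy, ← List.sum_map_add]
        refine congrArg List.sum (List.map_congr_left fun t _ => ?_)
        rw [← map_add, ← TensorProduct.tmul_add, map_add]; rfl
      | tmul f m =>
        have h1 : ∀ G : List (H × HPar k H × H), (⟨dualSum G (hPar k H) f, dualSum_mem _ _ _⟩ :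
            (hPar k H).dilation) = (G.map fun t => dilRight (show HPar k H from
              (f : RegHom k H (hPar k H)) t.2.2) (dilGen t.1 t.2.1)).sum := by
          intro G
          induction G with
          | nil => rfl
          | cons t G ih =>
            rw [List.map_cons, List.sum_cons, ← ih, dilRight_dilGen]
            refine Subtype.ext ?_
            have e : dualSum (t :: G) (hPar k H) (f : RegHom k H (hPar k H)) =
              t.1 • (hPar k H).dilMap ((hPar k H).par t.2.1 ((f : RegHom k H (hPar k H)) t.2.2)) +
                dualSum G (hPar k H) (f : RegHom k H (hPar k H)) := rfl
            exact e.trans (congrArg (fun v => t.1 • (hPar k H).dilMap v +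
              dualSum G (hPar k H) (f : RegHom k H (hPar k H))) (par_hPar _ _))
        have h2 : f = (F.map fun t => dilRight (show HPar k H from
              (f : RegHom k H (hPar k H)) t.2.2) (dilGen t.1 t.2.1)).sum := by
          rw [← h1]
          exact Subtype.ext (hF _ _ (dilation_le_covariant _ f.2)).symm
        have h3 : ∀ G : List (H × HPar k H × H), (balanced M).mkQ (((G.map fun t =>
            dilRight (show HPar k H from (f : RegHom k H (hPar k H)) t.2.2)
              (dilGen t.1 t.2.1)).sum : (hPar k H).dilation) ⊗ₜ[k] m) =
            (G.map fun t => (balanced M).mkQ (dilGen t.1 t.2.1 ⊗ₜ[k]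
              (thetaLift M (f ⊗ₜ[k] m) : RegHom k H M) t.2.2)).sum := by
          intro G
          induction G with
          | nil => rw [List.map_nil, List.sum_nil, TensorProduct.zero_tmul, map_zero]; rfl
          | cons t G ih =>
            rw [List.map_cons, List.sum_cons, List.map_cons, List.sum_cons, TensorProduct.add_tmul,
              map_add, ih, thetaLift_tmul]
            congr 1
            rw [← sub_eq_zero, ← map_sub, Submodule.mkQ_apply, Submodule.Quotient.mk_eq_zero]
            exact Submodule.subset_span ⟨_, _, _, rfl⟩
        conv_lhs => rw [h2]
        exact h3 F
    refine (injective_iff_map_eq_zero _).2 fun z hz => ?_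
    obtain ⟨z, rfl⟩ := (balanced M).mkQ_surjective z
    have hz' : thetaLift M z = 0 := hz
    rw [key, List.sum_eq_zero]
    intro x hx
    obtain ⟨t, -, rfl⟩ := List.mem_map.1 hx
    have : ((thetaLift M z : M.dilation) : RegHom k H M) t.2.2 = 0 := by
      rw [hz']; rfl
    rw [this, TensorProduct.tmul_zero, map_zero]
  · rintro ⟨f, hf⟩
    induction hf using Submodule.span_induction with
    | mem x hx =>
      obtain ⟨m, rfl⟩ := hx
      -- `φ(1) ⊗ m` maps to `φ(m)`, and these elements generate the dilation over `H`.
      refine ⟨(balanced M).mkQ (dilGen 1 1 ⊗ₜ[k] m), Subtype.ext (RegHom.ext fun x => ?_)⟩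
      change M.par (HPar.mk k H (x * 1) * 1) m = M.act x m
      rw [mul_one, mul_one, par_mk]
    | zero => exact ⟨0, map_zero _⟩
    | add x y _ _ hx hy =>
      obtain ⟨v, hv⟩ := hx
      obtain ⟨w, hw⟩ := hy
      exact ⟨v + w, (map_add _ _ _).trans (by rw [hv, hw]; rfl)⟩
    | smul h x _ hx =>
      obtain ⟨v, hv⟩ := hx
      exact ⟨h • v, (map_smul _ _ _).trans (by rw [hv]; rfl)⟩

theorem parTensor_hom_ext {M : PMod k H} {P : Type*} [AddCommGroup P] [Module H P]
    {u v : parTensor M →ₗ[H] P}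
    (h : ∀ (f : (hPar k H).dilation) (m : M), u ((balanced M).mkQ (f ⊗ₜ[k] m)) =
      v ((balanced M).mkQ (f ⊗ₜ[k] m))) : u = v := by
  refine Submodule.linearMap_qext _ (LinearMap.ext fun t => ?_)
  induction t with
  | zero => rw [map_zero, map_zero]
  | add x y hx hy => rw [map_add, map_add, hx, hy]
  | tmul f m => exact h f m

/-- The natural isomorphism `D(H_par) ⊗_{H_par} - ≅ D`. -/
def parTensorIsoDilation (hH : IsPointed k H) (hG : Finite (GroupLike k H)) :
    parTensorFunctor k H ≅ dilationFunctor k H :=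
  NatIso.ofComponents (fun M => (LinearEquiv.ofBijective (theta M)
    (theta_bijective hH hG M)).toModuleIso) (fun {M N} g => by
      refine ModuleCat.hom_ext (parTensor_hom_ext fun f m => ?_)
      exact Subtype.ext (RegHom.ext fun x => (map_par g _ m).symm))

end PMod

namespace PMod

variable {k H : Type u} [Field k] [Ring H] [HopfAlgebra k H]

/-! ### The left adjoint -/

section LeftAdjoint

variable {N : Type u} [AddCommGroup N] [Module k N] [Module H N] [IsScalarTower k H N]
  {M : PMod k H}

/-- Morphisms `A_par ⊗ N → M` correspond to `H`-linear maps from `N` to the dilation of `M`. -/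
def unitEvalEquiv (hM : M.dilation = M.covariant) :
    ((aPar k H).tensorGlobal N ⟶ M) ≃ (N →ₗ[H] M.dilation) where
  toFun u :=
    { toFun n := ⟨unitEval u n, hM.symm ▸ unitEval_mem u n⟩
      map_add' n n' := Subtype.ext (RegHom.ext fun x => by
        change unitEval u (n + n') x = unitEval u n x + unitEval u n' x
        rw [unitEval_apply, smul_add, TensorProduct.tmul_add]
        exact map_add (Hom.toLin u) _ _)
      map_smul' h n := Subtype.ext (smul_unitEval u h n).symm }
  invFun v := ofUnitEval (M.dilation.subtype ∘ₗ v) fun n => hM ▸ (v n).2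
  left_inv u := hom_ext_unitEval fun n => unitEval_ofUnitEval _ _ n
  right_inv v := LinearMap.ext fun n => Subtype.ext (unitEval_ofUnitEval _ _ n)

end LeftAdjoint

-- Global modules get their `k`-structure by restriction along `k → H`, which makes `A_par ⊗ N`
-- available for an arbitrary `H`-module `N`.
attribute [local instance] ModuleCat.moduleOfAlgebraModule
  ModuleCat.isScalarTower_of_algebra_moduleCat

/-- The left adjoint is `N ↦ A_par ⊗ N`, through `unitEvalEquiv`. -/
theorem dilationFunctor_isRightAdjoint (hD : ∀ M : PMod k H, M.dilation = M.covariant) :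
    (dilationFunctor k H).IsRightAdjoint :=
  (Adjunction.adjunctionOfEquivLeft (G := dilationFunctor k H)
    (F_obj := fun N : ModuleCat.{u} H => (aPar k H).tensorGlobal N)
    (fun N M => (unitEvalEquiv (hD M)).trans
      (ModuleCat.homEquiv (M := N) (N := ModuleCat.of H M.dilation)).symm)
    (fun _ _ _ _ _ => rfl)).isRightAdjoint

/-! ### The right adjoint -/

/-- The partial module associated with a representation of `H_par`. -/
def ofAlgHom {V : Type u} [AddCommGroup V] [Module k V] (ρ : HPar k H →ₐ[k] Module.End k V) :
    PMod k H where
  carrier := V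
  act := ρ.toLinearMap ∘ₗ HPar.mk k H
  isPartialRep := (HPar.mk_isPartialRep k H).algHom_comp ρ

theorem par_ofAlgHom {V : Type u} [AddCommGroup V] [Module k V]
    (ρ : HPar k H →ₐ[k] Module.End k V) : (ofAlgHom ρ).par = ρ := by
  refine AlgHom.ext fun y => ?_
  induction y using HPar.induction_mk with
  | halg c => exact (AlgHom.commutes _ c).trans (AlgHom.commutes ρ c).symm
  | hmk h => exact par_mk (ofAlgHom ρ) h
  | hadd x y hx hy =>
    exact (map_add _ x y).trans ((congrArg₂ (· + ·) hx hy).trans (map_add ρ x y).symm)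
  | hmul x y hx hy =>
    exact (map_mul _ x y).trans ((congrArg₂ (· * ·) hx hy).trans (map_mul ρ x y).symm)

theorem dilRight_add (y z : HPar k H) (f : (hPar k H).dilation) :
    dilRight (y + z) f = dilRight y f + dilRight z f :=
  Subtype.ext (RegHom.ext fun x => show (show HPar k H from (f : RegHom k H (hPar k H)) x) *
    (y + z) = _ from mul_add _ _ _)

theorem dilRight_smul (c : k) (y : HPar k H) (f : (hPar k H).dilation) :
    dilRight (c • y) f = c • dilRight y f := by
  refine Subtype.ext (RegHom.ext fun x => ?_)
  exact mul_smul_comm c (show HPar k H from (f : RegHom k H (hPar k H)) x) y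

section RightAdjoint

variable (Y : Type u) [AddCommGroup Y] [Module k Y] [Module H Y] [IsScalarTower k H Y]

/-- The action of `H_par` on `Hom_H(D(H_par), Y)` by `(y u)(f) = u(f ◁ y)`. -/
def dilHomRep : HPar k H →ₐ[k] Module.End k ((hPar k H).dilation →ₗ[H] Y) :=
  AlgHom.ofLinearMap
    { toFun y :=
        { toFun u := u ∘ₗ dilRight y
          map_add' _ _ := rfl
          map_smul' _ _ := rfl }
      map_add' y z := LinearMap.ext fun u => LinearMap.ext fun f =>
        (congrArg u (dilRight_add y z f)).trans (map_add u (dilRight y f) (dilRight z f))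
      map_smul' c y := LinearMap.ext fun u => LinearMap.ext fun f =>
        (congrArg u (dilRight_smul c y f)).trans (LinearMap.map_smul_of_tower u c (dilRight y f)) }
    (LinearMap.ext fun u => LinearMap.ext fun f =>
      congrArg u (Subtype.ext (RegHom.ext fun x => mul_one (show HPar k H from
          (f : RegHom k H (hPar k H)) x))))
    (fun y z => LinearMap.ext fun u => LinearMap.ext fun f =>
      congrArg u (Subtype.ext (RegHom.ext fun x => (mul_assoc (show HPar k H from
          (f : RegHom k H (hPar k H)) x) y z).symm)))

/-- The partial module `Hom_H(D(H_par), Y)`. -/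
def dilHom : PMod k H := ofAlgHom (dilHomRep (k := k) Y)

variable {Y} {M : PMod k H}

/-- The bilinear map `(f, m) ↦ v(m)(f)`. -/
def dilHomBilin (v : M ⟶ dilHom Y) : (hPar k H).dilation →ₗ[H] M →ₗ[k] Y where
  toFun f :=
    { toFun m := (show (hPar k H).dilation →ₗ[H] Y from Hom.toLin v m) f
      map_add' m n := LinearMap.congr_fun (map_add (Hom.toLin v) m n) f
      map_smul' c m := LinearMap.congr_fun (map_smul (Hom.toLin v) c m) f }
  map_add' f g := LinearMap.ext fun m =>
    map_add (show (hPar k H).dilation →ₗ[H] Y from Hom.toLin v m) f g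
  map_smul' h f := LinearMap.ext fun m =>
    map_smul (show (hPar k H).dilation →ₗ[H] Y from Hom.toLin v m) h f

/-- A morphism of partial modules is `H_par`-linear, and `y` acts on `dilHom Y` by precomposition
with `◁ y`; this is the balancing condition. -/
theorem balanced_le_ker_lift (v : M ⟶ dilHom Y) :
    balanced M ≤ LinearMap.ker (TensorProduct.AlgebraTensorModule.lift (dilHomBilin v)) := by
  refine Submodule.span_le.2 ?_
  rintro _ ⟨f, y, m, rfl⟩
  rw [SetLike.mem_coe, LinearMap.mem_ker, map_sub, sub_eq_zero]
  have e := (map_par v y m).trans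
    (LinearMap.congr_fun (DFunLike.congr_fun (par_ofAlgHom (dilHomRep (k := k) Y)) y) _)
  exact (LinearMap.congr_fun (show _ = (show (hPar k H).dilation →ₗ[H] Y from Hom.toLin v m) ∘ₗ
    dilRight y from e) f).symm

/-- The linear map `m ↦ (f ↦ β(f, m))`. -/
def flipDil (β : (hPar k H).dilation →ₗ[H] M →ₗ[k] Y) : M →ₗ[k] (hPar k H).dilation →ₗ[H] Y where
  toFun m :=
    { toFun f := β f m
      map_add' f g := LinearMap.congr_fun (map_add β f g) m
      map_smul' h f := LinearMap.congr_fun (map_smul β h f) m }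
  map_add' m n := LinearMap.ext fun f => map_add (β f) m n
  map_smul' c m := LinearMap.ext fun f => map_smul (β f) c m

/-- The linear map `m ↦ (f ↦ w(f ⊗ m))`. -/
def curryDil (w : parTensor M →ₗ[H] Y) : M →ₗ[k] (hPar k H).dilation →ₗ[H] Y :=
  flipDil (TensorProduct.AlgebraTensorModule.curry (w ∘ₗ (balanced M).mkQ))

/-- `H`-linear maps `D(H_par) ⊗_{H_par} M → Y` correspond to morphisms
`M → Hom_H(D(H_par), Y)`. -/
def parTensorEquiv : (parTensor M →ₗ[H] Y) ≃ (M ⟶ dilHom Y) where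
  toFun w :=
    { toLin := curryDil w
      map_act h m := LinearMap.ext fun f => by
        change w ((balanced M).mkQ (f ⊗ₜ[k] M.act h m)) =
          w ((balanced M).mkQ (dilRight (HPar.mk k H h) f ⊗ₜ[k] m))
        refine congrArg w ((Submodule.Quotient.eq _).2 ?_).symm
        exact Submodule.subset_span ⟨f, HPar.mk k H h, m, by rw [par_mk]⟩ }
  invFun v := (balanced M).liftQ _ (balanced_le_ker_lift v)
  left_inv w := parTensor_hom_ext fun _ _ => rfl
  right_inv v := rfl

end RightAdjoint

/-- Tensor-Hom adjunction for the bimodule `D(H_par)`; the right adjoint is `Y ↦ Hom_H(D(H_par),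
Y)`. -/
theorem parTensorFunctor_isLeftAdjoint : (parTensorFunctor k H).IsLeftAdjoint :=
  (Adjunction.adjunctionOfEquivRight (F := parTensorFunctor k H)
    (G_obj := fun Y : ModuleCat.{u} H => dilHom (k := k) Y)
    (fun M Y => (ModuleCat.homEquiv (M := ModuleCat.of H (parTensor M)) (N := Y)).trans
      parTensorEquiv)
    (fun _ _ _ _ _ => rfl)).isLeftAdjoint

end PMod

end PartialHopf

end

theorem mainTheorem9 (k H : Type u) [Field k] [CharZero k] [Ring H] [HopfAlgebra k H]
    (hS : Function.Bijective (antipode k : H →ₗ[k] H))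
    (hpointed : PartialHopf.IsPointed k H) (hG : Finite (GroupLike k H)) :
    (PartialHopf.IsExactFunctor (PartialHopf.PMod.dilationFunctor k H) ∧
      PreservesFiniteLimits (PartialHopf.PMod.dilationFunctor k H) ∧
      PreservesFiniteColimits (PartialHopf.PMod.dilationFunctor k H)) ∧
    (PartialHopf.PMod.dilationFunctor k H).IsRightAdjoint ∧
    (PartialHopf.PMod.dilationFunctor k H).IsLeftAdjoint ∧
    Nonempty (PartialHopf.PMod.dilationFunctor k H ≅
      PartialHopf.PMod.homFunctor (PartialHopf.PMod.aPar k H)) ∧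
    Nonempty (PartialHopf.PMod.homFunctor (PartialHopf.PMod.aPar k H) ≅
      PartialHopf.PMod.parTensorFunctor k H) := by
  have hD := fun M => PartialHopf.PMod.dilation_eq_covariant (k := k) hpointed hG M
  have e := PartialHopf.PMod.dilationIsoHom hD
  have e' := PartialHopf.PMod.parTensorIsoDilation hpointed hG
  have hR := PartialHopf.PMod.dilationFunctor_isRightAdjoint hD
  have := PartialHopf.PMod.parTensorFunctor_isLeftAdjoint (k := k) (H := H)
  have hL := Functor.isLeftAdjoint_of_iso e'
  -- The categorical form of exactness follows from the two adjoints, the one on short exact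
  -- sequences from `dilationFunctor_exact`.
  have : PreservesLimitsOfSize.{0, 0} (PartialHopf.PMod.dilationFunctor k H) :=
    (Adjunction.ofIsRightAdjoint _).rightAdjoint_preservesLimits
  have : PreservesColimitsOfSize.{0, 0} (PartialHopf.PMod.dilationFunctor k H) :=
    (Adjunction.ofIsLeftAdjoint _).leftAdjoint_preservesColimits
  exact ⟨⟨PartialHopf.PMod.dilationFunctor_exact hD, inferInstance, inferInstance⟩, hR, hL, ⟨e⟩,
    ⟨e.symm ≪≫ e'.symm⟩⟩
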